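/- For $s\in\mathbb{C}$ with $s\ne 0$, $s^4\neq 1$ put $c(s)=\frac{(s^2+1)^2}{4s^2}$ and consider the elliptic curves $$E_s\colon y^2=(x^2-s^2)\bigl(x^2-\tfrac1{s^2}\bigr)\ \text{ with origin }(s,0),\qquad E'_s\colon y^2=x(x-1)(x-c(s))\ \text{ with origin }(c(s),0)$$ over $\mathbb{C}$, the isogeny $\psi\colon E_s\to E'_s$, $(x,y)\mapsto\bigl(\frac{(x^2+1)^2}{4x^2},\frac{(x^4-1)y}{8x^3}\bigr)$, and the isomorphism of elliptic curves $\lambda_s\colon E_s\to E'_s$, $(x,y)\mapsto\bigl(\frac{(s^2+1)(sx+1)}{2s(x+s)},\frac{(s^4-1)y}{4s(x+s)^2}\bigr)$, which satisfies $\psi=[2]\circ\lambda_s$. For $t\in\mathbb{C}$ with $t\neq0$, $t^{12}\ne1$ let $C_t\colon y^2=(x^3-1)(x^3-t^{12})$, a curve of genus $2$, with automorphisms $\iota(x,y)=(x,-y)$, $\sigma(x,y)=(\zeta x,y)$ (where $\zeta$ is a primitive third root of unity), $\tau(x,y)=(t^4/x,\,t^6y/x^3)$ and the point $0^+=(0,t^6)$.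 Let $s_1,s_2$ be two such parameters with $c(s_1)\ne c(s_2)$, and let $\pi_j\colon E_{s_j}\to\mathbb{P}^1$ be the $x$-coordinate maps. Assume that there are points $S_1\in E_{s_1}$, $S_2\in E_{s_2}$ of exact order $3$ with $\pi_1(S_1)=\pi_2(S_2)$. Let $C$ be the normalization of $E'_{s_1}\times_{\mathbb{P}^1}E'_{s_2}$ (fiber product with respect to the $x$-coordinate maps). (1) There are $t\in\mathbb{C}$ with $t\ne0$, $t^{12}\neq1$ and an isomorphism $\kappa\colon C_t\to C$ such that the compositions $\phi_j\colon C_t\to C\to E'_{s_j}$ of $\kappa$ with the two projections are the quotient maps by $\langle\tau\rangle$ (for $j=1$) and by $\langle\tau\iota\rangle$ (for $j=2$), and $\phi_j(0^+)=\psi(S_j)$ for $j=1,2$. (2) Fix any such $t$, $\kappa$ and any primitive third root of unity $\zeta$. Let $\theta_j\colon J(C_t)\to E'_{s_j}$ and $\theta_j^\vee\colon E'_{s_j}\to J(C_t)$ be the homomorphisms induced by $\phi_j$ and by pull-back of divisors under $\phi_j$, and let $\varphi_{12}\colon E_{s_1}\to E_{s_2}$ and $\varphi_{21}\colon E_{s_2}\to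 E_{s_1}$ be the homomorphisms corresponding to $\theta_2\circ\sigma\circ\theta_1^\vee$ and $\theta_1\circ\sigma\circ\theta_2^\vee$ under the isomorphisms $\lambda_{s_1}$, $\lambda_{s_2}$. Then for all $P_1\in E_{s_1}$, $P_2\in E_{s_2}$ with $\pi_1(P_1)=\pi_2(P_2)$ and for each choice of the sign (the same on both sides) we have $$\pi_1\bigl([2]^{-1}(-P_1\pm\varphi_{21}(P_2))\bigr)=\pi_2\bigl([2]^{-1}(-P_2\pm\varphi_{12}(P_1))\bigr)$$ as subsets of $\mathbb{P}^1(\mathbb{C})$; moreover $\pi_1(P_1+E_{s_1}[2])=\pi_2(P_2+E_{s_2}[2])$, and if $P_1$ and $P_2$ are torsion points, then all the elements of these three sets are $x$-coordinates of torsion points on both $E_{s_1}$ and $E_{s_2}$. (3) In the situation of (2), for all but finitely many $\xi\in\mathbb{P}^1(\mathbb{C})$ the following holds for all $P_1,P_2$ with $\pi_1(P_1)=\pi_2(P_2)=\xi$: the set $\pi_1(P_1+E_{s_1}[2])$ has four elements, and the two sets $\pi_1([2]^{-1}(-P_1\pm\varphi_{21}(P_2)))$ together contain exactly eight further elements. 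-/

import Mathlib

noncomputable section

open scoped Classical

namespace PoonenPairs

/-! ### Double covers of the projective line -/

/-- A (homogeneous) form `F(X, Z)` of degree `2 * n` over `ℂ`. -/
structure BinForm (n : ℕ) where
  eval : ℂ → ℂ → ℂ
  homog : ∀ r X Z, eval (r * X) (r * Z) = r ^ (2 * n) * eval X Z

/-- The complex points of `Y ^ 2 = F(X, Z)` in the weighted projective plane with weights
`(1, n, 1)`, which is the smooth projective model of `y ^ 2 = F(x, 1)` when the form `F`, of degree
`2 * n`, is squarefree. Each point is represented by its unique coordinate vector with `Z = 1`
(the affine point `(x, y) = (X, Y)`), or with `Z = 0` and `X = 1` (a point over `x = ∞`, where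
`Y` is the value of `y / x ^ n`). -/
@[ext]
structure Cover {n : ℕ} (F : BinForm n) where
  X : ℂ
  Y : ℂ
  Z : ℂ
  eqn : Y ^ 2 = F.eval X Z
  norm : Z = 1 ∨ (Z = 0 ∧ X = 1)

namespace Cover

variable {n : ℕ} {F : BinForm n}

/-- The point with weighted homogeneous coordinates `[X : Y : Z]`. -/
def ofCoords (F : BinForm n) (X Y Z : ℂ) (h : Y ^ 2 = F.eval X Z) (h0 : X ≠ 0 ∨ Z ≠ 0) :
    Cover F :=
  if hZ : Z = 0 then
    { X := 1
      Y := Y / X ^ n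
      Z := 0
      eqn := by
        have hX : X ≠ 0 := h0.resolve_right (not_not.mpr hZ)
        have := F.homog X⁻¹ X Z
        rw [hZ, mul_zero, inv_mul_cancel₀ hX, ← hZ, ← h, hZ] at this
        rw [this, div_pow, ← pow_mul, inv_pow, mul_comm n 2]
        field_simp
      norm := Or.inr ⟨rfl, rfl⟩ }
  else
    { X := X / Z
      Y := Y / Z ^ n
      Z := 1
      eqn := by
        have := F.homog Z⁻¹ X Z
        rw [inv_mul_cancel₀ hZ, ← h, inv_mul_eq_div] at this
        rw [this, div_pow, ← pow_mul, inv_pow, mul_comm n 2]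
        field_simp
      norm := Or.inl rfl }

/-- The `x`-coordinate map to the projective line. -/
def x (P : Cover F) : OnePoint ℂ :=
  if P.Z = 0 then OnePoint.infty else ((P.X : ℂ) : OnePoint ℂ)

theorem ne_zero (P : Cover F) : P.X ≠ 0 ∨ P.Z ≠ 0 := by
  rcases P.norm with h | h
  · exact Or.inr (by rw [h]; exact one_ne_zero)
  · exact Or.inl (by rw [h.2]; exact one_ne_zero)

/-- The normalized coordinates of `ofCoords` are proportional to the given ones. -/
theorem ofCoords_spec (X Y Z : ℂ) (h : Y ^ 2 = F.eval X Z) (h0 : X ≠ 0 ∨ Z ≠ 0) :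
    ∃ r : ℂ, r ≠ 0 ∧ (ofCoords F X Y Z h h0).X = r * X ∧ (ofCoords F X Y Z h h0).Y = r ^ n * Y ∧
      (ofCoords F X Y Z h h0).Z = r * Z := by
  unfold ofCoords
  split_ifs with hZ
  · have hX : X ≠ 0 := h0.resolve_right (not_not.mpr hZ)
    refine ⟨X⁻¹, inv_ne_zero hX, ?_, ?_, ?_⟩
    · simp [hX]
    · simp only [inv_pow]; field_simp
    · simp [hZ]
  · refine ⟨Z⁻¹, inv_ne_zero hZ, ?_, ?_, ?_⟩
    · simp only; field_simp
    · simp only [inv_pow]; field_simp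
    · simp [hZ]

/-- Points with proportional coordinates are equal. -/
theorem eq_of_proportional {P Q : Cover F} (r : ℂ) (hr : r ≠ 0) (hX : P.X = r * Q.X)
    (hY : P.Y = r ^ n * Q.Y) (hZ : P.Z = r * Q.Z) : P = Q := by
  have hr1 : r = 1 := by
    rcases P.norm with h | h <;> rcases Q.norm with h' | h'
    · rw [h, h'] at hZ; simpa using hZ.symm
    · rw [h, h'.1] at hZ; simp at hZ
    · rw [h.1, h'] at hZ; simp at hZ; exact absurd hZ.symm hr
    · rw [h.2, h'.2] at hX; simpa using hX.symm
  subst hr1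
  apply Cover.ext <;> simp_all

end Cover

/-- An isomorphism between two double covers of the projective line, over an automorphism of the
projective line: it is given by `(x, y) ↦ ((a x + b) / (c x + d), e y / (c x + d) ^ n)`. (For
`n = 3`, i.e. for curves of genus two, every isomorphism of curves is of this form.) -/
structure CoverIso {n : ℕ} (F G : BinForm n) where
  a : ℂ
  b : ℂ
  c : ℂ
  d : ℂ
  e : ℂ
  det_ne : a * d - b * c ≠ 0
  e_ne : e ≠ 0
  eqn : ∀ X Z, G.eval (a * X + b * Z) (c * X + d * Z) = e ^ 2 * F.eval X Z

namespace CoverIso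

variable {n : ℕ} {F G : BinForm n}

/-- The map on points of an isomorphism of double covers. -/
def map (f : CoverIso F G) (P : Cover F) : Cover G :=
  Cover.ofCoords G (f.a * P.X + f.b * P.Z) (f.e * P.Y) (f.c * P.X + f.d * P.Z)
    (by rw [f.eqn, mul_pow, P.eqn])
    (by
      by_contra! h
      obtain ⟨h1, h2⟩ := h
      have hX : (f.a * f.d - f.b * f.c) * P.X = 0 := by linear_combination f.d * h1 - f.b * h2
      have hZ : (f.a * f.d - f.b * f.c) * P.Z = 0 := by linear_combination f.a * h2 - f.c * h1
      rcases P.ne_zero with h | h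
      · exact h ((mul_eq_zero.mp hX).resolve_left f.det_ne)
      · exact h ((mul_eq_zero.mp hZ).resolve_left f.det_ne))

/-- The inverse isomorphism. -/
def symm (f : CoverIso F G) : CoverIso G F where
  a := f.d
  b := -f.b
  c := -f.c
  d := f.a
  e := (f.a * f.d - f.b * f.c) ^ n / f.e
  det_ne := by
    have := f.det_ne
    intro h
    apply this
    linear_combination h
  e_ne := div_ne_zero (pow_ne_zero _ f.det_ne) f.e_ne
  eqn X Z := by
    have h := f.eqn (f.d * X + -f.b * Z) (-f.c * X + f.a * Z)
    have h1 : f.a * (f.d * X + -f.b * Z) + f.b * (-f.c * X + f.a * Z)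
        = (f.a * f.d - f.b * f.c) * X := by ring
    have h2 : f.c * (f.d * X + -f.b * Z) + f.d * (-f.c * X + f.a * Z)
        = (f.a * f.d - f.b * f.c) * Z := by ring
    rw [h1, h2, G.homog] at h
    have he := f.e_ne
    rw [div_pow, div_mul_eq_mul_div, eq_div_iff (pow_ne_zero 2 he), mul_comm (F.eval _ _), ← h,
      ← pow_mul, mul_comm n 2]

theorem map_spec (f : CoverIso F G) (P : Cover F) :
    ∃ r : ℂ, r ≠ 0 ∧ (f.map P).X = r * (f.a * P.X + f.b * P.Z) ∧
      (f.map P).Y = r ^ n * (f.e * P.Y) ∧ (f.map P).Z = r * (f.c * P.X + f.d * P.Z) :=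
  Cover.ofCoords_spec _ _ _ _ _

theorem symm_map_map (f : CoverIso F G) (P : Cover F) : f.symm.map (f.map P) = P := by
  obtain ⟨r, hr, hX, hY, hZ⟩ := f.map_spec P
  obtain ⟨r', hr', hX', hY', hZ'⟩ := f.symm.map_spec (f.map P)
  have he := f.e_ne
  refine Cover.eq_of_proportional (r' * r * (f.a * f.d - f.b * f.c))
    (mul_ne_zero (mul_ne_zero hr' hr) f.det_ne) ?_ ?_ ?_
  · rw [hX', hX, hZ]; simp only [symm]; ring
  · rw [hY', hY]; simp only [symm, mul_pow]; field_simp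
  · rw [hZ', hX, hZ]; simp only [symm]; ring

theorem map_symm_map (f : CoverIso F G) (P : Cover G) : f.map (f.symm.map P) = P := by
  obtain ⟨r, hr, hX, hY, hZ⟩ := f.symm.map_spec P
  obtain ⟨r', hr', hX', hY', hZ'⟩ := f.map_spec (f.symm.map P)
  have he := f.e_ne
  refine Cover.eq_of_proportional (r' * r * (f.a * f.d - f.b * f.c))
    (mul_ne_zero (mul_ne_zero hr' hr) f.det_ne) ?_ ?_ ?_
  · rw [hX', hX, hZ]; simp only [symm]; ring
  · rw [hY', hY]; simp only [symm, mul_pow]; field_simp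
  · rw [hZ', hX, hZ]; simp only [symm]; ring

/-- The bijection on points given by an isomorphism of double covers. -/
def toEquiv (f : CoverIso F G) : Cover F ≃ Cover G where
  toFun := f.map
  invFun := f.symm.map
  left_inv := f.symm_map_map
  right_inv := f.map_symm_map

end CoverIso

/-! ### The elliptic curves `E_s` and `E'_s` -/

/-- The admissible parameters: `s ≠ 0` and `s ^ 4 ≠ 1`, so that the four branch points
`±s`, `±1/s` are distinct. -/
structure Param where
  s : ℂ
  s_ne : s ≠ 0
  s_pow : s ^ 4 ≠ 1

namespace Param

/-- The branch point `c = (s ^ 2 + 1) ^ 2 / (4 s ^ 2)` of `E'_s`. -/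
def c (p : Param) : ℂ := (p.s ^ 2 + 1) ^ 2 / (4 * p.s ^ 2)

theorem sq_add_ne (p : Param) : p.s ^ 2 + 1 ≠ 0 := fun h =>
  p.s_pow (by linear_combination (p.s ^ 2 - 1) * h)

theorem sq_sub_ne (p : Param) : p.s ^ 2 - 1 ≠ 0 := fun h =>
  p.s_pow (by linear_combination (p.s ^ 2 + 1) * h)

theorem c_ne_zero (p : Param) : p.c ≠ 0 :=
  div_ne_zero (pow_ne_zero _ p.sq_add_ne) (mul_ne_zero (by norm_num) (pow_ne_zero _ p.s_ne))

theorem c_ne_one (p : Param) : p.c ≠ 1 := by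
  intro h
  have hs := p.s_ne
  unfold c at h
  rw [div_eq_one_iff_eq (mul_ne_zero (by norm_num) (pow_ne_zero _ hs))] at h
  exact pow_ne_zero 2 p.sq_sub_ne (by linear_combination h)

end Param

/-- The form of `E_s : y ^ 2 = (x ^ 2 - s ^ 2) (x ^ 2 - 1 / s ^ 2)`. -/
def formE (p : Param) : BinForm 2 where
  eval X Z := (X ^ 2 - p.s ^ 2 * Z ^ 2) * (X ^ 2 - 1 / p.s ^ 2 * Z ^ 2)
  homog r X Z := by ring

/-- The form of `E'_s : y ^ 2 = x (x - 1) (x - c)`. -/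
def formE' (p : Param) : BinForm 2 where
  eval X Z := X * (X - Z) * (X - p.c * Z) * Z
  homog r X Z := by ring

/-- The curve `E_s`. -/
abbrev E (p : Param) : Type := Cover (formE p)

/-- The curve `E'_s`. -/
abbrev E' (p : Param) : Type := Cover (formE' p)

/-- `y ^ 2 = x (x - 1) (x - c)` as a Weierstrass curve. -/
def weierstrass (p : Param) : WeierstrassCurve.Affine ℂ :=
  { a₁ := 0, a₂ := -(1 + p.c), a₃ := 0, a₄ := p.c, a₆ := 0 }

theorem weierstrass_equation (p : Param) (x y : ℂ) :
    (weierstrass p).Equation x y ↔ y ^ 2 = x * (x - 1) * (x - p.c) := by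
  rw [WeierstrassCurve.Affine.equation_iff]
  simp only [weierstrass]
  constructor <;> intro h <;> linear_combination h

theorem weierstrass_disc (p : Param) : (weierstrass p).Δ ≠ 0 := by
  have h : (weierstrass p).Δ = 16 * p.c ^ 2 * (p.c - 1) ^ 2 := by
    simp only [weierstrass, WeierstrassCurve.Δ, WeierstrassCurve.b₂, WeierstrassCurve.b₄,
      WeierstrassCurve.b₆, WeierstrassCurve.b₈]
    ring
  rw [h]
  exact mul_ne_zero (mul_ne_zero (by norm_num) (pow_ne_zero _ p.c_ne_zero))
    (pow_ne_zero _ (sub_ne_zero.mpr p.c_ne_one))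

theorem weierstrass_nonsingular (p : Param) (x y : ℂ) :
    (weierstrass p).Nonsingular x y ↔ y ^ 2 = x * (x - 1) * (x - p.c) := by
  rw [← WeierstrassCurve.Affine.equation_iff_nonsingular_of_Δ_ne_zero (weierstrass_disc p),
    weierstrass_equation]

/-- The points of `E'_s` as points of the Weierstrass curve. -/
def E'.toWeierstrass (p : Param) : E' p ≃ (weierstrass p).Point where
  toFun P := if hZ : P.Z = 0 then .zero else .some P.X P.Y (by
    rw [weierstrass_nonsingular, P.eqn]
    have : P.Z = 1 := P.norm.resolve_right fun h => hZ h.1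
    simp [formE', this])
  invFun Q := match Q with
    | .zero => ⟨1, 0, 0, by simp [formE'], Or.inr ⟨rfl, rfl⟩⟩
    | .some x y h => ⟨x, y, 1, by
        rw [(weierstrass_nonsingular p x y).mp h]; simp [formE'], Or.inl rfl⟩
  left_inv P := by
    by_cases hZ : P.Z = 0
    · have hX : P.X = 1 := (P.norm.resolve_left fun h => by simp [hZ] at h).2
      have hY : P.Y = 0 := by
        have := P.eqn
        simpa [formE', hZ] using this
      simp only [dif_pos hZ]
      exact Cover.ext hX.symm hY.symm hZ.symm
    · simp only [dif_neg hZ]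
      exact Cover.ext rfl rfl (P.norm.resolve_right fun h => hZ h.1).symm
  right_inv Q := by
    cases Q <;> simp

/-- The origin `(c, 0)` of `E'_s`. -/
def E'.origin (p : Param) : E' p := ⟨p.c, 0, 1, by simp [formE'], Or.inl rfl⟩

/-- The group law of the elliptic curve `E'_s` with origin `(c, 0)`: it is the usual group law
(with origin the point at infinity) shifted by `(c, 0)`. -/
instance (p : Param) : AddCommGroup (E' p) :=
  ((E'.toWeierstrass p).trans
    (Equiv.subRight (E'.toWeierstrass p (E'.origin p)))).addCommGroup

theorem E'.zero_eq_origin (p : Param) : (0 : E' p) = E'.origin p := by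
  change (E'.toWeierstrass p).symm (0 + E'.toWeierstrass p (E'.origin p)) = _
  rw [zero_add, Equiv.symm_apply_apply]

/-- The isomorphism `λ_s : E_s → E'_s`,
`(x, y) ↦ ((s² + 1) (s x + 1) / (2 s (x + s)), (s⁴ - 1) y / (4 s (x + s)²))`, which maps the
origin `(s, 0)` of `E_s` to the origin of `E'_s` and satisfies `ψ = [2] ∘ λ_s`. -/
def lamIso (p : Param) : CoverIso (formE p) (formE' p) where
  a := (p.s ^ 2 + 1) * p.s
  b := p.s ^ 2 + 1
  c := 2 * p.s
  d := 2 * p.s ^ 2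
  e := p.s * (p.s ^ 4 - 1)
  det_ne := by
    have h : (p.s ^ 2 + 1) * p.s * (2 * p.s ^ 2) - (p.s ^ 2 + 1) * (2 * p.s)
        = 2 * p.s * (p.s ^ 2 + 1) * (p.s ^ 2 - 1) := by ring
    rw [h]
    exact mul_ne_zero (mul_ne_zero (mul_ne_zero two_ne_zero p.s_ne) p.sq_add_ne) p.sq_sub_ne
  e_ne := mul_ne_zero p.s_ne (sub_ne_zero.mpr p.s_pow)
  eqn X Z := by
    have := p.s_ne
    simp only [formE', formE, Param.c]
    field_simp
    ring

/-- The isomorphism `λ_s` on points. -/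
def lam (p : Param) : E p ≃ E' p := (lamIso p).toEquiv

/-- The origin `(s, 0)` of `E_s`. -/
def E.origin (p : Param) : E p := ⟨p.s, 0, 1, by simp [formE], Or.inl rfl⟩

/-- The group law of the elliptic curve `E_s` with origin `(s, 0)`, transported from `E'_s` by the
isomorphism `λ_s`, which respects the origins. -/
instance (p : Param) : AddCommGroup (E p) := (lam p).addCommGroup

theorem lam_origin (p : Param) : lam p (E.origin p) = E'.origin p := by
  obtain ⟨r, hr, hX, hY, hZ⟩ := (lamIso p).map_spec (E.origin p)
  have hs := p.s_ne
  refine Cover.eq_of_proportional (r * (4 * p.s ^ 2))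
    (mul_ne_zero hr (mul_ne_zero (by norm_num) (pow_ne_zero _ hs))) ?_ ?_ ?_
  · refine hX.trans ?_
    simp only [E.origin, E'.origin, lamIso, Param.c]
    field_simp
  · refine hY.trans ?_
    simp [E.origin, E'.origin]
  · refine hZ.trans ?_
    simp only [E.origin, E'.origin, lamIso]
    ring

theorem E.zero_eq_origin (p : Param) : (0 : E p) = E.origin p := by
  change (lam p).symm 0 = _
  rw [E'.zero_eq_origin, ← lam_origin, Equiv.symm_apply_apply]

/-- The isogeny `ψ : E_s → E'_s`,
`(x, y) ↦ ((x² + 1)² / (4 x²), (x⁴ - 1) y / (8 x³))`. -/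
def psi (p : Param) (P : E p) : E' p :=
  Cover.ofCoords (formE' p) ((P.X ^ 2 + P.Z ^ 2) ^ 2)
    (2 * P.X * P.Z * (P.X ^ 4 - P.Z ^ 4) * P.Y) (4 * P.X ^ 2 * P.Z ^ 2)
    (by
      have hs := p.s_ne
      rw [mul_pow, P.eqn]
      simp only [formE', formE, Param.c]
      field_simp
      ring)
    (by
      rcases P.norm with h | h
      · by_cases hX : P.X = 0
        · left; simp [hX, h]
        · right; simp [hX, h]
      · left; simp [h.1, h.2])

/-! ### The genus two curve attached to `E'_{s₁}` and `E'_{s₂}` -/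

/-- The form of the genus two curve which is the normalization of the fiber product
of `E'_{s₁}` and `E'_{s₂}` over the `x`-line. With `z = y₁ / y₂` one has
`x = (c₂ z² - c₁) / (z² - 1)`, and `w = (z² - 1)² y₂` satisfies
`w² = (c₂ - c₁) (z² - 1) (c₂ z² - c₁) ((c₂ - 1) z² - (c₁ - 1))`. -/
def formFib (p q : Param) : BinForm 3 where
  eval X Z := (q.c - p.c) * (X ^ 2 - Z ^ 2) * (q.c * X ^ 2 - p.c * Z ^ 2)
    * ((q.c - 1) * X ^ 2 - (p.c - 1) * Z ^ 2)
  homog r X Z := by ring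

theorem fib_ne {p q : Param} (h : p.c ≠ q.c) (P : Cover (formFib p q)) :
    q.c * P.X ^ 2 - p.c * P.Z ^ 2 ≠ 0 ∨ P.X ^ 2 - P.Z ^ 2 ≠ 0 := by
  by_contra! h0
  obtain ⟨h1, h2⟩ := h0
  have hd : q.c - p.c ≠ 0 := sub_ne_zero.mpr h.symm
  have hX : (q.c - p.c) * P.X ^ 2 = 0 := by linear_combination h1 - p.c * h2
  have hZ : (q.c - p.c) * P.Z ^ 2 = 0 := by linear_combination h1 - q.c * h2
  rcases P.ne_zero with h | h
  · exact h (pow_eq_zero_iff two_ne_zero |>.mp ((mul_eq_zero.mp hX).resolve_left hd))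
  · exact h (pow_eq_zero_iff two_ne_zero |>.mp ((mul_eq_zero.mp hZ).resolve_left hd))

/-- The projection `(z, w) ↦ (x, y₁) = ((c₂ z² - c₁) / (z² - 1), z w / (z² - 1)²)` to `E'_{s₁}`. -/
def proj₁ {p q : Param} (h : p.c ≠ q.c) (P : Cover (formFib p q)) : E' p :=
  Cover.ofCoords (formE' p) (q.c * P.X ^ 2 - p.c * P.Z ^ 2) (P.X * P.Y) (P.X ^ 2 - P.Z ^ 2)
    (by rw [mul_pow, P.eqn]; simp only [formE', formFib]; ring) (fib_ne h P)

/-- The projection `(z, w) ↦ (x, y₂) = ((c₂ z² - c₁) / (z² - 1), w / (z² - 1)²)` to `E'_{s₂}`. -/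
def proj₂ {p q : Param} (h : p.c ≠ q.c) (P : Cover (formFib p q)) : E' q :=
  Cover.ofCoords (formE' q) (q.c * P.X ^ 2 - p.c * P.Z ^ 2) (P.Z * P.Y) (P.X ^ 2 - P.Z ^ 2)
    (by rw [mul_pow, P.eqn]; simp only [formE', formFib]; ring) (fib_ne h P)

/-! ### Poonen's curves `C_t` -/

/-- The form of `C_t : y ^ 2 = (x ^ 3 - 1) (x ^ 3 - t ^ 12)`. -/
def formC (t : ℂ) : BinForm 3 where
  eval X Z := (X ^ 3 - Z ^ 3) * (X ^ 3 - t ^ 12 * Z ^ 3)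
  homog r X Z := by ring

/-- The curve `C_t`. -/
abbrev C (t : ℂ) : Type := Cover (formC t)

/-- The hyperelliptic involution `ι : (x, y) ↦ (x, -y)`. -/
def iota (t : ℂ) : CoverIso (formC t) (formC t) where
  a := 1
  b := 0
  c := 0
  d := 1
  e := -1
  det_ne := by norm_num
  e_ne := by norm_num
  eqn X Z := by simp

/-- The automorphism `σ : (x, y) ↦ (ζ x, y)`, where `ζ` is a primitive third root of unity. -/
def sigma (t : ℂ) {ζ : ℂ} (hζ : IsPrimitiveRoot ζ 3) : CoverIso (formC t) (formC t) where
  a := ζ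
  b := 0
  c := 0
  d := 1
  e := 1
  det_ne := by simpa using hζ.ne_zero (by norm_num)
  e_ne := one_ne_zero
  eqn X Z := by simp [formC, mul_pow, hζ.pow_eq_one]

/-- The involution `τ : (x, y) ↦ (t ^ 4 / x, t ^ 6 y / x ^ 3)`. -/
def tau {t : ℂ} (ht : t ≠ 0) : CoverIso (formC t) (formC t) where
  a := 0
  b := t ^ 4
  c := 1
  d := 0
  e := t ^ 6
  det_ne := by simpa using ht
  e_ne := pow_ne_zero _ ht
  eqn X Z := by simp only [formC]; ring

/-- The point `0⁺ = (0, t ^ 6)`. -/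
def zeroPlus (t : ℂ) : C t := ⟨0, t ^ 6, 1, by simp [formC]; ring, Or.inl rfl⟩

/-- The covering map `φ₁ : C_t → E'_{s₁}` obtained from an isomorphism `κ` of `C_t` with the
normalization of the fiber product. -/
def phi₁ {p q : Param} (h : p.c ≠ q.c) {t : ℂ} (κ : CoverIso (formC t) (formFib p q)) (Q : C t) :
    E' p := proj₁ h (κ.map Q)

/-- The covering map `φ₂ : C_t → E'_{s₂}` obtained from an isomorphism `κ` of `C_t` with the
normalization of the fiber product. -/
def phi₂ {p q : Param} (h : p.c ≠ q.c) {t : ℂ} (κ : CoverIso (formC t) (formFib p q)) (Q : C t) :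
    E' q := proj₂ h (κ.map Q)

/-- An isomorphism from `C_t` to the normalization of the fiber product of `E'_{s₁}` and `E'_{s₂}`
under which the projections to `E'_{s₁}` and `E'_{s₂}` (both of degree two) become the quotient
maps by `τ` and `τ ι`, and `0⁺` corresponds to the point `(ψ(S₁), ψ(S₂))`. -/
def IsModel {p q : Param} (h : p.c ≠ q.c) (S₁ : E p) (S₂ : E q) {t : ℂ} (ht : t ≠ 0)
    (κ : CoverIso (formC t) (formFib p q)) : Prop :=
  (∀ Q : C t, phi₁ h κ ((tau ht).map Q) = phi₁ h κ Q) ∧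
  (∀ Q : C t, phi₂ h κ ((tau ht).map ((iota t).map Q)) = phi₂ h κ Q) ∧
  phi₁ h κ (zeroPlus t) = psi p S₁ ∧
  phi₂ h κ (zeroPlus t) = psi q S₂

/-! ### The isogenies -/

/-- The pull-back of the divisor `[P]` under a quotient map `f : C → D` by an involution `α`
of `C`: each point `Q` above `P` is counted with its ramification index, which is `2` if `Q` is
fixed by `α` and `1` otherwise. -/
def pullPoint {C D : Type} (f : C → D) (α : C → C) (P : D) : C →₀ ℤ :=
  ∑ᶠ Q ∈ f ⁻¹' {P}, Finsupp.single Q (if α Q = Q then 2 else 1)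

/-- The divisor of degree zero representing the image of `P` under the map from an elliptic curve
to the Jacobian of `C` that is given by pull-back of divisors. -/
def pullBack {C D : Type} [AddCommGroup D] (f : C → D) (α : C → C) (P : D) : C →₀ ℤ :=
  pullPoint f α P - pullPoint f α 0

/-- The map from divisors (of degree zero) on `C` to an elliptic curve `D` that induces the
homomorphism from the Jacobian of `C` to `D` given by `f : C → D`. -/
def pushForward {C D : Type} [AddCommGroup D] (f : C → D) (δ : C →₀ ℤ) : D :=
  δ.sum fun Q n => n • f Q

section Isogenies

variable {p q : Param} (h : p.c ≠ q.c) {t : ℂ} (ht : t ≠ 0)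
  (κ : CoverIso (formC t) (formFib p q)) {ζ : ℂ} (hζ : IsPrimitiveRoot ζ 3)

/-- The isogeny `φ₁₂ = θ₂ ∘ σ ∘ θ₁^∨ : E'_{s₁} → E'_{s₂}`, computed on representing divisors;
here `θ₁^∨` is pull-back of divisors under `φ₁`, the quotient map by `τ`, and `θ₂` is induced
by `φ₂`. -/
def isog₁₂' (P : E' p) : E' q :=
  pushForward (phi₂ h κ) (Finsupp.mapDomain (sigma t hζ).map
    (pullBack (phi₁ h κ) (tau ht).map P))

/-- The isogeny `φ₂₁ = θ₁ ∘ σ ∘ θ₂^∨ : E'_{s₂} → E'_{s₁}`, computed on representing divisors;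
here `θ₂^∨` is pull-back of divisors under `φ₂`, the quotient map by `τ ι`, and `θ₁` is induced
by `φ₁`. -/
def isog₂₁' (P : E' q) : E' p :=
  pushForward (phi₁ h κ) (Finsupp.mapDomain (sigma t hζ).map
    (pullBack (phi₂ h κ) (fun Q => (tau ht).map ((iota t).map Q)) P))

/-- The isogeny `E_{s₁} → E_{s₂}` induced by `φ₁₂` via the isomorphisms `λ_{s₁}`, `λ_{s₂}`. -/
def isog₁₂ (P : E p) : E q := (lam q).symm (isog₁₂' h ht κ hζ (lam p P))

/-- The isogeny `E_{s₂} → E_{s₁}` induced by `φ₂₁` via the isomorphisms `λ_{s₁}`, `λ_{s₂}`. -/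
def isog₂₁ (P : E q) : E p := (lam p).symm (isog₂₁' h ht κ hζ (lam q P))

end Isogenies

/-- The set `π([2]⁻¹(R))` of `x`-coordinates of the points `P` with `[2] P = R`. -/
def halves {p : Param} (R : E p) : Set (OnePoint ℂ) := Cover.x '' {P : E p | 2 • P = R}

/-- The set `π(P + E[2])`. -/
def twoTranslates {p : Param} (P : E p) : Set (OnePoint ℂ) :=
  Cover.x '' {R : E p | ∃ T : E p, 2 • T = 0 ∧ R = P + T}

/-- The set `I(π₁, π₂)` of common `x`-coordinates of torsion points. -/
def commonTorsion (p q : Param) : Set (OnePoint ℂ) :=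
  Cover.x '' {P : E p | IsOfFinAddOrder P} ∩ Cover.x '' {P : E q | IsOfFinAddOrder P}

end PoonenPairs

end

/-! Put r = π₁(S₁) = π₂(S₂). An x-coordinate r of a point of order three on E_s satisfies s r⁴ +
2s²r³ - 2r - s = 0, which is quadratic in s. So s₁ and s₂ are its two roots, and with n = s₁/r the
quotient s₂/r is the involution `dual n`. Everything becomes rational in r² and n.

A curve with a point of order three can be written g² = k f³ + (1 - 3f)² (`flexCurve`). In this form
E'_{s₁} and E'_{s₂} have parameters k and l with k + l = -4, the case in which `isogX`, `isogY`,
`isogZ` give a three-isogeny between them. The images of S₁, S₂ under λ lie over f = 0. For points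
P₁, P₂ with the same x-coordinate the values f₁, f₂ at λ(P₁), λ(P₂) satisfy 1/f₁ + 1/f₂ = 1. Write
1/f₁ = V/U and 1/f₂ = W/U with U = V + W. The normalized y-coordinates are then square roots G₁, G₂
of the quartics F₁ = `flexQuartic k V U` and F₂ = `flexQuartic l W U`.

On C_t put T = t²Z. Since k t⁶ = -(t⁶ + 1)², the equation is Y² = X⁶ + (k + 2)X³T³ + T⁶, and φ₁, φ₂
become f₁ = XT/(X + T)², f₂ = -XT/(T - X)². Pulling back under φ₂, applying σ and pushing forward
under φ₁ sends φ₂(Q) to φ₁(σQ) - φ₁(σ²Q), because στ = τσ². The chord construction identifies this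
difference with the explicit three-isogeny (`sub_eq_isog`).

The heart is the choice of Q on C_t with X : T = G₁ - G₂ : G₁ + G₂. Up to sign, φ₁ maps Q, σQ, σ²Q
to λ(2P₁), λ(-P₁ + φ₂₁(P₂)), λ(-P₁ - φ₂₁(P₂)). Exchanging G₁ and G₂ gives the matching statement for
σQ, σ²Q and φ₂ (`two_nsmul_flex`, `neg_add_isog`, `exists_common_point`). Now φ₁ and φ₂ have the
same x-coordinate, and ψ = ±[2] ∘ λ acts on x-coordinates by (x² + 1)²/(4x²), where s does not
occur. Hence the sets of halves on both sides are fibers of one function over one point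
(`halves_eq`, `halves_congr`).

Torsion is preserved because the isogenies commute with doubling up to sign. For the count, the
three fibers over x(φ₁(Q)), x(φ₁(σQ)), x(φ₁(σ²Q)) have four elements each and are disjoint unless
X/T is ∞ or a root of a fixed polynomial. Each such value of X/T forces a linear relation between F₁
and F₂, which has finitely many solutions. For existence, the conditions on a model dictate t⁶ and
κ, and the required equation of forms is a comparison of four coefficients. -/

noncomputable section

open scoped Classical

namespace PoonenPairs

open WeierstrassCurve.Affine (Point)

/-! ### Addition on Weierstrass curves in weighted homogeneous coordinates -/

section Weierstrass

variable {W : WeierstrassCurve.Affine ℂ}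

/-- The point `T` has coordinates `[X : Y : Z]`, with weights `(1, 2, 1)`. -/
def Rep (T : W.Point) (X Y Z : ℂ) : Prop :=
  (Z = 0 ∧ X ≠ 0 ∧ T = 0) ∨ (Z ≠ 0 ∧ ∃ h, T = Point.some (X / Z) (Y / Z ^ 2) h)

theorem equation_of_short (h₁ : W.a₁ = 0) (h₃ : W.a₃ = 0) {x y : ℂ} :
    W.Equation x y ↔ y ^ 2 = x ^ 3 + W.a₂ * x ^ 2 + W.a₄ * x + W.a₆ := by
  rw [WeierstrassCurve.Affine.equation_iff, h₁, h₃]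
  ring_nf

theorem deriv_ne_of_short (h₁ : W.a₁ = 0) (h₃ : W.a₃ = 0) {x y : ℂ} (h : W.Nonsingular x y)
    (hy : y = 0) : 3 * x ^ 2 + 2 * W.a₂ * x + W.a₄ ≠ 0 := by
  rw [WeierstrassCurve.Affine.nonsingular_iff, h₁, h₃] at h
  rcases h.2 with h | h
  · simpa using h.symm
  · simp [hy] at h

theorem negY_of_short (h₁ : W.a₁ = 0) (h₃ : W.a₃ = 0) (x y : ℂ) : W.negY x y = -y := by
  rw [WeierstrassCurve.Affine.negY, h₁, h₃]
  ring

theorem some_eq_or_eq_neg {x y y' : ℂ} (h : W.Nonsingular x y) (h' : W.Nonsingular x y') :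
    Point.some x y h = Point.some x y' h' ∨ Point.some x y h = -Point.some x y' h' :=
  WeierstrassCurve.Affine.Point.X_eq_iff.mp rfl

theorem neg_some_of_short (h₁ : W.a₁ = 0) (h₃ : W.a₃ = 0) {x y x' y' : ℂ}
    (h : W.Nonsingular x y) (h' : W.Nonsingular x' y') (hx : x' = x) (hy : y' = -y) :
    -Point.some x y h = Point.some x' y' h' := by
  subst hx hy
  simp only [WeierstrassCurve.Affine.Point.neg_some, negY_of_short h₁ h₃]

/-- Three points of a line which is not vertical have sum zero. -/
theorem add_eq_neg_of_line (h₁ : W.a₁ = 0) (h₃ : W.a₃ = 0) {x₁ x₂ x₃ y₁ y₂ y₃ α β : ℂ}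
    (n₁ : W.Nonsingular x₁ y₁) (n₂ : W.Nonsingular x₂ y₂) (n₃ : W.Nonsingular x₃ y₃)
    (l₁ : y₁ = α * x₁ + β) (l₂ : y₂ = α * x₂ + β) (l₃ : y₃ = α * x₃ + β)
    (e₁ : x₁ + x₂ + x₃ = α ^ 2 - W.a₂) (e₂ : x₁ * x₂ + x₁ * x₃ + x₂ * x₃ = W.a₄ - 2 * α * β) :
    Point.some x₁ y₁ n₁ + Point.some x₂ y₂ n₂ = -Point.some x₃ y₃ n₃ := by
  have key : ¬(x₁ = x₂ ∧ y₁ = W.negY x₂ y₂) ∧ W.slope x₁ x₂ y₁ y₂ = α := by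
    by_cases hx : x₁ = x₂
    · have hy : y₁ = y₂ := by rw [l₁, l₂, hx]
      -- Here x₁ is a double root of the cubic minus the squared line, so the line is the tangent.
      have hd : 3 * x₁ ^ 2 + 2 * W.a₂ * x₁ + W.a₄ = 2 * α * y₁ := by
        subst hx
        linear_combination (-2 * x₁) * e₁ - e₂ - 2 * α * l₁ + 4 * x₁ * e₁ + 0 * l₃
      have hy0 : y₁ ≠ 0 := fun h => deriv_ne_of_short h₁ h₃ n₁ h (by rw [hd, h, mul_zero])
      have hne : y₁ ≠ W.negY x₂ y₂ := by
        rw [negY_of_short h₁ h₃, ← hy]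
        intro h
        apply hy0
        linear_combination h / 2
      refine ⟨fun h => hne h.2, ?_⟩
      rw [WeierstrassCurve.Affine.slope_of_Y_ne hx hne, h₁, negY_of_short h₁ h₃]
      rw [div_eq_iff (by intro h; apply hy0; linear_combination h / 2)]
      linear_combination hd
    · refine ⟨fun h => hx h.1, ?_⟩
      rw [WeierstrassCurve.Affine.slope_of_X_ne hx, div_eq_iff (sub_ne_zero.mpr hx), l₁, l₂]
      ring
  rw [WeierstrassCurve.Affine.Point.add_some key.1, eq_comm]
  apply neg_some_of_short h₁ h₃
  · rw [key.2, WeierstrassCurve.Affine.addX, h₁]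
    linear_combination -e₁
  · rw [key.2, WeierstrassCurve.Affine.addY, WeierstrassCurve.Affine.negAddY,
      negY_of_short h₁ h₃, WeierstrassCurve.Affine.addX, h₁, l₁, l₃]
    linear_combination α * e₁

/-- The `x`-coordinate of a sum, with sign: the coordinates of `A + B` satisfy two linear
equations, which characterize it up to sign. -/
theorem add_eq_or_eq_neg (h₁ : W.a₁ = 0) (h₃ : W.a₃ = 0) {A B C : W.Point}
    {X₁ Y₁ Z₁ X₂ Y₂ Z₂ X₃ Y₃ Z₃ : ℂ} (hA : Rep A X₁ Y₁ Z₁) (hB : Rep B X₂ Y₂ Z₂)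
    (hC : Rep C X₃ Y₃ Z₃)
    (e₁ : X₃ * (X₁ * Z₂ - X₂ * Z₁) ^ 2 = Z₃ * (X₁ * X₂ * (X₁ * Z₂ + X₂ * Z₁)
      + 2 * W.a₂ * X₁ * X₂ * Z₁ * Z₂ + W.a₄ * (X₁ * Z₂ + X₂ * Z₁) * Z₁ * Z₂
      + 2 * W.a₆ * Z₁ ^ 2 * Z₂ ^ 2 - 2 * Y₁ * Y₂))
    (e₂ : X₃ * (X₁ * X₂ * (X₁ * Z₂ + X₂ * Z₁)
      + 2 * W.a₂ * X₁ * X₂ * Z₁ * Z₂ + W.a₄ * (X₁ * Z₂ + X₂ * Z₁) * Z₁ * Z₂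
      + 2 * W.a₆ * Z₁ ^ 2 * Z₂ ^ 2 + 2 * Y₁ * Y₂) = Z₃ * ((X₁ * X₂ - W.a₄ * Z₁ * Z₂) ^ 2
      - 4 * W.a₆ * Z₁ * Z₂ * (X₁ * Z₂ + X₂ * Z₁ + W.a₂ * Z₁ * Z₂)))
    (hY₁ : Z₁ = 0 → Y₁ = 0) (hY₂ : Z₂ = 0 → Y₂ = 0) :
    A + B = C ∨ A + B = -C := by
  rcases hA with ⟨z₁, hX₁, rfl⟩ | ⟨z₁, n₁, rfl⟩
  · rw [zero_add]
    subst z₁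
    rcases hB with ⟨z₂, hX₂, rfl⟩ | ⟨z₂, n₂, rfl⟩ <;> rcases hC with ⟨z₃, hX₃, rfl⟩ | ⟨z₃, n₃, rfl⟩
    · simp
    · exfalso
      subst z₂
      apply mul_ne_zero z₃ (pow_ne_zero 2 (mul_ne_zero hX₁ hX₂))
      rw [hY₁ rfl] at e₂
      linear_combination -e₂
    · exfalso
      subst z₃
      apply mul_ne_zero hX₃ (pow_ne_zero 2 (mul_ne_zero hX₁ z₂))
      linear_combination e₁
    · rw [hY₁ rfl] at e₁
      have : X₃ / Z₃ = X₂ / Z₂ := by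
        rw [div_eq_div_iff z₃ z₂]
        apply mul_left_cancel₀ (mul_ne_zero (pow_ne_zero 2 hX₁) z₂)
        linear_combination e₁
      have h2 := some_eq_or_eq_neg (W := W) (x := X₂ / Z₂) n₂ (this ▸ n₃)
      grind
  rcases hB with ⟨z₂, hX₂, rfl⟩ | ⟨z₂, n₂, rfl⟩
  · rw [add_zero]
    subst z₂
    rcases hC with ⟨z₃, hX₃, rfl⟩ | ⟨z₃, n₃, rfl⟩
    · exfalso
      subst z₃
      apply mul_ne_zero hX₃ (pow_ne_zero 2 (mul_ne_zero hX₂ z₁))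
      linear_combination e₁
    · rw [hY₂ rfl] at e₁
      have : X₃ / Z₃ = X₁ / Z₁ := by
        rw [div_eq_div_iff z₃ z₁]
        apply mul_left_cancel₀ (mul_ne_zero (pow_ne_zero 2 hX₂) z₁)
        linear_combination e₁
      have h2 := some_eq_or_eq_neg (W := W) (x := X₁ / Z₁) n₁ (this ▸ n₃)
      grind
  obtain ⟨x₁, rfl⟩ : ∃ x, X₁ = x * Z₁ := ⟨X₁ / Z₁, by field_simp⟩
  obtain ⟨x₂, rfl⟩ : ∃ x, X₂ = x * Z₂ := ⟨X₂ / Z₂, by field_simp⟩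
  obtain ⟨y₁, rfl⟩ : ∃ x, Y₁ = x * Z₁ ^ 2 := ⟨Y₁ / Z₁ ^ 2, by field_simp⟩
  obtain ⟨y₂, rfl⟩ : ∃ x, Y₂ = x * Z₂ ^ 2 := ⟨Y₂ / Z₂ ^ 2, by field_simp⟩
  simp only [mul_div_cancel_right₀ _ z₁, mul_div_cancel_right₀ _ z₂,
    mul_div_cancel_right₀ _ (pow_ne_zero 2 z₁), mul_div_cancel_right₀ _ (pow_ne_zero 2 z₂)]
    at n₁ n₂ ⊢
  have q₁ := (equation_of_short h₁ h₃).mp n₁.1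
  have q₂ := (equation_of_short h₁ h₃).mp n₂.1
  have hZ : Z₁ ^ 2 * Z₂ ^ 2 ≠ 0 := mul_ne_zero (pow_ne_zero 2 z₁) (pow_ne_zero 2 z₂)
  replace e₁ : X₃ * (x₁ - x₂) ^ 2 = Z₃ * (x₁ * x₂ * (x₁ + x₂) + 2 * W.a₂ * x₁ * x₂
      + W.a₄ * (x₁ + x₂) + 2 * W.a₆ - 2 * y₁ * y₂) := by
    apply mul_left_cancel₀ hZ
    linear_combination e₁
  replace e₂ : X₃ * (x₁ * x₂ * (x₁ + x₂) + 2 * W.a₂ * x₁ * x₂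
      + W.a₄ * (x₁ + x₂) + 2 * W.a₆ + 2 * y₁ * y₂) = Z₃ * ((x₁ * x₂ - W.a₄) ^ 2
      - 4 * W.a₆ * (x₁ + x₂ + W.a₂)) := by
    apply mul_left_cancel₀ hZ
    linear_combination e₂
  -- `e₁` expresses x(A + B), while `e₂` expresses the product x(A + B) x(A - B). The second is
  -- needed exactly when the factor (x₁ - x₂)² in the first vanishes.
  by_cases hx : x₁ = x₂
  · subst hx
    by_cases hy : y₁ = W.negY x₁ y₂
    · rw [WeierstrassCurve.Affine.Point.add_of_Y_eq rfl hy]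
      rw [negY_of_short h₁ h₃] at hy
      have hy2 : y₂ = -y₁ := by linear_combination hy
      subst hy2
      rcases hC with ⟨z₃, hX₃, rfl⟩ | ⟨z₃, n₃, rfl⟩
      · simp
      · exfalso
        have hy0 : y₁ = 0 := by
          have : Z₃ * y₁ ^ 2 = 0 := by linear_combination -e₁ / 4 + Z₃ * q₁ / 2
          simpa [z₃] using this
        have hd := deriv_ne_of_short h₁ h₃ n₁ hy0
        apply mul_ne_zero z₃ (pow_ne_zero 2 hd)
        have q₃ : x₁ ^ 3 + W.a₂ * x₁ ^ 2 + W.a₄ * x₁ + W.a₆ = 0 := by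
          rw [← q₁, hy0]; ring
        rw [hy0] at e₂
        linear_combination -e₂ + 2 * X₃ * q₃ + Z₃ * 4 * (2 * x₁ + W.a₂) * q₃
    · rw [negY_of_short h₁ h₃] at hy
      have hy2 : y₂ = y₁ := by
        have : (y₁ - y₂) * (y₁ + y₂) = 0 := by linear_combination q₁ - q₂
        rcases mul_eq_zero.mp this with h | h
        · linear_combination -h
        · exact absurd (by linear_combination h) hy
      subst hy2
      have hy0 : y₂ ≠ 0 := fun h => hy (by rw [h, neg_zero])
      have hne : y₂ ≠ W.negY x₁ y₂ := by rwa [negY_of_short h₁ h₃]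
      rw [WeierstrassCurve.Affine.Point.add_self_of_Y_ne hne]
      have hs : 2 * y₂ * W.slope x₁ x₁ y₂ y₂ = 3 * x₁ ^ 2 + 2 * W.a₂ * x₁ + W.a₄ := by
        rw [WeierstrassCurve.Affine.slope_of_Y_ne rfl hne, h₁, negY_of_short h₁ h₃]
        field_simp
        ring
      set ℓ := W.slope x₁ x₁ y₂ y₂
      -- For A = B the equation `e₁` reads 0 = 0, and `e₂` is the duplication formula.
      have hx3 : X₃ = Z₃ * (ℓ ^ 2 - W.a₂ - x₁ - x₁) := by
        apply mul_left_cancel₀ (mul_ne_zero ((by norm_num : (4 : ℂ) ≠ 0)) (pow_ne_zero 2 hy0))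
        linear_combination e₂ + 2 * (X₃ * 1 + Z₃ * (2 * x₁ + W.a₂) * 2 ) * q₁
          - Z₃ * (2 * y₂ * ℓ + 3 * x₁ ^ 2 + 2 * W.a₂ * x₁ + W.a₄) * hs
      rcases hC with ⟨z₃, hX₃, rfl⟩ | ⟨z₃, n₃, rfl⟩
      · exact absurd (by rw [hx3, z₃, zero_mul]) hX₃
      · apply WeierstrassCurve.Affine.Point.X_eq_iff.mp
        rw [hx3, WeierstrassCurve.Affine.addX, h₁]
        field_simp
        ring
  · rw [WeierstrassCurve.Affine.Point.add_of_X_ne hx]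
    have hx' := sub_ne_zero.mpr hx
    have hs : (x₁ - x₂) * W.slope x₁ x₂ y₁ y₂ = y₁ - y₂ := by
      rw [WeierstrassCurve.Affine.slope_of_X_ne hx]
      field_simp
    set ℓ := W.slope x₁ x₂ y₁ y₂
    have hx3 : X₃ = Z₃ * (ℓ ^ 2 - W.a₂ - x₁ - x₂) := by
      apply mul_left_cancel₀ (pow_ne_zero 2 hx')
      linear_combination e₁ - Z₃ * ((x₁ - x₂) * ℓ + y₁ - y₂) * hs - Z₃ * q₁ - Z₃ * q₂
    rcases hC with ⟨z₃, hX₃, rfl⟩ | ⟨z₃, n₃, rfl⟩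
    · exact absurd (by rw [hx3, z₃, zero_mul]) hX₃
    · apply WeierstrassCurve.Affine.Point.X_eq_iff.mp
      rw [hx3, WeierstrassCurve.Affine.addX, h₁]
      field_simp
      ring

/-! ### Affine changes of variables as group homomorphisms -/

section VariableChange

variable {W' : WeierstrassCurve.Affine ℂ}

theorem nonsingular_of_short (h₁ : W.a₁ = 0) (h₃ : W.a₃ = 0) {x y : ℂ} :
    W.Nonsingular x y ↔ y ^ 2 = x ^ 3 + W.a₂ * x ^ 2 + W.a₄ * x + W.a₆ ∧
      (3 * x ^ 2 + 2 * W.a₂ * x + W.a₄ ≠ 0 ∨ y ≠ 0) := by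
  rw [WeierstrassCurve.Affine.nonsingular_iff, equation_of_short h₁ h₃, h₁, h₃]
  refine and_congr_right fun _ => or_congr (by rw [zero_mul, ne_comm]) (not_congr ?_)
  constructor <;> intro h
  · linear_combination h / 2
  · linear_combination 2 * h

theorem nonsingular_affine (h₁ : W.a₁ = 0) (h₃ : W.a₃ = 0) (h₁' : W'.a₁ = 0) (h₃' : W'.a₃ = 0)
    {μ ν ω : ℂ} (hμ : μ ≠ 0) (hω : ω ^ 2 = μ ^ 3) (e₂ : 3 * ν + W'.a₂ = μ * W.a₂)
    (e₄ : 3 * ν ^ 2 + 2 * W'.a₂ * ν + W'.a₄ = μ ^ 2 * W.a₄)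
    (e₆ : ν ^ 3 + W'.a₂ * ν ^ 2 + W'.a₄ * ν + W'.a₆ = μ ^ 3 * W.a₆) {x y : ℂ}
    (h : W.Nonsingular x y) : W'.Nonsingular (μ * x + ν) (ω * y) := by
  rw [nonsingular_of_short h₁ h₃] at h
  rw [nonsingular_of_short h₁' h₃']
  have hω0 : ω ≠ 0 := by
    rintro rfl
    exact pow_ne_zero 3 hμ (by rw [← hω]; ring)
  refine ⟨?_, h.2.imp (fun h h' => ?_) fun h => mul_ne_zero hω0 h⟩
  · linear_combination ω ^ 2 * h.1 + (x ^ 3 + W.a₂ * x ^ 2 + W.a₄ * x + W.a₆) * hω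
      - μ ^ 2 * x ^ 2 * e₂ - μ * x * e₄ - e₆
  · apply mul_ne_zero (pow_ne_zero 2 hμ) h
    linear_combination h' - 2 * μ * x * e₂ - e₄

/-- The homomorphism between the groups of points of two Weierstrass curves which is given by a
change of variables `(x, y) ↦ (μ x + ν, ω y)`. -/
def affineHom (h₁ : W.a₁ = 0) (h₃ : W.a₃ = 0) (h₁' : W'.a₁ = 0) (h₃' : W'.a₃ = 0)
    {μ ν ω : ℂ} (hμ : μ ≠ 0) (hω : ω ^ 2 = μ ^ 3) (e₂ : 3 * ν + W'.a₂ = μ * W.a₂)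
    (e₄ : 3 * ν ^ 2 + 2 * W'.a₂ * ν + W'.a₄ = μ ^ 2 * W.a₄)
    (e₆ : ν ^ 3 + W'.a₂ * ν ^ 2 + W'.a₄ * ν + W'.a₆ = μ ^ 3 * W.a₆) : W.Point →+ W'.Point where
  toFun P := match P with
    | .zero => 0
    | .some x y h => .some (μ * x + ν) (ω * y)
        (nonsingular_affine h₁ h₃ h₁' h₃' hμ hω e₂ e₄ e₆ h)
  map_zero' := rfl
  map_add' P Q := by
    have hω0 : ω ≠ 0 := by
      rintro rfl
      exact pow_ne_zero 3 hμ (by rw [← hω]; ring)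
    rcases P with _ | ⟨x, y, h⟩
    · change _ = 0 + _
      rw [zero_add, show (Point.zero : W.Point) = 0 from rfl, zero_add]
    rcases Q with _ | ⟨x', y', h'⟩
    · change _ = _ + 0
      rw [add_zero, show (Point.zero : W.Point) = 0 from rfl, add_zero]
    by_cases hxy : x = x' ∧ y = W.negY x' y'
    · rw [WeierstrassCurve.Affine.Point.add_of_Y_eq hxy.1 hxy.2]
      refine (WeierstrassCurve.Affine.Point.add_of_Y_eq (by rw [hxy.1]) ?_).symm
      rw [hxy.2, negY_of_short h₁ h₃, negY_of_short h₁' h₃']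
      ring
    · have hxy' : ¬(μ * x + ν = μ * x' + ν ∧ ω * y = W'.negY (μ * x' + ν) (ω * y')) := by
        rw [negY_of_short h₁' h₃']
        rw [negY_of_short h₁ h₃] at hxy
        rintro ⟨hx, hy⟩
        refine hxy ⟨mul_left_cancel₀ hμ (by linear_combination hx), mul_left_cancel₀ hω0 ?_⟩
        linear_combination hy
      have hs : W'.slope (μ * x + ν) (μ * x' + ν) (ω * y) (ω * y') * μ = ω * W.slope x x' y y' := by
        by_cases hx : x = x'
        · subst hx
          have hy : y ≠ W.negY x y' := fun hy => hxy ⟨rfl, hy⟩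
          have hy' : ω * y ≠ W'.negY (μ * x + ν) (ω * y') := fun hy => hxy' ⟨rfl, hy⟩
          rw [WeierstrassCurve.Affine.slope_of_Y_ne rfl hy,
            WeierstrassCurve.Affine.slope_of_Y_ne rfl hy']
          have hyy := WeierstrassCurve.Affine.Y_eq_of_Y_ne h.1 h'.1 rfl hy
          rw [← hyy] at hy
          rw [negY_of_short h₁ h₃] at hy ⊢
          rw [negY_of_short h₁' h₃', h₁, h₁']
          have hy2 : y - -y ≠ 0 := sub_ne_zero.mpr hy
          have hy3 : ω * y - -(ω * y) ≠ 0 := by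
            rw [show ω * y - -(ω * y) = ω * (y - -y) by ring]
            exact mul_ne_zero hω0 hy2
          rw [div_mul_eq_mul_div, ← mul_div_assoc, div_eq_div_iff hy3 hy2]
          linear_combination (y - -y) * (μ * e₄ + 2 * μ ^ 2 * x * e₂
            - (3 * x ^ 2 + 2 * W.a₂ * x + W.a₄) * hω)
        · have hx' : μ * x + ν ≠ μ * x' + ν := fun hx' =>
            hx (mul_left_cancel₀ hμ (by linear_combination hx'))
          rw [WeierstrassCurve.Affine.slope_of_X_ne hx, WeierstrassCurve.Affine.slope_of_X_ne hx',
            div_mul_eq_mul_div, ← mul_div_assoc,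
            div_eq_div_iff (sub_ne_zero.mpr hx') (sub_ne_zero.mpr hx)]
          ring
      have hX : μ * W.addX x x' (W.slope x x' y y') + ν
          = W'.addX (μ * x + ν) (μ * x' + ν)
            (W'.slope (μ * x + ν) (μ * x' + ν) (ω * y) (ω * y')) := by
        apply mul_left_cancel₀ (pow_ne_zero 2 hμ)
        simp only [WeierstrassCurve.Affine.addX, h₁, h₁']
        set ℓ := W.slope x x' y y'
        set ℓ' := W'.slope (μ * x + ν) (μ * x' + ν) (ω * y) (ω * y')
        linear_combination -(ℓ' * μ + ω * ℓ) * hs - ℓ ^ 2 * hω + μ ^ 2 * e₂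
      rw [WeierstrassCurve.Affine.Point.add_some hxy]
      refine Eq.trans ?_ (WeierstrassCurve.Affine.Point.add_some hxy').symm
      simp only [Point.some.injEq]
      refine ⟨hX, ?_⟩
      simp only [WeierstrassCurve.Affine.addY, WeierstrassCurve.Affine.negAddY, ← hX,
        negY_of_short h₁ h₃, negY_of_short h₁' h₃']
      set ℓ := W.slope x x' y y'
      set ℓ' := W'.slope (μ * x + ν) (μ * x' + ν) (ω * y) (ω * y')
      linear_combination (W.addX x x' ℓ - x) * hs

theorem affineHom_injective (h₁ : W.a₁ = 0) (h₃ : W.a₃ = 0) (h₁' : W'.a₁ = 0) (h₃' : W'.a₃ = 0)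
    {μ ν ω : ℂ} (hμ : μ ≠ 0) (hω : ω ^ 2 = μ ^ 3) (e₂ : 3 * ν + W'.a₂ = μ * W.a₂)
    (e₄ : 3 * ν ^ 2 + 2 * W'.a₂ * ν + W'.a₄ = μ ^ 2 * W.a₄)
    (e₆ : ν ^ 3 + W'.a₂ * ν ^ 2 + W'.a₄ * ν + W'.a₆ = μ ^ 3 * W.a₆) :
    Function.Injective (affineHom h₁ h₃ h₁' h₃' hμ hω e₂ e₄ e₆) := by
  rw [injective_iff_map_eq_zero]
  rintro (_ | ⟨x, y, h⟩) h0
  · rfl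
  · exact absurd h0 (WeierstrassCurve.Affine.Point.some_ne_zero _)

theorem Rep.affineHom {h₁ : W.a₁ = 0} {h₃ : W.a₃ = 0} {h₁' : W'.a₁ = 0} {h₃' : W'.a₃ = 0}
    {μ ν ω : ℂ} {hμ : μ ≠ 0} {hω : ω ^ 2 = μ ^ 3} {e₂ : 3 * ν + W'.a₂ = μ * W.a₂}
    {e₄ : 3 * ν ^ 2 + 2 * W'.a₂ * ν + W'.a₄ = μ ^ 2 * W.a₄}
    {e₆ : ν ^ 3 + W'.a₂ * ν ^ 2 + W'.a₄ * ν + W'.a₆ = μ ^ 3 * W.a₆} {T : W.Point} {X Y Z : ℂ}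
    (h : Rep T X Y Z) :
    Rep (affineHom h₁ h₃ h₁' h₃' hμ hω e₂ e₄ e₆ T) (μ * X + ν * Z) (ω * Y) Z := by
  rcases h with ⟨hZ, hX, rfl⟩ | ⟨hZ, n, rfl⟩
  · refine Or.inl ⟨hZ, ?_, map_zero _⟩
    rw [hZ, mul_zero, add_zero]
    exact mul_ne_zero hμ hX
  · have hx : (μ * X + ν * Z) / Z = μ * (X / Z) + ν := by field_simp
    have hy : ω * Y / Z ^ 2 = ω * (Y / Z ^ 2) := by ring
    refine Or.inr ⟨hZ, ?_, ?_⟩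
    · rw [hx, hy]
      exact nonsingular_affine h₁ h₃ h₁' h₃' hμ hω e₂ e₄ e₆ n
    · simp only [hx, hy]
      rfl

end VariableChange

theorem Rep.smul {T : W.Point} {X Y Z : ℂ} (h : Rep T X Y Z) {r : ℂ} (hr : r ≠ 0) :
    Rep T (r * X) (r ^ 2 * Y) (r * Z) := by
  rcases h with ⟨hZ, hX, rfl⟩ | ⟨hZ, n, rfl⟩
  · exact Or.inl ⟨by rw [hZ, mul_zero], mul_ne_zero hr hX, rfl⟩
  · have hx : r * X / (r * Z) = X / Z := by field_simp
    have hy : r ^ 2 * Y / (r * Z) ^ 2 = Y / Z ^ 2 := by field_simp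
    refine Or.inr ⟨mul_ne_zero hr hZ, ?_, ?_⟩
    · rwa [hx, hy]
    · simp only [hx, hy]

theorem Rep.neg (h₁ : W.a₁ = 0) (h₃ : W.a₃ = 0) {T : W.Point} {X Y Z : ℂ} (h : Rep T X Y Z) :
    Rep (-T) X (-Y) Z := by
  rcases h with ⟨hZ, hX, rfl⟩ | ⟨hZ, n, rfl⟩
  · exact Or.inl ⟨hZ, hX, neg_zero⟩
  · have hy : -Y / Z ^ 2 = -(Y / Z ^ 2) := by ring
    have n' : W.Nonsingular (X / Z) (-Y / Z ^ 2) := by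
      have := (W.nonsingular_neg (X / Z) (Y / Z ^ 2)).mpr n
      rwa [negY_of_short h₁ h₃, ← hy] at this
    exact Or.inr ⟨hZ, n', neg_some_of_short h₁ h₃ _ _ rfl hy⟩

end Weierstrass

theorem Rep.unique {W : WeierstrassCurve.Affine ℂ} {T T' : W.Point} {X Y Z : ℂ}
    (h : Rep T X Y Z) (h' : Rep T' X Y Z) : T = T' := by
  rcases h with ⟨hZ, hX, rfl⟩ | ⟨hZ, n, rfl⟩ <;> rcases h' with ⟨hZ', hX', rfl⟩ | ⟨hZ', n', rfl⟩
  · rfl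
  · exact absurd hZ hZ'
  · exact absurd hZ' hZ
  · rfl

/-- Doubling on the level of `x`-coordinates. -/
theorem two_nsmul_eq_or_eq_neg {W : WeierstrassCurve.Affine ℂ} (h₁ : W.a₁ = 0) (h₃ : W.a₃ = 0)
    {A C : W.Point} {X Y Z X₃ Y₃ Z₃ : ℂ} (hA : Rep A X Y Z) (hC : Rep C X₃ Y₃ Z₃)
    (hY : Y ^ 2 = Z * (X ^ 3 + W.a₂ * X ^ 2 * Z + W.a₄ * X * Z ^ 2 + W.a₆ * Z ^ 3))
    (e : X₃ * (4 * Y ^ 2) = Z₃ * ((X ^ 2 - W.a₄ * Z ^ 2) ^ 2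
      - 4 * W.a₆ * Z ^ 3 * (2 * X + W.a₂ * Z))) :
    2 • A = C ∨ 2 • A = -C := by
  have hY0 : Z = 0 → Y = 0 := fun h => by simpa [h] using hY
  rw [two_nsmul]
  refine add_eq_or_eq_neg h₁ h₃ hA hA hC ?_ ?_ hY0 hY0
  · linear_combination 2 * Z₃ * hY
  · linear_combination e - 2 * X₃ * hY

/-! ### Points of double covers -/

namespace Cover

variable {n m : ℕ} {F : BinForm n} {G : BinForm m}

theorem x_eq_x_iff (P : Cover F) (Q : Cover G) : P.x = Q.x ↔ P.X * Q.Z = Q.X * P.Z := by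
  unfold x
  rcases P.norm with h | ⟨h, h'⟩ <;> rcases Q.norm with k | ⟨k, k'⟩ <;> simp [*]

theorem ofCoords_cross (X Y Z : ℂ) (h : Y ^ 2 = F.eval X Z) (h0 : X ≠ 0 ∨ Z ≠ 0) :
    (ofCoords F X Y Z h h0).X * Z = X * (ofCoords F X Y Z h h0).Z := by
  obtain ⟨r, -, hX, -, hZ⟩ := ofCoords_spec X Y Z h h0
  rw [hX, hZ]
  ring

/-- The image of a point under `(x, y) ↦ (x, -y)`. -/
def flip (P : Cover F) : Cover F := ⟨P.X, -P.Y, P.Z, by rw [neg_sq, P.eqn], P.norm⟩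

theorem eq_or_eq_flip {P Q : Cover F} (h : P.X * Q.Z = Q.X * P.Z) : P = Q ∨ P = Q.flip := by
  have hXZ : P.X = Q.X ∧ P.Z = Q.Z := by
    rcases P.norm with h1 | ⟨h1, h2⟩ <;> rcases Q.norm with k1 | ⟨k1, k2⟩ <;> simp_all
  have : (P.Y - Q.Y) * (P.Y + Q.Y) = 0 := by
    have h1 := P.eqn
    have h2 := Q.eqn
    rw [hXZ.1, hXZ.2] at h1
    linear_combination h1 - h2
  rcases mul_eq_zero.mp this with h | h
  · exact Or.inl (Cover.ext hXZ.1 (by linear_combination h) hXZ.2)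
  · exact Or.inr (Cover.ext hXZ.1 (by simp only [flip]; linear_combination h) hXZ.2)

end Cover

/-! ### The group law of `E'_s` -/

section Shift

variable (p : Param)

/-- The curve `E'_s` with its group law is isomorphic to the Weierstrass curve. -/
def shift : E' p ≃+ (weierstrass p).Point where
  toEquiv := (E'.toWeierstrass p).trans
    (Equiv.subRight (E'.toWeierstrass p (E'.origin p)))
  map_add' _ _ :=
    Equiv.apply_symm_apply ((E'.toWeierstrass p).trans
      (Equiv.subRight (E'.toWeierstrass p (E'.origin p)))) _

theorem shift_apply (P : E' p) :
    shift p P = E'.toWeierstrass p P - E'.toWeierstrass p (E'.origin p) := rfl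

/-- The origin (c, 0) has order two on the Weierstrass curve, so subtracting it is translation by
it. On x-coordinates this is the Möbius map x ↦ c(x - 1)/(x - c). -/
theorem rep_shift (P : E' p) :
    Rep (shift p P) (p.c * (P.X - P.Z)) (p.c * (1 - p.c) * P.Y) (P.X - p.c * P.Z) := by
  have hc : p.c * (1 - p.c) ≠ 0 := mul_ne_zero p.c_ne_zero (sub_ne_zero.mpr p.c_ne_one.symm)
  have a₁ : (weierstrass p).a₁ = 0 := rfl
  have a₃ : (weierstrass p).a₃ = 0 := rfl
  have hO : ∃ h, E'.toWeierstrass p (E'.origin p) = Point.some p.c 0 h := by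
    refine ⟨?_, ?_⟩
    · rw [weierstrass_nonsingular]; ring
    · simp [E'.toWeierstrass, E'.origin]
  obtain ⟨hn, hO⟩ := hO
  have hO' : -E'.toWeierstrass p (E'.origin p) = E'.toWeierstrass p (E'.origin p) := by
    rw [hO]
    exact neg_some_of_short a₁ a₃ _ _ rfl (by rw [neg_zero])
  rw [shift_apply, sub_eq_add_neg, hO', hO]
  rcases P.norm with hZ | ⟨hZ, hX⟩
  · have hP : ∃ h, E'.toWeierstrass p P = Point.some P.X P.Y h := by
      refine ⟨?_, ?_⟩
      · rw [weierstrass_nonsingular, P.eqn]; simp [formE', hZ]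
      · simp [E'.toWeierstrass, hZ]
    obtain ⟨hn', hP⟩ := hP
    have hq := (weierstrass_nonsingular p _ _).mp hn'
    rw [hP, hZ, mul_one]
    by_cases hx : P.X = p.c
    · refine Or.inl ⟨by rw [hx, sub_self], ?_, ?_⟩
      · rw [hx]; intro h; apply hc; linear_combination -h
      · apply WeierstrassCurve.Affine.Point.add_of_Y_eq hx
        rw [negY_of_short a₁ a₃]
        have : P.Y ^ 2 = 0 := by rw [hq, hx]; ring
        rw [pow_eq_zero_iff two_ne_zero] at this
        rw [this, neg_zero]
    · have hx' := sub_ne_zero.mpr hx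
      rw [WeierstrassCurve.Affine.Point.add_of_X_ne hx]
      have hs := WeierstrassCurve.Affine.slope_of_X_ne (W := weierstrass p) (y₁ := P.Y) (y₂ := 0) hx
      have h1 : (weierstrass p).addX P.X p.c ((weierstrass p).slope P.X p.c P.Y 0)
          = p.c * (P.X - 1) / (P.X - p.c) := by
        rw [WeierstrassCurve.Affine.addX, hs]
        simp only [weierstrass]
        field_simp
        linear_combination hq
      have h2 : (weierstrass p).addY P.X p.c P.Y ((weierstrass p).slope P.X p.c P.Y 0)
          = p.c * (1 - p.c) * P.Y / (P.X - p.c) ^ 2 := by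
        rw [WeierstrassCurve.Affine.addY, WeierstrassCurve.Affine.negAddY, h1,
          negY_of_short a₁ a₃, hs]
        field_simp
        ring
      refine Or.inr ⟨hx', ?_, ?_⟩
      · rw [← h1, ← h2]
        exact WeierstrassCurve.Affine.nonsingular_add hn' hn (fun h => hx h.1)
      · simp only [← h1, ← h2]
  · have hP : E'.toWeierstrass p P = 0 := by
      simp only [E'.toWeierstrass, Equiv.coe_fn_mk, dif_pos hZ]
      rfl
    have hY : P.Y = 0 := by
      have := P.eqn
      simpa [formE', hZ] using this
    rw [hP, zero_add, hZ, hX, hY]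
    refine Or.inr ⟨by norm_num, ?_, ?_⟩
    · simpa using hn
    · simp

theorem rep_shift_of_eq {Q : E' p} {r X Y Z : ℂ} (hr : r ≠ 0) (hX : Q.X = r * X)
    (hY : Q.Y = r ^ 2 * Y) (hZ : Q.Z = r * Z) :
    Rep (shift p Q) (p.c * (X - Z)) (p.c * (1 - p.c) * Y) (X - p.c * Z) := by
  have := (rep_shift p Q).smul (inv_ne_zero hr)
  rw [hX, hY, hZ] at this
  convert this using 1 <;> field_simp

theorem rep_shift_ofCoords {X Y Z : ℂ} (h : Y ^ 2 = (formE' p).eval X Z) (h0 : X ≠ 0 ∨ Z ≠ 0) :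
    Rep (shift p (Cover.ofCoords (formE' p) X Y Z h h0)) (p.c * (X - Z)) (p.c * (1 - p.c) * Y)
      (X - p.c * Z) := by
  obtain ⟨r, hr, hX, hY, hZ⟩ := Cover.ofCoords_spec X Y Z h h0
  exact rep_shift_of_eq p hr hX hY hZ

theorem E'.neg_eq_flip (P : E' p) : -P = P.flip := by
  apply (shift p).injective
  rw [map_neg]
  have h1 := (rep_shift p P).neg rfl rfl
  have h2 := rep_shift p P.flip
  simp only [Cover.flip, mul_neg] at h2
  exact h1.unique h2

theorem E'.eq_or_eq_neg {P Q : E' p} (h : P.X * Q.Z = Q.X * P.Z) : P = Q ∨ P = -Q := by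
  rw [E'.neg_eq_flip]
  exact Cover.eq_or_eq_flip h

theorem E'.cross_of_eq_or {P Q : E' p} (h : P = Q ∨ P = -Q) : P.X * Q.Z = Q.X * P.Z := by
  rw [E'.neg_eq_flip] at h
  rcases h with rfl | rfl <;> rfl

/-- The isomorphism `λ_s` of groups. -/
def lamAdd : E p ≃+ E' p where
  toEquiv := lam p
  map_add' _ _ := Equiv.apply_symm_apply (lam p) _

theorem lam_spec (P : E p) : ∃ r ≠ 0,
    (lam p P).X = r * ((p.s ^ 2 + 1) * (p.s * P.X + P.Z)) ∧
    (lam p P).Y = r ^ 2 * (p.s * (p.s ^ 4 - 1) * P.Y) ∧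
    (lam p P).Z = r * (2 * p.s * (P.X + p.s * P.Z)) := by
  obtain ⟨r, hr, hX, hY, hZ⟩ := (lamIso p).map_spec P
  refine ⟨r, hr, hX.trans ?_, hY, hZ.trans ?_⟩ <;> simp only [lamIso] <;> ring

/-- The coordinates on the Weierstrass curve of the point `λ_s(P)`. -/
theorem rep_lam (P : E p) : Rep (shift p (lam p P))
    ((p.s ^ 2 + 1) ^ 2 * (p.s * P.X - P.Z))
    ((p.s ^ 2 + 1) ^ 2 * (1 - p.s ^ 4) * p.s * P.Y)
    ((p.s ^ 2 + 1) * (2 * p.s * (P.X - p.s * P.Z))) := by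
  obtain ⟨r, hr, hX, hY, hZ⟩ := lam_spec p P
  have := rep_shift_of_eq p hr hX hY hZ
  have hs := p.s_ne
  have hs' := p.sq_sub_ne
  convert this.smul (r := 4 * p.s ^ 2 / (p.s ^ 2 - 1))
    (div_ne_zero (mul_ne_zero (by norm_num) (pow_ne_zero 2 hs)) hs') using 1
  all_goals
    simp only [Param.c]
    field_simp
    ring

/-- Only the duplication formula for x-coordinates is checked. The sign is irrelevant since only
sets of x-coordinates are compared. -/
theorem psi_eq_or_eq_neg (P : E p) : psi p P = 2 • lam p P ∨ psi p P = -(2 • lam p P) := by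
  have hs := p.s_ne
  have h1 := rep_lam p P
  have h2 : Rep (shift p (psi p P)) _ _ _ := rep_shift_ofCoords p _ _
  have hP : P.Y ^ 2 = (P.X ^ 2 - p.s ^ 2 * P.Z ^ 2) * (P.X ^ 2 - 1 / p.s ^ 2 * P.Z ^ 2) := P.eqn
  have hY : ((p.s ^ 2 + 1) ^ 2 * (1 - p.s ^ 4) * p.s * P.Y) ^ 2
    = (p.s ^ 2 + 1) ^ 4 * (1 - p.s ^ 4) ^ 2 * ((P.X ^ 2 - p.s ^ 2 * P.Z ^ 2)
      * (p.s ^ 2 * P.X ^ 2 - P.Z ^ 2)) := by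
    have : (p.s * P.Y) ^ 2 = (P.X ^ 2 - p.s ^ 2 * P.Z ^ 2) * (p.s ^ 2 * P.X ^ 2 - P.Z ^ 2) := by
      rw [mul_pow, hP]; field_simp
    linear_combination ((p.s ^ 2 + 1) ^ 2 * (1 - p.s ^ 4)) ^ 2 * this
  have := two_nsmul_eq_or_eq_neg (W := weierstrass p) rfl rfl h1 h2 (by
    rw [hY]
    simp only [weierstrass, Param.c]
    field_simp
    ring) (by
    rw [hY]
    simp only [weierstrass, Param.c]
    field_simp
    ring)
  rcases this with h | h
  · left; apply (shift p).injective; rw [map_nsmul, h]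
  · right; apply (shift p).injective; rw [map_neg, map_nsmul, h, neg_neg]

theorem E.neg_eq_flip (P : E p) : -P = P.flip := by
  apply (lamAdd p).injective
  apply (shift p).injective
  rw [map_neg, map_neg]
  have h1 := (rep_lam p P).neg rfl rfl
  have h2 := rep_lam p P.flip
  simp only [Cover.flip, mul_neg] at h2
  exact h1.unique h2

theorem E.exists_point (X Z : ℂ) (h : Z = 1 ∨ (Z = 0 ∧ X = 1)) : ∃ P : E p, P.X = X ∧ P.Z = Z := by
  obtain ⟨y, hy⟩ := IsAlgClosed.exists_pow_nat_eq ((formE p).eval X Z) (n := 2) (by norm_num)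
  exact ⟨⟨X, y, Z, hy, h⟩, rfl, rfl⟩

variable {p}

theorem lam_nsmul (n : ℕ) (P : E p) : lam p (n • P) = n • lam p P := map_nsmul (lamAdd p) n P

theorem lam_add (P Q : E p) : lam p (P + Q) = lam p P + lam p Q := map_add (lamAdd p) P Q

theorem lam_neg (P : E p) : lam p (-P) = -lam p P := map_neg (lamAdd p) P

theorem psi_cross (P : E p) :
    (psi p P).X * (4 * P.X ^ 2 * P.Z ^ 2) = (P.X ^ 2 + P.Z ^ 2) ^ 2 * (psi p P).Z :=
  Cover.ofCoords_cross _ _ _ _ _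

/-- The fiber of `x ↦ (x ^ 2 + 1) ^ 2 / (4 x ^ 2)` over the point `[A : B]`. -/
def psiFiber (A B : ℂ) : Set (OnePoint ℂ) :=
  {ξ | ∃ X Z : ℂ, ((Z = 1 ∧ ξ = (X : OnePoint ℂ)) ∨ (Z = 0 ∧ X = 1 ∧ ξ = OnePoint.infty)) ∧
    A * (4 * X ^ 2 * Z ^ 2) = (X ^ 2 + Z ^ 2) ^ 2 * B}

/-- Transitivity of equality on the projective line; only the middle pair has to be nonzero. -/
theorem cross_trans {a b c d e f : ℂ} (hcd : c ≠ 0 ∨ d ≠ 0) (h : a * d = c * b)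
    (h' : c * f = e * d) : a * f = e * b := by
  rcases hcd with hc | hd
  · exact mul_left_cancel₀ hc (by linear_combination a * h' + e * h)
  · exact mul_left_cancel₀ hd (by linear_combination f * h + b * h')

theorem psi_coords_ne (P : E p) :
    (P.X ^ 2 + P.Z ^ 2) ^ 2 ≠ 0 ∨ 4 * P.X ^ 2 * P.Z ^ 2 ≠ 0 := by
  rcases P.norm with h | h
  · by_cases hX : P.X = 0
    · left; simp [hX, h]
    · right; simp [hX, h]
  · left; simp [h.1, h.2]

theorem mem_psiFiber (P : E p) (A B : ℂ) :
    P.x ∈ psiFiber A B ↔ A * (4 * P.X ^ 2 * P.Z ^ 2) = (P.X ^ 2 + P.Z ^ 2) ^ 2 * B := by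
  constructor
  · rintro ⟨X, Z, h, e⟩
    unfold Cover.x at h
    rcases P.norm with h1 | ⟨h1, h2⟩
    · rw [if_neg (by rw [h1]; norm_num)] at h
      rcases h with ⟨hZ, hX⟩ | ⟨-, -, hX⟩
      · rw [OnePoint.coe_eq_coe] at hX
        rw [hX, h1, ← hZ]; exact e
      · exact absurd hX (OnePoint.coe_ne_infty _)
    · rw [if_pos h1] at h
      rcases h with ⟨-, hX⟩ | ⟨hZ, hX, -⟩
      · exact absurd hX (OnePoint.infty_ne_coe _)
      · rw [h1, h2, ← hZ, ← hX]; rw [hX, hZ] at e ⊢; exact e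
  · intro e
    refine ⟨P.X, P.Z, ?_, e⟩
    unfold Cover.x
    rcases P.norm with h1 | ⟨h1, h2⟩
    · exact Or.inl ⟨h1, if_neg (by rw [h1]; norm_num)⟩
    · exact Or.inr ⟨h1, h2, if_pos h1⟩

theorem exists_of_mem_psiFiber {A B : ℂ} {ξ : OnePoint ℂ} (h : ξ ∈ psiFiber A B) (p : Param) :
    ∃ P : E p, P.x = ξ := by
  obtain ⟨X, Z, h, -⟩ := h
  rcases h with ⟨hZ, rfl⟩ | ⟨hZ, hX, rfl⟩
  · obtain ⟨P, hX, hZ'⟩ := E.exists_point p X Z (Or.inl hZ)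
    exact ⟨P, by rw [Cover.x, hZ', hX, if_neg (by rw [hZ]; norm_num)]⟩
  · obtain ⟨P, hX, hZ'⟩ := E.exists_point p X Z (Or.inr ⟨hZ, hX⟩)
    exact ⟨P, by rw [Cover.x, hZ', if_pos hZ]⟩

theorem cross_psi_iff (P : E p) {A B : ℂ} :
    P.x ∈ psiFiber A B ↔ (psi p P).X * B = A * (psi p P).Z := by
  rw [mem_psiFiber]
  have h1 := psi_cross P
  constructor
  · intro h
    exact cross_trans (psi_coords_ne P) h1 (by linear_combination -h)
  · intro h
    have := cross_trans (psi p P).ne_zero h1.symm h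
    linear_combination -this

/-- As ψ = ±[2] ∘ λ, the halves of ±R are the points P for which ψ(P) and λ(R) have equal
x-coordinates. The formula for x(ψ(P)) does not involve s, so the right side depends on the curve
only through x(λ(R)). -/
theorem halves_eq (R : E p) : halves R = psiFiber (lam p R).X (lam p R).Z := by
  have key : ∀ P : E p, P.x ∈ psiFiber (lam p R).X (lam p R).Z ↔ 2 • P = R ∨ 2 • (-P) = R := by
    intro P
    rw [cross_psi_iff P]
    have hl : ∀ Q : E p, 2 • Q = R ↔ 2 • lam p Q = lam p R := fun Q => by
      rw [← (lam p).injective.eq_iff, lam_nsmul]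
    rw [hl, hl, lam_neg]
    constructor
    · intro h
      rcases E'.eq_or_eq_neg p h with h | h <;> rcases psi_eq_or_eq_neg p P with h' | h' <;>
        rw [h'] at h
      · exact Or.inl h
      · right; rw [← h]; abel
      · right; rw [← neg_eq_iff_eq_neg] at h; rw [← h]; abel
      · left; rwa [neg_inj] at h
    · intro h
      apply E'.cross_of_eq_or
      rcases h with h | h <;> rcases psi_eq_or_eq_neg p P with h' | h' <;> rw [h', ← h]
      · exact Or.inl rfl
      · exact Or.inr rfl
      · right; abel
      · left; abel
  ext ξ
  constructor
  · rintro ⟨P, hP, rfl⟩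
    exact (key P).mpr (Or.inl hP)
  · intro hξ
    obtain ⟨P, rfl⟩ := exists_of_mem_psiFiber hξ p
    rcases (key P).mp hξ with h | h
    · exact ⟨P, h, rfl⟩
    · exact ⟨-P, h, by rw [E.neg_eq_flip]; rfl⟩

theorem twoTranslates_eq_halves (P : E p) : twoTranslates P = halves (2 • P) := by
  unfold twoTranslates halves
  congr 1
  ext Q
  constructor
  · rintro ⟨T, hT, rfl⟩
    change 2 • (P + T) = 2 • P
    rw [nsmul_add, hT, add_zero]
  · intro h
    exact ⟨Q - P, by rw [nsmul_sub, show 2 • Q = 2 • P from h, sub_self], by abel⟩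

theorem cross_two_nsmul (P : E p) :
    (lam p (2 • P)).X * (4 * P.X ^ 2 * P.Z ^ 2) = (P.X ^ 2 + P.Z ^ 2) ^ 2 * (lam p (2 • P)).Z := by
  have h := psi_cross P
  refine cross_trans (psi p P).ne_zero ?_ h
  apply E'.cross_of_eq_or
  rw [lam_nsmul]
  rcases psi_eq_or_eq_neg p P with h | h <;> rw [h]
  · exact Or.inl rfl
  · right; rw [neg_neg]

end Shift

variable {p q : Param}

theorem psiFiber_congr {A B A' B' : ℂ} (h : A ≠ 0 ∨ B ≠ 0) (h' : A' ≠ 0 ∨ B' ≠ 0)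
    (e : A * B' = A' * B) : psiFiber A B = psiFiber A' B' := by
  ext ξ
  refine exists_congr fun X => exists_congr fun Z => and_congr_right fun _ => ?_
  constructor
  · intro h1
    have := cross_trans h (a := A') (b := B') (e := (X ^ 2 + Z ^ 2) ^ 2)
      (f := 4 * X ^ 2 * Z ^ 2) (by linear_combination -e) (by linear_combination h1)
    linear_combination this
  · intro h1
    have := cross_trans h' (a := A) (b := B) (e := (X ^ 2 + Z ^ 2) ^ 2)
      (f := 4 * X ^ 2 * Z ^ 2) (by linear_combination e) (by linear_combination h1)
    linear_combination this

/-- This reduces equality of sets of halves on two different curves to equality of one x-coordinate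
on the curves E'. -/
theorem halves_congr {R : E p} {R' : E q}
    (h : (lam p R).X * (lam q R').Z = (lam q R').X * (lam p R).Z) : halves R = halves R' := by
  rw [halves_eq, halves_eq]
  exact psiFiber_congr (lam p R).ne_zero (lam q R').ne_zero h

theorem twoTranslates_congr {P : E p} {P' : E q} (h : P.x = P'.x) :
    twoTranslates P = twoTranslates P' := by
  rw [twoTranslates_eq_halves, twoTranslates_eq_halves]
  apply halves_congr
  have hX : P.X = P'.X ∧ P.Z = P'.Z := by
    rw [Cover.x_eq_x_iff] at h
    rcases P.norm with h1 | ⟨h1, h2⟩ <;> rcases P'.norm with k1 | ⟨k1, k2⟩ <;> simp_all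
  have h1 := cross_two_nsmul P
  have h2 := cross_two_nsmul P'
  have h0 := psi_coords_ne P
  rw [← hX.1, ← hX.2] at h2
  exact cross_trans h0 h1 (by linear_combination -h2)

theorem halves_subset_torsion {R : E p} (h : IsOfFinAddOrder R) :
    halves R ⊆ Cover.x '' {P : E p | IsOfFinAddOrder P} := by
  rintro _ ⟨P, hP, rfl⟩
  have hP' : 2 • P = R := hP
  rw [← hP'] at h
  exact ⟨P, h.of_nsmul two_ne_zero, rfl⟩

/-- At infinity `Rep` says nothing about Y, hence the two extra hypotheses. -/
theorem Rep.proportional {W : WeierstrassCurve.Affine ℂ} {T : W.Point} {X Y Z X' Y' Z' : ℂ}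
    (h : Rep T X Y Z) (h' : Rep T X' Y' Z') (hY : Z = 0 → Y = 0) (hY' : Z' = 0 → Y' = 0) :
    ∃ r ≠ 0, X' = r * X ∧ Y' = r ^ 2 * Y ∧ Z' = r * Z := by
  rcases h with ⟨hZ, hX, rfl⟩ | ⟨hZ, n, rfl⟩ <;> rcases h' with ⟨hZ', hX', h0⟩ | ⟨hZ', n', h0⟩
  · exact ⟨X' / X, div_ne_zero hX' hX, by field_simp, by simp [hY hZ, hY' hZ'], by simp [hZ, hZ']⟩
  · exact absurd h0.symm (WeierstrassCurve.Affine.Point.some_ne_zero _)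
  · exact absurd h0 (WeierstrassCurve.Affine.Point.some_ne_zero _)
  · obtain ⟨hx, hy⟩ := WeierstrassCurve.Affine.Point.some.inj h0
    refine ⟨Z' / Z, div_ne_zero hZ' hZ, ?_, ?_, by field_simp⟩
    · field_simp at hx ⊢
      linear_combination -hx
    · field_simp at hy ⊢
      linear_combination -hy

/-! ### Curves with a rational point of order three and the isogeny between them -/

/-- The elliptic curve `y ^ 2 = x ^ 3 + (3 x - k) ^ 2`. In terms of `x = k f`, `y = k g` it is the
curve `g ^ 2 = k f ^ 3 + (1 - 3 f) ^ 2`, which has the points `(0, ±1)` of order three. -/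
def flexCurve (k : ℂ) : WeierstrassCurve.Affine ℂ :=
  { a₁ := 0, a₂ := 9, a₃ := 0, a₄ := -6 * k, a₆ := k ^ 2 }

/-- The quartic form `v (v (v - 3 u) ^ 2 + k u ^ 3)`; here `v / u = 1 / f`. -/
def flexQuartic (k V U : ℂ) : ℂ := V * (V * (V - 3 * U) ^ 2 + k * U ^ 3)

theorem flexCurve_nonsingular {k : ℂ} (hk : k ≠ 0) (hk' : k + 4 ≠ 0) {x y : ℂ}
    (h : y ^ 2 = x ^ 3 + 9 * x ^ 2 - 6 * k * x + k ^ 2) : (flexCurve k).Nonsingular x y := by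
  rw [← WeierstrassCurve.Affine.equation_iff_nonsingular_of_Δ_ne_zero,
    equation_of_short (by rfl) (by rfl)]
  · simp only [flexCurve]
    linear_combination h
  · have : (flexCurve k).Δ = -432 * k ^ 3 * (k + 4) := by
      simp only [flexCurve, WeierstrassCurve.Δ, WeierstrassCurve.b₂, WeierstrassCurve.b₄,
        WeierstrassCurve.b₆, WeierstrassCurve.b₈]
      ring
    rw [this]
    exact mul_ne_zero (mul_ne_zero (by norm_num) (pow_ne_zero 3 hk)) hk'

theorem flexCurve_rep_neg {k : ℂ} {T : (flexCurve k).Point} {X Y Z : ℂ} (h : Rep T X Y Z) :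
    Rep (-T) X (-Y) Z := h.neg rfl rfl

section ThreeIsogeny

variable {k l : ℂ}

/-- The three-isogeny from `flexCurve l` to `flexCurve k`, where `k + l = -4`: the image of the
point `[l u : l g : w]` has the coordinates given here, with `δ ^ 2 = -3`. -/
def isogX (l W U : ℂ) : ℂ := -(l * U ^ 3 + 12 * U ^ 2 * W - 12 * U * W ^ 2 + 4 * W ^ 3)

/-- The `Y`-coordinate of the three-isogeny, see `isogX`. -/
def isogY (l δ W G U : ℂ) : ℂ := -(δ * G * U * (l * U ^ 3 + 12 * U * W ^ 2 - 8 * W ^ 3))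

/-- The `Z`-coordinate of the three-isogeny, see `isogX`. -/
def isogZ (W U : ℂ) : ℂ := 3 * U ^ 2 * W

variable {ζ : ℂ}

theorem root_rel (hζ : IsPrimitiveRoot ζ 3) : ζ ^ 2 + ζ + 1 = 0 := by
  have h1 : ζ ≠ 1 := hζ.ne_one (by norm_num)
  apply mul_left_cancel₀ (sub_ne_zero.mpr h1)
  linear_combination hζ.pow_eq_one

/-- By `e₁` and `e₂` the cubic minus the squared line equals (x - x₁)(x - x₂)(x - x₃) up to an
additive constant, so it takes the same value at x₁ and x₃. -/
theorem cubic_root_of_line {x₁ x₂ x₃ α β : ℂ} (e₁ : x₁ + x₂ + x₃ = α ^ 2 - 9)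
    (e₂ : x₁ * x₂ + x₁ * x₃ + x₂ * x₃ = -6 * k - 2 * α * β)
    (h : (α * x₁ + β) ^ 2 = x₁ ^ 3 + 9 * x₁ ^ 2 + -6 * k * x₁ + k ^ 2) :
    (α * x₃ + β) ^ 2 = x₃ ^ 3 + 9 * x₃ ^ 2 - 6 * k * x₃ + k ^ 2 := by
  linear_combination h - (x₃ - x₁) * (x₃ + x₁) * e₁ + (x₃ - x₁) * e₂

/-- A and B play the roles of φ₁(σQ) and φ₁(σ²Q), in the chart T = 1. The line through A and -B
meets the curve again in -(A - B). Conjugation symmetry in ζ, ζ² leaves only δ = ζ - ζ² with δ² =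
-3, and the result is expressed by the coordinates U = -X, W = (1 - X)², G = Y(1 - X) of φ₂(Q). -/
theorem sub_eq_isog_of_generic (hk : k ≠ 0) (hk' : k + 4 ≠ 0) (hkl : k + l = -4)
    (hζ : ζ ^ 2 + ζ + 1 = 0)
    {X Y : ℂ} (hY : Y ^ 2 = X ^ 6 + (k + 2) * X ^ 3 + 1) (h0 : X ≠ 0) (h1 : X - 1 ≠ 0)
    (hD : X ^ 2 - X + 1 ≠ 0) {A B : (flexCurve k).Point}
    (hA : Rep A (k * (ζ * X)) (k * (Y * (ζ * X + 1))) ((ζ * X + 1) ^ 2))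
    (hB : Rep B (k * (ζ ^ 2 * X)) (k * (Y * (ζ ^ 2 * X + 1))) ((ζ ^ 2 * X + 1) ^ 2)) :
    Rep (A - B) (isogX l ((1 - X) ^ 2) (-X)) (isogY l (ζ - ζ ^ 2) ((1 - X) ^ 2) (Y * (1 - X)) (-X))
      (isogZ ((1 - X) ^ 2) (-X)) := by
  obtain rfl : l = -4 - k := by linear_combination hkl
  have hD' : (ζ * X + 1) * (ζ ^ 2 * X + 1) = X ^ 2 - X + 1 := by
    linear_combination (X ^ 2 * (ζ - 1) + X) * hζ
  have ha : ζ * X + 1 ≠ 0 := fun h => hD (by rw [← hD', h, zero_mul])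
  have hb : ζ ^ 2 * X + 1 ≠ 0 := fun h => hD (by rw [← hD', h, mul_zero])
  have h1' : 1 - X ≠ 0 := fun h => h1 (by linear_combination -h)
  have hZ : isogZ ((1 - X) ^ 2) (-X) ≠ 0 := by
    simp only [isogZ]
    exact mul_ne_zero (mul_ne_zero (by norm_num) (pow_ne_zero 2 (neg_ne_zero.mpr h0)))
      (pow_ne_zero 2 h1')
  rcases hA with ⟨h, -⟩ | ⟨-, nA, rfl⟩
  · exact absurd h (pow_ne_zero 2 ha)
  replace hB := flexCurve_rep_neg hB
  rcases hB with ⟨h, -⟩ | ⟨-, nB, eB⟩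
  · exact absurd h (pow_ne_zero 2 hb)
  rw [sub_eq_add_neg, eB]
  obtain ⟨D, hDdef⟩ : ∃ D, D = X ^ 2 - X + 1 := ⟨_, rfl⟩
  obtain ⟨δ, hδdef⟩ : ∃ δ, δ = ζ - ζ ^ 2 := ⟨_, rfl⟩
  rw [← hDdef] at hD hD'
  rw [← hδdef]
  have hδ : δ ^ 2 = -3 := by rw [hδdef]; linear_combination (ζ ^ 2 - 3 * ζ + 3) * hζ
  have hp₁ : ζ * (ζ ^ 2 * X + 1) ^ 2 = ζ ^ 2 * X ^ 2 + 2 * X + ζ := by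
    linear_combination (ζ - 1) * (ζ ^ 2 * X ^ 2 + 2 * X) * hζ
  have hp₂ : ζ ^ 2 * (ζ * X + 1) ^ 2 = ζ * X ^ 2 + 2 * X + ζ ^ 2 := by
    linear_combination (ζ - 1) * (ζ * X ^ 2 + 2 * X) * hζ
  have hq₁ : (ζ ^ 2 * X + 1) ^ 3 = X ^ 3 + 3 * ζ * X ^ 2 + 3 * ζ ^ 2 * X + 1 := by
    linear_combination (ζ - 1) * ((ζ ^ 3 + 1) * X ^ 3 + 3 * ζ * X ^ 2) * hζ
  have hq₂ : (ζ * X + 1) ^ 3 = X ^ 3 + 3 * ζ ^ 2 * X ^ 2 + 3 * ζ * X + 1 := by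
    linear_combination (ζ - 1) * X ^ 3 * hζ
  have hxa : k * (ζ * X) / (ζ * X + 1) ^ 2 = k * X * (ζ ^ 2 * X ^ 2 + 2 * X + ζ) / D ^ 2 := by
    rw [← hD', ← hp₁]
    field_simp
  have hxb : k * (ζ ^ 2 * X) / (ζ ^ 2 * X + 1) ^ 2 = k * X * (ζ * X ^ 2 + 2 * X + ζ ^ 2) / D ^ 2 := by
    rw [← hD', ← hp₂]
    field_simp
  have hya : k * (Y * (ζ * X + 1)) / ((ζ * X + 1) ^ 2) ^ 2
      = k * Y * (X ^ 3 + 3 * ζ * X ^ 2 + 3 * ζ ^ 2 * X + 1) / D ^ 3 := by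
    rw [← hD', ← hq₁]
    field_simp
  have hyb : -(k * (Y * (ζ ^ 2 * X + 1))) / ((ζ ^ 2 * X + 1) ^ 2) ^ 2
      = -(k * Y * (X ^ 3 + 3 * ζ ^ 2 * X ^ 2 + 3 * ζ * X + 1)) / D ^ 3 := by
    rw [← hD', ← hq₂]
    field_simp
  -- The expression being squared is the slope α of the line through A and -B; its intercept is β =
  -- kδY/(3(X - 1)D). The facts `e₁`, `e₂`, `l₁`, `l₂`, `l₃` below are the hypotheses of
  -- `add_eq_neg_of_line`.
  have hα : (δ * Y * (2 - X) * (1 - 2 * X) / (3 * X * (X - 1) * D)) ^ 2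
      = -(X ^ 6 + (k + 2) * X ^ 3 + 1) * ((2 - X) * (1 - 2 * X)) ^ 2
        / (3 * X ^ 2 * (X - 1) ^ 2 * D ^ 2) := by
    rw [← hY, div_pow, div_eq_div_iff (by simp [h0, h1, hD]) (by simp [h0, h1, hD])]
    linear_combination (3 * X ^ 2 * (X - 1) ^ 2 * D ^ 2) * (Y * (2 - X) * (1 - 2 * X)) ^ 2 * hδ
  have hαβ : (δ * Y * (2 - X) * (1 - 2 * X) / (3 * X * (X - 1) * D))
        * (k * δ * Y / (3 * (X - 1) * D))
      = -k * (X ^ 6 + (k + 2) * X ^ 3 + 1) * ((2 - X) * (1 - 2 * X))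
        / (3 * X * (X - 1) ^ 2 * D ^ 2) := by
    rw [← hY, div_mul_div_comm, div_eq_div_iff (by simp [h0, h1, hD]) (by simp [h0, h1, hD])]
    linear_combination (3 * X * (X - 1) ^ 2 * D ^ 2) * (k * Y ^ 2 * (2 - X) * (1 - 2 * X)) * hδ
  have hx3 : isogX (-4 - k) ((1 - X) ^ 2) (-X) / isogZ ((1 - X) ^ 2) (-X)
      = ((-4 - k) * X ^ 3 - 12 * X ^ 2 * (X - 1) ^ 2 - 12 * X * (X - 1) ^ 4 - 4 * (X - 1) ^ 6)
        / (3 * X ^ 2 * (X - 1) ^ 2) := by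
    rw [div_eq_div_iff hZ (by simp [h0, h1])]
    simp only [isogX, isogZ]
    ring
  have hy3 : -isogY (-4 - k) δ ((1 - X) ^ 2) (Y * (1 - X)) (-X) / isogZ ((1 - X) ^ 2) (-X) ^ 2
      = δ * Y * ((4 + k) * X ^ 3 - 12 * X * (X - 1) ^ 4 - 8 * (X - 1) ^ 6)
        / (9 * X ^ 3 * (X - 1) ^ 3) := by
    rw [div_eq_div_iff (pow_ne_zero 2 hZ) (by simp [h0, h1])]
    simp only [isogY, isogZ]
    ring
  have hsum : k * (ζ * X) / (ζ * X + 1) ^ 2 + k * (ζ ^ 2 * X) / (ζ ^ 2 * X + 1) ^ 2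
      = k * X * (-X ^ 2 + 4 * X - 1) / D ^ 2 := by
    rw [hxa, hxb, ← add_div]
    congr 1
    linear_combination k * X * (X ^ 2 + 1) * hζ
  have hprod : k * (ζ * X) / (ζ * X + 1) ^ 2 * (k * (ζ ^ 2 * X) / (ζ ^ 2 * X + 1) ^ 2)
      = k ^ 2 * X ^ 2 / D ^ 2 := by
    rw [← hD']
    field_simp
    linear_combination (ζ - 1) * hζ
  have e₁ : k * (ζ * X) / (ζ * X + 1) ^ 2 + k * (ζ ^ 2 * X) / (ζ ^ 2 * X + 1) ^ 2
      + isogX (-4 - k) ((1 - X) ^ 2) (-X) / isogZ ((1 - X) ^ 2) (-X)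
      = (δ * Y * (2 - X) * (1 - 2 * X) / (3 * X * (X - 1) * D)) ^ 2 - 9 := by
    rw [hsum, hα, hx3]
    field_simp
    rw [hDdef]
    ring
  have e₂ : k * (ζ * X) / (ζ * X + 1) ^ 2 * (k * (ζ ^ 2 * X) / (ζ ^ 2 * X + 1) ^ 2)
      + k * (ζ * X) / (ζ * X + 1) ^ 2 * (isogX (-4 - k) ((1 - X) ^ 2) (-X)
        / isogZ ((1 - X) ^ 2) (-X))
      + k * (ζ ^ 2 * X) / (ζ ^ 2 * X + 1) ^ 2 * (isogX (-4 - k) ((1 - X) ^ 2) (-X)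
        / isogZ ((1 - X) ^ 2) (-X))
      = -6 * k - 2 * (δ * Y * (2 - X) * (1 - 2 * X) / (3 * X * (X - 1) * D))
        * (k * δ * Y / (3 * (X - 1) * D)) := by
    rw [mul_assoc 2, hαβ, add_assoc, ← add_mul, hsum, hprod, hx3]
    field_simp
    rw [hDdef]
    ring
  have l₃ : -isogY (-4 - k) δ ((1 - X) ^ 2) (Y * (1 - X)) (-X) / isogZ ((1 - X) ^ 2) (-X) ^ 2
      = δ * Y * (2 - X) * (1 - 2 * X) / (3 * X * (X - 1) * D)
        * (isogX (-4 - k) ((1 - X) ^ 2) (-X) / isogZ ((1 - X) ^ 2) (-X))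
        + k * δ * Y / (3 * (X - 1) * D) := by
    rw [hx3, hy3]
    field_simp
    rw [hDdef]
    ring
  have l₁ : k * (Y * (ζ * X + 1)) / ((ζ * X + 1) ^ 2) ^ 2
      = δ * Y * (2 - X) * (1 - 2 * X) / (3 * X * (X - 1) * D) * (k * (ζ * X) / (ζ * X + 1) ^ 2)
        + k * δ * Y / (3 * (X - 1) * D) := by
    rw [hxa, hya]
    have : 3 * (X - 1) * (X ^ 3 + 3 * ζ * X ^ 2 + 3 * ζ ^ 2 * X + 1)
        = δ * ((2 - X) * (1 - 2 * X) * (ζ ^ 2 * X ^ 2 + 2 * X + ζ) + D ^ 2) := by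
      rw [hδdef, hDdef]
      clear * - hζ
      grind
    field_simp
    linear_combination Y * this
  have l₂ : -(k * (Y * (ζ ^ 2 * X + 1))) / ((ζ ^ 2 * X + 1) ^ 2) ^ 2
      = δ * Y * (2 - X) * (1 - 2 * X) / (3 * X * (X - 1) * D)
        * (k * (ζ ^ 2 * X) / (ζ ^ 2 * X + 1) ^ 2) + k * δ * Y / (3 * (X - 1) * D) := by
    rw [hxb, hyb]
    have : -(3 * (X - 1) * (X ^ 3 + 3 * ζ ^ 2 * X ^ 2 + 3 * ζ * X + 1))
        = δ * ((2 - X) * (1 - 2 * X) * (ζ * X ^ 2 + 2 * X + ζ ^ 2) + D ^ 2) := by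
      rw [hδdef, hDdef]
      clear * - hζ
      grind
    field_simp
    linear_combination Y * this
  have qA := (nonsingular_of_short (W := flexCurve k) rfl rfl).mp nA |>.1
  have nC := flexCurve_nonsingular hk hk' (cubic_root_of_line e₁ e₂ (by rw [← l₁]; exact qA))
  rw [add_eq_neg_of_line rfl rfl nA nB nC l₁ l₂ rfl e₁ e₂]
  have hy : isogY (-4 - k) δ ((1 - X) ^ 2) (Y * (1 - X)) (-X) / isogZ ((1 - X) ^ 2) (-X) ^ 2
      = -(δ * Y * (2 - X) * (1 - 2 * X) / (3 * X * (X - 1) * D)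
        * (isogX (-4 - k) ((1 - X) ^ 2) (-X) / isogZ ((1 - X) ^ 2) (-X))
        + k * δ * Y / (3 * (X - 1) * D)) := by
    rw [← l₃, neg_div, neg_neg]
  have nC' := (WeierstrassCurve.Affine.nonsingular_neg (W' := flexCurve k) _ _).mpr nC
  rw [negY_of_short rfl rfl, ← hy] at nC'
  exact Or.inr ⟨hZ, nC', neg_some_of_short rfl rfl _ _ rfl hy⟩

end ThreeIsogeny

/-! ### The addition formulas along V + W = U -/

section Core

variable {k l δ V W U G₁ G₂ : ℂ}

/-- This identity and the two after it evaluate the polynomial expressions in `add_eq_or_eq_neg` for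
a point over k U : V and the isogeny image of a point over l U : W. On V + W = U they collapse to
polynomials in the two quartics F₁, F₂ alone. -/
theorem core_N (hkl : k + l = -4) (hW : W = U - V) :
    (k * U) * isogX l W U * ((k * U) * isogZ W U + isogX l W U * V)
      + 2 * 9 * (k * U) * isogX l W U * V * isogZ W U
      + (-6 * k) * ((k * U) * isogZ W U + isogX l W U * V) * V * isogZ W U
      + 2 * k ^ 2 * V ^ 2 * isogZ W U ^ 2
    = k * (flexQuartic k V U - flexQuartic l W U) *
      (flexQuartic k V U - 3 * flexQuartic l W U) := by
  obtain rfl : l = -4 - k := by linear_combination hkl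
  subst hW
  simp only [isogX, isogZ, flexQuartic]
  ring

theorem core_D (hkl : k + l = -4) (hW : W = U - V) :
    ((k * U) * isogZ W U - isogX l W U * V) ^ 2
    = (flexQuartic k V U - 3 * flexQuartic l W U) ^ 2
      + 12 * flexQuartic k V U * flexQuartic l W U := by
  obtain rfl : l = -4 - k := by linear_combination hkl
  subst hW
  simp only [isogX, isogZ, flexQuartic]
  ring

theorem core_M (hkl : k + l = -4) (hW : W = U - V) :
    ((k * U) * isogX l W U - (-6 * k) * V * isogZ W U) ^ 2
      - 4 * k ^ 2 * V * isogZ W U * ((k * U) * isogZ W U + isogX l W U * V + 9 * V * isogZ W U)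
    = k ^ 2 * (flexQuartic k V U - flexQuartic l W U) ^ 2 := by
  obtain rfl : l = -4 - k := by linear_combination hkl
  subst hW
  simp only [isogX, isogZ, flexQuartic]
  ring

theorem core_Y (hkl : k + l = -4) (hW : W = U - V) :
    U * (l * U ^ 3 + 12 * U * W ^ 2 - 8 * W ^ 3) = -(flexQuartic k V U - flexQuartic l W U) := by
  obtain rfl : l = -4 - k := by linear_combination hkl
  subst hW
  simp only [flexQuartic]
  ring

/-- With δ² = -3 the right side of `core_D` factors as (F₁ - 3F₂ - 2δG₁G₂)(F₁ - 3F₂ + 2δG₁G₂). The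
second factor cancels against the numerator k(F₁ - F₂)(F₁ - 3F₂ + 2δG₁G₂). The first one times ζ is
the square (ζ(G₁ - G₂) + G₁ + G₂)². So the sum has the form of φ₁ at ζX : T with X = G₁ - G₂ and T =
G₁ + G₂. -/
theorem neg_add_isog (hkl : k + l = -4) (hW : W = U - V)
    (hG₁ : G₁ ^ 2 = flexQuartic k V U) (hG₂ : G₂ ^ 2 = flexQuartic l W U) {ζ : ℂ}
    (hζ : ζ ^ 2 + ζ + 1 = 0) {P B C : (flexCurve k).Point} {Y₃ : ℂ}
    (hP : Rep P (k * U) (k * G₁) V)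
    (hB : Rep B (isogX l W U) (isogY l (ζ - ζ ^ 2) W G₂ U) (isogZ W U))
    (hC : Rep C (k * (ζ * (G₁ - G₂) * (G₁ + G₂))) Y₃ ((ζ * (G₁ - G₂) + (G₁ + G₂)) ^ 2)) :
    -P + B = C ∨ -P + B = -C := by
  have hF : (G₁ - G₂) * (G₁ + G₂) = flexQuartic k V U - flexQuartic l W U := by
    linear_combination hG₁ - hG₂
  have hZ : (ζ * (G₁ - G₂) + (G₁ + G₂)) ^ 2 = ζ * (flexQuartic k V U - 3 * flexQuartic l W U
      - 2 * (ζ - ζ ^ 2) * (G₁ * G₂)) := by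
    linear_combination ζ * hG₁ - 3 * ζ * hG₂
      + (G₁ ^ 2 + G₂ ^ 2 - 2 * G₁ * G₂ + (4 - 2 * ζ) * G₁ * G₂) * hζ
  have hδ : (ζ - ζ ^ 2) ^ 2 = -3 := by linear_combination (ζ ^ 2 - 3 * ζ + 3) * hζ
  have hΓ : (G₁ * G₂) ^ 2 = flexQuartic k V U * flexQuartic l W U := by
    rw [mul_pow, hG₁, hG₂]
  have hYY : k * G₁ * isogY l (ζ - ζ ^ 2) W G₂ U
      = k * (ζ - ζ ^ 2) * (G₁ * G₂) * (flexQuartic k V U - flexQuartic l W U) := by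
    have := core_Y hkl hW
    simp only [isogY]
    linear_combination -k * (ζ - ζ ^ 2) * (G₁ * G₂) * this
  have hN := core_N hkl hW
  have hD := core_D hkl hW
  have hM := core_M hkl hW
  refine add_eq_or_eq_neg rfl rfl (flexCurve_rep_neg hP) hB hC ?_ ?_ ?_ ?_
  · simp only [flexCurve]
    rw [mul_assoc ζ, hF, hZ, hD, hN]
    generalize flexQuartic k V U = a at *
    generalize flexQuartic l W U = b at *
    generalize ζ - ζ ^ 2 = d at *
    linear_combination (-2 * ζ * (a - 3 * b - 2 * d * (G₁ * G₂))) * hYY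
      + 4 * ζ * k * (a - b) * (G₁ * G₂) ^ 2 * hδ - 12 * ζ * k * (a - b) * hΓ
  · simp only [flexCurve]
    rw [mul_assoc ζ, hF, hZ, hN, hM]
    generalize flexQuartic k V U = a at *
    generalize flexQuartic l W U = b at *
    generalize ζ - ζ ^ 2 = d at *
    linear_combination (-2 * k * ζ * (a - b)) * hYY
  · intro h
    have : G₁ ^ 2 = 0 := by rw [hG₁, h]; simp [flexQuartic]
    rw [pow_eq_zero_iff two_ne_zero] at this
    rw [this]; ring
  · intro h
    have : U = 0 ∨ W = 0 := by simpa [isogZ] using h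
    rcases this with h | h
    · simp [isogY, h]
    · have : G₂ ^ 2 = 0 := by rw [hG₂, h]; simp [flexQuartic]
      rw [pow_eq_zero_iff two_ne_zero] at this
      simp [isogY, this]

/-- The companion of `neg_add_isog` for ζ = 1: the value of f at 2P is (F₁ - F₂)/(4F₁). -/
theorem two_nsmul_flex (hkl : k + l = -4) (hW : W = U - V)
    (hG₁ : G₁ ^ 2 = flexQuartic k V U) (hG₂ : G₂ ^ 2 = flexQuartic l W U)
    {P C : (flexCurve k).Point} {Y₃ : ℂ} (hP : Rep P (k * U) (k * G₁) V)
    (hC : Rep C (k * ((G₁ - G₂) * (G₁ + G₂))) Y₃ (((G₁ - G₂) + (G₁ + G₂)) ^ 2)) :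
    2 • P = C ∨ 2 • P = -C := by
  have hF : (G₁ - G₂) * (G₁ + G₂) = flexQuartic k V U - flexQuartic l W U := by
    linear_combination hG₁ - hG₂
  have hZ : ((G₁ - G₂) + (G₁ + G₂)) ^ 2 = 4 * flexQuartic k V U := by
    linear_combination 4 * hG₁
  obtain rfl : l = -4 - k := by linear_combination hkl
  subst hW
  refine two_nsmul_eq_or_eq_neg rfl rfl hP hC ?_ ?_
  · rw [mul_pow, hG₁]
    simp only [flexCurve, flexQuartic]
    ring
  · rw [mul_pow, hG₁, hF, hZ]
    simp only [flexCurve, flexQuartic]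
    ring

/-- On x-coordinates, isogeny after duplication on the curve for l equals duplication on the curve
for k after isogeny. -/
theorem isog_two_identity (hkl : k + l = -4) :
    isogX l (4 * flexQuartic l W U) (U * (-8 * W ^ 3 + 12 * W ^ 2 * U + l * U ^ 3))
      * (4 * (isogZ W U * (isogX l W U ^ 3 + 9 * isogX l W U ^ 2 * isogZ W U
        - 6 * k * isogX l W U * isogZ W U ^ 2 + k ^ 2 * isogZ W U ^ 3)))
    = isogZ (4 * flexQuartic l W U) (U * (-8 * W ^ 3 + 12 * W ^ 2 * U + l * U ^ 3))
      * ((isogX l W U ^ 2 + 6 * k * isogZ W U ^ 2) ^ 2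
      - 4 * k ^ 2 * isogZ W U ^ 3 * (2 * isogX l W U + 9 * isogZ W U)) := by
  obtain rfl : k = -4 - l := by linear_combination hkl
  simp only [isogX, isogZ, flexQuartic]
  ring

end Core

section ThreeIsogeny

variable {k l ζ : ℂ}

/-- The homogeneous version, with the configurations where the chord computation breaks down treated
separately. -/
theorem sub_eq_isog (hk : k ≠ 0) (hk' : k + 4 ≠ 0) (hkl : k + l = -4)
    (hζ : ζ ^ 2 + ζ + 1 = 0) {X Y T : ℂ} (hXT : X ≠ 0 ∨ T ≠ 0)
    (hY : Y ^ 2 = X ^ 6 + (k + 2) * X ^ 3 * T ^ 3 + T ^ 6) {A B : (flexCurve k).Point}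
    (hA : Rep A (k * (ζ * X * T)) (k * (Y * (ζ * X + T))) ((ζ * X + T) ^ 2))
    (hB : Rep B (k * (ζ ^ 2 * X * T)) (k * (Y * (ζ ^ 2 * X + T))) ((ζ ^ 2 * X + T) ^ 2)) :
    Rep (A - B) (isogX l ((T - X) ^ 2) (-(X * T)))
      (isogY l (ζ - ζ ^ 2) ((T - X) ^ 2) (Y * (T - X)) (-(X * T)))
      (isogZ ((T - X) ^ 2) (-(X * T))) := by
  obtain rfl : l = -4 - k := by linear_combination hkl
  have hζ0 : ζ ≠ 0 := by rintro rfl; norm_num at hζ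
  have hl : -4 - k ≠ 0 := fun h => hk' (by linear_combination -h)
  -- For X = 0, T = 0 or T = X the two points coincide, and `isogZ` vanishes.
  by_cases hX : X = 0
  · subst hX
    have hT : T ≠ 0 := by simpa using hXT
    have hA' : A = B := by
      simp only [mul_zero, zero_mul, zero_add] at hA hB
      exact hA.unique hB
    refine Or.inl ⟨by simp [isogZ], by simp [isogX, hT], by rw [hA', sub_self]⟩
  by_cases hT : T = 0
  · subst hT
    have hA' : A = B := by
      refine Rep.unique (hA.smul (pow_ne_zero 2 hζ0)) ?_
      convert hB using 1
      · ring
      · linear_combination k * Y * ζ ^ 2 * X * (ζ - 1) * hζ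
      · ring
    refine Or.inl ⟨by simp [isogZ], by simp [isogX, hX], by rw [hA', sub_self]⟩
  by_cases h1 : T - X = 0
  · obtain rfl : T = X := by linear_combination h1
    have hA' : A = B := by
      refine Rep.unique (hA.smul hζ0) ?_
      convert hB using 1
      · ring
      · linear_combination k * Y * T * (ζ - 1) * hζ
      · linear_combination T ^ 2 * (-ζ ^ 2 - 1 + 2 * ζ) * hζ
    refine Or.inl ⟨by simp [isogZ], by simp [isogX, hT, hl], by rw [hA', sub_self]⟩
  -- Here A is the zero of the group, and below, when ζ²X + T = 0, it is B; the difference is then ∓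
  -- the other point.
  by_cases h2 : ζ * X + T = 0
  · obtain rfl : T = -(ζ * X) := by linear_combination h2
    have hA' : A = 0 := by
      rcases hA with ⟨-, -, h⟩ | ⟨h, -⟩
      · exact h
      · exact absurd (by rw [h2]; ring) h
    rw [hA', zero_sub]
    have := (flexCurve_rep_neg hB).smul (neg_ne_zero.mpr (pow_ne_zero 4 hX))
    clear * - this hζ
    convert this using 1
    · simp only [isogX]; grind
    · simp only [isogY]; grind
    · simp only [isogZ]; grind
  by_cases h3 : ζ ^ 2 * X + T = 0
  · obtain rfl : T = -(ζ ^ 2 * X) := by linear_combination h3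
    have hB' : B = 0 := by
      rcases hB with ⟨-, -, h⟩ | ⟨h, -⟩
      · exact h
      · exact absurd (by rw [h3]; ring) h
    rw [hB', sub_zero]
    have := hA.smul (neg_ne_zero.mpr (pow_ne_zero 4 hX))
    clear * - this hζ
    convert this using 1
    · simp only [isogX]; grind
    · simp only [isogY]; grind
    · simp only [isogZ]; grind
  have hD : (X / T) ^ 2 - X / T + 1 ≠ 0 := by
    intro h
    have h4 : (ζ * X + T) * (ζ ^ 2 * X + T) = T ^ 2 * ((X / T) ^ 2 - X / T + 1) := by
      field_simp
      linear_combination (X ^ 2 * (ζ - 1) + X * T) * hζ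
    rw [h, mul_zero] at h4
    exact (mul_ne_zero h2 h3) h4
  have hY' : (Y / T ^ 3) ^ 2 = (X / T) ^ 6 + (k + 2) * (X / T) ^ 3 + 1 := by
    field_simp
    linear_combination hY
  have hr : (T ^ 2)⁻¹ ≠ 0 := inv_ne_zero (pow_ne_zero 2 hT)
  have h4 : X / T - 1 ≠ 0 := by
    rw [div_sub_one hT]
    exact div_ne_zero (fun h => h1 (by linear_combination -h)) hT
  have hA' := hA.smul hr
  have hB' := hB.smul hr
  have := (sub_eq_isog_of_generic hk hk' hkl hζ hY' (div_ne_zero hX hT) h4 hD (A := A) (B := B)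
    (by convert hA' using 1 <;> field_simp) (by convert hB' using 1 <;> field_simp)).smul
    (pow_ne_zero 6 hT)
  convert this using 1
  · simp only [isogX]; field_simp
  · simp only [isogY]; field_simp
  · simp only [isogZ]; field_simp

theorem flexCurve_exists_rep (hk : k ≠ 0) (hk' : k + 4 ≠ 0) {X Z : ℂ} (h : X ≠ 0 ∨ Z ≠ 0) :
    ∃ (T : (flexCurve k).Point) (Y : ℂ), Rep T X Y Z ∧ (Z = 0 → Y = 0) := by
  by_cases hZ : Z = 0
  · exact ⟨0, 0, Or.inl ⟨hZ, by simpa [hZ] using h, rfl⟩, fun _ => rfl⟩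
  · obtain ⟨y, hy⟩ := IsAlgClosed.exists_pow_nat_eq
      ((X / Z) ^ 3 + 9 * (X / Z) ^ 2 - 6 * k * (X / Z) + k ^ 2) (n := 2) (by norm_num)
    have hy' : y * Z ^ 2 / Z ^ 2 = y := by field_simp
    have n := flexCurve_nonsingular hk hk' hy
    exact ⟨.some _ _ n, y * Z ^ 2, Or.inr ⟨hZ, by rwa [hy'], by simp only [hy']⟩,
      fun h => absurd h hZ⟩

theorem isog_equation (hkl : k + l = -4) {δ W G U : ℂ} (hδ : δ ^ 2 = -3)
    (hG : G ^ 2 = flexQuartic l W U) :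
    isogY l δ W G U ^ 2 = isogZ W U * (isogX l W U ^ 3 + 9 * isogX l W U ^ 2 * isogZ W U
      + -6 * k * isogX l W U * isogZ W U ^ 2 + k ^ 2 * isogZ W U ^ 3) := by
  obtain rfl : k = -4 - l := by linear_combination hkl
  have : isogY l δ W G U ^ 2
      = -3 * flexQuartic l W U * (U * (l * U ^ 3 + 12 * U * W ^ 2 - 8 * W ^ 3)) ^ 2 := by
    rw [← hG, ← hδ, isogY]
    ring
  rw [this]
  simp only [isogX, isogZ, flexQuartic]
  ring

/-- A substitute for additivity of the isogeny: `isog_two_identity` controls x-coordinates only,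
which gives compatibility with doubling up to sign. This suffices for torsion points. -/
theorem two_nsmul_isog (hl : l ≠ 0) (hl' : l + 4 ≠ 0) (hkl : k + l = -4)
    {δ W G U W' G' U' : ℂ} (hδ : δ ^ 2 = -3) (hG : G ^ 2 = flexQuartic l W U)
    (hG' : G' ^ 2 = flexQuartic l W' U') {P : (flexCurve l).Point} {A A' : (flexCurve k).Point}
    (hP : Rep P (l * U) (l * G) W) (hP' : Rep (2 • P) (l * U') (l * G') W')
    (hA : Rep A (isogX l W U) (isogY l δ W G U) (isogZ W U))
    (hA' : Rep A' (isogX l W' U') (isogY l δ W' G' U') (isogZ W' U')) :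
    2 • A = A' ∨ 2 • A = -A' := by
  have hWU : W = 0 → U ≠ 0 := by
    rintro hW rfl
    rcases hP with ⟨-, h, -⟩ | ⟨h, -⟩
    · exact h (mul_zero l)
    · exact h hW
  -- Numerator and denominator of the duplication formula have no common zero, as l and l + 4 are
  -- nonzero.
  have hne : l * (U * (-8 * W ^ 3 + 12 * W ^ 2 * U + l * U ^ 3)) ≠ 0
      ∨ 4 * flexQuartic l W U ≠ 0 := by
    by_contra! h
    obtain ⟨h1, h2⟩ := h
    simp only [flexQuartic, mul_eq_zero, hl, false_or, OfNat.ofNat_ne_zero] at h1 h2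
    by_cases hW : W = 0
    · have hU := hWU hW
      simp [hW, hU, hl] at h1
    · have h3 := h2.resolve_left hW
      by_cases hU : U = 0
      · simp [hU, hW] at h3
      · have h4 := h1.resolve_left hU
        have h5 : W * (W - U) ^ 2 = 0 := by linear_combination (h3 - h4) / 9
        have h6 : W = U := by
          simpa [hW, sub_eq_zero] using h5
        subst h6
        exact mul_ne_zero hl' (pow_ne_zero 3 hW) (by linear_combination h3)
  obtain ⟨C, Y₃, hC, hY₃⟩ := flexCurve_exists_rep hl hl' hne
  have h2 : 2 • P = C ∨ 2 • P = -C := by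
    refine two_nsmul_eq_or_eq_neg rfl rfl hP hC ?_ ?_
    · rw [mul_pow, hG]
      simp only [flexCurve, flexQuartic]
      ring
    · rw [mul_pow, hG]
      simp only [flexCurve, flexQuartic]
      ring
  have h3 : ∃ Y, Rep (2 • P) (l * (U * (-8 * W ^ 3 + 12 * W ^ 2 * U + l * U ^ 3))) Y
      (4 * flexQuartic l W U) ∧ (4 * flexQuartic l W U = 0 → Y = 0) := by
    rcases h2 with h | h
    · exact ⟨Y₃, h ▸ hC, hY₃⟩
    · exact ⟨-Y₃, h ▸ flexCurve_rep_neg hC, fun h0 => by rw [hY₃ h0, neg_zero]⟩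
  obtain ⟨Y, hY, hY0⟩ := h3
  obtain ⟨r, hr, hX, -, hZ⟩ := hP'.proportional hY (by
    rintro rfl
    have : G' ^ 2 = 0 := by rw [hG']; simp [flexQuartic]
    rw [pow_eq_zero_iff two_ne_zero] at this
    rw [this, mul_zero]) hY0
  have hX' : U * (-8 * W ^ 3 + 12 * W ^ 2 * U + l * U ^ 3) = r * U' :=
    mul_left_cancel₀ hl (by linear_combination hX)
  have hid := isog_two_identity (W := W) (U := U) hkl
  rw [hX', hZ] at hid
  have hq := isog_equation hkl hδ hG
  refine two_nsmul_eq_or_eq_neg rfl rfl hA (hA'.smul (pow_ne_zero 3 hr)) ?_ ?_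
  · simp only [flexCurve]
    exact hq
  · rw [hq]
    simp only [flexCurve]
    have e₁ : isogX l (r * W') (r * U') = r ^ 3 * isogX l W' U' := by simp only [isogX]; ring
    have e₂ : isogZ (r * W') (r * U') = r ^ 3 * isogZ W' U' := by simp only [isogZ]; ring
    rw [e₁, e₂] at hid
    linear_combination hid

end ThreeIsogeny

/-- By induction 2ⁿ f(P) = ±f(2ⁿ P). The multiples of P form a finite set, so 2ᵃP = 2ᵇP for some a ≠
b, whence 2ᵃ - 2ᵇ or 2ᵃ + 2ᵇ annihilates f(P). -/
theorem isOfFinAddOrder_of_two_nsmul {A B : Type*} [AddCommGroup A] [AddCommGroup B] {f : A → B}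
    (hf : ∀ P, 2 • f P = f (2 • P) ∨ 2 • f P = -f (2 • P)) {P : A} (hP : IsOfFinAddOrder P) :
    IsOfFinAddOrder (f P) := by
  have key : ∀ n : ℕ, 2 ^ n • f P = f (2 ^ n • P) ∨ 2 ^ n • f P = -f (2 ^ n • P) := by
    intro n
    induction n with
    | zero => simp
    | succ n ih =>
      rw [pow_succ', mul_nsmul', mul_nsmul']
      rcases ih with h | h <;> rw [h]
      · exact hf _
      · rw [smul_neg, neg_inj, neg_eq_iff_eq_neg]
        exact (hf _).symm
  have : Finite (AddSubgroup.zmultiples P) := (finite_zmultiples.mpr hP).to_subtype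
  obtain ⟨a, b, hab, h⟩ := Finite.exists_ne_map_eq_of_infinite
    fun n : ℕ => (⟨2 ^ n • P, nsmul_mem (AddSubgroup.mem_zmultiples P) _⟩ :
      AddSubgroup.zmultiples P)
  replace h : 2 ^ a • P = 2 ^ b • P := congrArg Subtype.val h
  have hne : (2 : ℤ) ^ a ≠ 2 ^ b := fun h =>
    hab (Nat.pow_right_injective le_rfl (by exact_mod_cast h))
  rw [isOfFinAddOrder_iff_zsmul_eq_zero]
  have hz : ∀ n : ℕ, (2 ^ n : ℤ) • f P = 2 ^ n • f P := fun n => by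
    rw [← natCast_zsmul]; norm_cast
  have hpos : (2 : ℤ) ^ a + 2 ^ b ≠ 0 := by positivity
  rcases key a with h1 | h1 <;> rcases key b with h2 | h2 <;> rw [h] at h1
  · exact ⟨2 ^ a - 2 ^ b, sub_ne_zero.mpr hne, by rw [sub_smul, hz, hz, h1, h2, sub_self]⟩
  · exact ⟨2 ^ a + 2 ^ b, hpos, by rw [add_smul, hz, hz, h1, h2, add_neg_cancel]⟩
  · exact ⟨2 ^ a + 2 ^ b, hpos, by rw [add_smul, hz, hz, h1, h2, neg_add_cancel]⟩
  · exact ⟨2 ^ a - 2 ^ b, sub_ne_zero.mpr hne, by rw [sub_smul, hz, hz, h1, h2, sub_self]⟩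

/-! ### Parameters with a given `x`-coordinate of a point of order three -/

/-- Since 2S = -S, the points λ(2S) and λ(S) have the same x-coordinate. This is a quintic equation
for x(S); the origin contributes the root x = s, and the cofactor is the three-division quartic. -/
theorem relation_of_addOrderOf_eq_three {p : Param} {S : E p} (h : addOrderOf S = 3) :
    S.Z = 1 ∧ S.X ≠ 0 ∧ p.s * S.X ^ 4 + 2 * p.s ^ 2 * S.X ^ 3 - 2 * S.X - p.s = 0 := by
  have hs := p.s_ne
  have h2 : 2 • S = -S := by
    rw [← add_eq_zero_iff_eq_neg, ← succ_nsmul]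
    have := addOrderOf_nsmul_eq_zero S
    rwa [h] at this
  have hS : S ≠ 0 := by
    rintro rfl
    rw [addOrderOf_zero] at h
    norm_num at h
  have h3 := cross_two_nsmul S
  rw [h2, lam_neg, E'.neg_eq_flip] at h3
  simp only [Cover.flip] at h3
  obtain ⟨r, hr, hX, -, hZ⟩ := lam_spec p S
  rw [hX, hZ] at h3
  rcases S.norm with h1 | ⟨h1, h1'⟩
  · rw [h1] at h3 ⊢
    have h4 : (S.X - p.s) * (p.s * S.X ^ 4 + 2 * p.s ^ 2 * S.X ^ 3 - 2 * S.X - p.s) = 0 := by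
      have := mul_left_cancel₀ hr (a := r)
        (b := 2 * ((p.s ^ 2 + 1) * (p.s * S.X + 1) * (2 * S.X ^ 2)))
        (c := 2 * ((S.X ^ 2 + 1) ^ 2 * (p.s * (S.X + p.s)))) (by linear_combination h3)
      linear_combination -this / 2
    have h5 : S.X - p.s ≠ 0 := by
      intro h
      apply hS
      rw [E.zero_eq_origin]
      have hX : S.X = p.s := by linear_combination h
      refine Cover.ext hX ?_ h1
      have := S.eqn
      simp only [formE, hX, h1] at this
      have h0 : S.Y ^ 2 = 0 := by rw [this]; ring
      simpa [E.origin] using h0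
    have h6 := (mul_eq_zero.mp h4).resolve_left h5
    refine ⟨rfl, fun h => hs ?_, h6⟩
    rw [h] at h6
    linear_combination -h6
  · rw [h1, h1'] at h3
    exact absurd h3.symm (by simp [hr, hs])

/-- With `n = s / r`, the point of `E_s` with `x`-coordinate `r` has order three. -/
structure IsFlexParam (p : Param) (r n : ℂ) : Prop where
  r_ne : r ≠ 0
  n_ne : n ≠ 0
  sub_ne : n - 1 ≠ 0
  add_ne : n + 1 ≠ 0
  two_ne : 2 * n + 1 ≠ 0
  add_two_ne : n + 2 ≠ 0
  quad_ne : n ^ 2 + 4 * n + 1 ≠ 0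
  rel : (r ^ 2) ^ 2 * (n * (2 * n + 1)) = n + 2
  s_eq : p.s = n * r

/-- The parameter `s / r` of the second curve. -/
def dual (n : ℂ) : ℂ := -(2 * n + 1) / (n + 2)

/-- The parameter `k` of the curve `flexCurve k` isomorphic to `E_s`. -/
def flexK (n : ℂ) : ℂ := -54 * n * (n + 1) ^ 4 / (n ^ 2 + 4 * n + 1) ^ 3

/-- The square of the quotient of the `y`-coordinates of the two points of order three. -/
def flexU (n : ℂ) : ℂ := -(2 * n + 1) * (n + 2) / (3 * n)

/-- The scaling factor of the isomorphism with `flexCurve k`. -/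
def flexMu (r n : ℂ) : ℂ := -36 * r ^ 2 * n ^ 2 * (2 * n + 1) / (n ^ 2 + 4 * n + 1) ^ 2

/-- The translation of the isomorphism with `flexCurve k`. -/
def flexNu (r n : ℂ) : ℂ :=
  18 * n * (r ^ 2 * n * (2 * n + 1) - (n ^ 2 + 3 * n + 1)) / (n ^ 2 + 4 * n + 1) ^ 2

/-- The quartic relation is quadratic in s with distinct roots s₁ and s₂. Vieta's formulas give
r²s₁s₂ = -1, hence s₂ = `dual n` · r. -/
theorem exists_isFlexParam {p q : Param} (hs : p.c ≠ q.c) {S₁ : E p} {S₂ : E q}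
    (hS₁ : addOrderOf S₁ = 3) (hS₂ : addOrderOf S₂ = 3) (hS : S₁.x = S₂.x) :
    ∃ r n, S₁.X = r ∧ S₁.Z = 1 ∧ S₂.X = r ∧ S₂.Z = 1 ∧ IsFlexParam p r n ∧
      q.s = dual n * r := by
  obtain ⟨hZ₁, hX₁, e₁⟩ := relation_of_addOrderOf_eq_three hS₁
  obtain ⟨hZ₂, hX₂, e₂⟩ := relation_of_addOrderOf_eq_three hS₂
  have hr : S₂.X = S₁.X := by
    rw [Cover.x_eq_x_iff, hZ₁, hZ₂] at hS
    linear_combination -hS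
  rw [hr] at e₂ hX₂
  obtain ⟨r, hr'⟩ : ∃ r, S₁.X = r := ⟨_, rfl⟩
  rw [hr'] at e₁ e₂ hX₁ hr
  have hne : p.s - q.s ≠ 0 := by
    intro h
    apply hs
    rw [Param.c, Param.c, sub_eq_zero.mp h]
  have h1 : r ^ 4 - 1 + 2 * r ^ 3 * (p.s + q.s) = 0 :=
    (mul_eq_zero.mp (by linear_combination e₁ - e₂ :
      (p.s - q.s) * (r ^ 4 - 1 + 2 * r ^ 3 * (p.s + q.s)) = 0)).resolve_left hne
  have h2 : r ^ 2 * (p.s * q.s) = -1 := by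
    have : r * (r ^ 2 * (p.s * q.s) + 1) = 0 := by linear_combination p.s / 2 * h1 - e₁ / 2
    linear_combination (mul_eq_zero.mp this).resolve_left hX₁
  obtain ⟨n, hn⟩ : ∃ n, p.s = n * r := ⟨p.s / r, by field_simp⟩
  have hp := p.s_ne
  have hp4 := p.s_pow
  rw [hn] at hp hp4 e₁ h2 hne
  have hn0 : n ≠ 0 := fun h => hp (by rw [h, zero_mul])
  have rel : (r ^ 2) ^ 2 * (n * (2 * n + 1)) = n + 2 := by
    apply mul_left_cancel₀ hX₁
    linear_combination e₁
  have h21 : 2 * n + 1 ≠ 0 := by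
    intro h
    rw [h, mul_zero, mul_zero] at rel
    have : (3 : ℂ) = 0 := by linear_combination -2 * rel - h
    norm_num at this
  have h12 : n + 2 ≠ 0 := by
    intro h
    rw [h] at rel
    simp [hX₁, hn0, h21] at rel
  have hd : q.s = dual n * r := by
    rw [dual]
    field_simp
    have h3 : n * r ≠ 0 := hp
    apply mul_left_cancel₀ (mul_ne_zero h3 (pow_ne_zero 2 hX₁))
    linear_combination (n + 2) * h2 + rel
  have key : (n * r) ^ 4 * (2 * n + 1) = n ^ 3 * (n + 2) := by linear_combination n ^ 3 * rel
  refine ⟨r, n, hr', hZ₁, hr, hZ₂, ⟨hX₁, hn0, ?_, ?_, h21, h12, ?_, rel, hn⟩, hd⟩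
  · intro h
    apply hp4
    apply mul_right_cancel₀ h21
    rw [key]
    linear_combination (n + 1) ^ 3 * h
  · intro h
    apply hp4
    apply mul_right_cancel₀ h21
    rw [key]
    linear_combination (n - 1) * (n + 1) ^ 2 * h
  -- The fixed points of `dual` are the roots of n² + 4n + 1, where s₁ = s₂ would follow.
  · intro h
    apply hne
    rw [hd, dual]
    field_simp
    linear_combination r * h

/-! ### Behaviour of the constants under n ↦ `dual n` -/

section

variable {p q : Param} {r n : ℂ}

theorem IsFlexParam.dual (h : IsFlexParam p r n) (hq : q.s = dual n * r) :
    IsFlexParam q r (dual n) := by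
  have h1 := h.n_ne
  have h2 := h.sub_ne
  have h3 := h.add_ne
  have h4 := h.two_ne
  have h5 := h.add_two_ne
  have h6 := h.quad_ne
  have hr := h.rel
  have e1 : PoonenPairs.dual n - 1 = -3 * (n + 1) / (n + 2) := by
    rw [PoonenPairs.dual]; field_simp; ring
  have e2 : PoonenPairs.dual n + 1 = -(n - 1) / (n + 2) := by
    rw [PoonenPairs.dual]; field_simp; ring
  have e3 : 2 * PoonenPairs.dual n + 1 = -3 * n / (n + 2) := by
    rw [PoonenPairs.dual]; field_simp; ring
  have e4 : PoonenPairs.dual n + 2 = 3 / (n + 2) := by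
    rw [PoonenPairs.dual]; field_simp; ring
  have e5 : PoonenPairs.dual n ^ 2 + 4 * PoonenPairs.dual n + 1
      = -3 * (n ^ 2 + 4 * n + 1) / (n + 2) ^ 2 := by
    rw [PoonenPairs.dual]; field_simp; ring
  refine ⟨h.r_ne, ?_, ?_, ?_, ?_, ?_, ?_, ?_, hq⟩
  · exact div_ne_zero (neg_ne_zero.mpr h4) h5
  · rw [e1]; exact div_ne_zero (mul_ne_zero (by norm_num) h3) h5
  · rw [e2]; exact div_ne_zero (neg_ne_zero.mpr h2) h5
  · rw [e3]; exact div_ne_zero (mul_ne_zero (by norm_num) h1) h5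
  · rw [e4]; exact div_ne_zero (by norm_num) h5
  · rw [e5]; exact div_ne_zero (mul_ne_zero (by norm_num) h6) (pow_ne_zero 2 h5)
  · rw [e3, e4, PoonenPairs.dual]
    field_simp
    linear_combination hr

theorem dual_dual (h5 : n + 2 ≠ 0) : dual (dual n) = n := by
  have e4 : dual n + 2 = 3 / (n + 2) := by
    rw [dual]; field_simp; ring
  rw [dual, e4, dual]
  field_simp
  ring

theorem flexU_dual (h : IsFlexParam p r n) : flexU (dual n) = (flexU n)⁻¹ := by
  have h1 := h.n_ne
  have h4 := h.two_ne
  have h5 := h.add_two_ne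
  have e3 : 2 * dual n + 1 = -3 * n / (n + 2) := by
    rw [dual]; field_simp; ring
  have e4 : dual n + 2 = 3 / (n + 2) := by
    rw [dual]; field_simp; ring
  rw [flexU, e3, e4, dual, flexU]
  field_simp

theorem flexK_dual (h : IsFlexParam p r n) :
    flexK (dual n) = -2 * (2 * n + 1) * (n + 2) * (n - 1) ^ 4 / (n ^ 2 + 4 * n + 1) ^ 3 := by
  have h5 := h.add_two_ne
  have h6 := h.quad_ne
  have e2 : dual n + 1 = -(n - 1) / (n + 2) := by
    rw [dual]; field_simp; ring
  have e5 : dual n ^ 2 + 4 * dual n + 1 = -3 * (n ^ 2 + 4 * n + 1) / (n + 2) ^ 2 := by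
    rw [dual]; field_simp; ring
  rw [flexK, e5, e2, dual]
  field_simp
  ring

theorem flexMu_dual (h : IsFlexParam p r n) : flexMu r (dual n) = flexU n * flexMu r n := by
  have h1 := h.n_ne
  have h5 := h.add_two_ne
  have h6 := h.quad_ne
  have e3 : 2 * dual n + 1 = -3 * n / (n + 2) := by
    rw [dual]; field_simp; ring
  have e5 : dual n ^ 2 + 4 * dual n + 1 = -3 * (n ^ 2 + 4 * n + 1) / (n + 2) ^ 2 := by
    rw [dual]; field_simp; ring
  rw [flexMu, e5, e3, dual, flexU, flexMu]
  field_simp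

theorem flexK_add_dual (h : IsFlexParam p r n) : flexK n + flexK (dual n) = -4 := by
  have h6 := h.quad_ne
  rw [flexK_dual h, flexK, ← add_div, div_eq_iff (pow_ne_zero 3 h6)]
  ring

theorem flexK_ne (h : IsFlexParam p r n) : flexK n ≠ 0 :=
  div_ne_zero (mul_ne_zero (mul_ne_zero (by norm_num) h.n_ne) (pow_ne_zero 4 h.add_ne))
    (pow_ne_zero 3 h.quad_ne)

theorem flexMu_ne (h : IsFlexParam p r n) : flexMu r n ≠ 0 :=
  div_ne_zero (mul_ne_zero (mul_ne_zero (mul_ne_zero (by norm_num) (pow_ne_zero 2 h.r_ne))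
    (pow_ne_zero 2 h.n_ne)) h.two_ne) (pow_ne_zero 2 h.quad_ne)

theorem flexU_ne (h : IsFlexParam p r n) : flexU n ≠ 0 :=
  div_ne_zero (mul_ne_zero (neg_ne_zero.mpr h.two_ne) h.add_two_ne)
    (mul_ne_zero (by norm_num) h.n_ne)

theorem c_eq (h : IsFlexParam p r n) :
    p.c = 1 / 2 + r ^ 2 * (n ^ 4 + 2 * n ^ 3 + 2 * n + 1) / (4 * n * (n + 2)) := by
  have h0 := h.r_ne
  have h1 := h.n_ne
  have h5 := h.add_two_ne
  have hr := h.rel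
  rw [Param.c, h.s_eq]
  field_simp
  linear_combination (-1 : ℂ) * hr * 2

theorem c_mul_c_sub_one (h : IsFlexParam p r n) :
    p.c * (p.c - 1) = (n - 1) ^ 2 * (n + 1) ^ 6 / (16 * n ^ 3 * (n + 2) * (2 * n + 1)) := by
  have h0 := h.r_ne
  have h1 := h.n_ne
  have h4 := h.two_ne
  have h5 := h.add_two_ne
  have hr : (r ^ 2) ^ 2 = (n + 2) / (n * (2 * n + 1)) := by
    rw [eq_div_iff (mul_ne_zero h1 h4), h.rel]
  have hc : p.c * (p.c - 1)
      = (r ^ 2) ^ 2 * (n ^ 4 + 2 * n ^ 3 + 2 * n + 1) ^ 2 / (4 * n * (n + 2)) ^ 2 - 1 / 4 := by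
    rw [c_eq h]
    field_simp
    ring
  rw [hc, hr, div_mul_eq_mul_div, div_div, div_sub_div _ _ (by simp [*]) (by norm_num),
    div_eq_div_iff (by simp [*]) (by simp [*])]
  ring

theorem c_sub_c (h : IsFlexParam p r n) (hq : q.s = dual n * r) :
    q.c - p.c = -(r ^ 2 * (n ^ 2 + 4 * n + 1) * (n - 1) ^ 2 * (n + 1) ^ 2)
      / (2 * n * (2 * n + 1) * (n + 2) ^ 2) := by
  have h1 := h.n_ne
  have h4 := h.two_ne
  have h5 := h.add_two_ne
  have e4 : dual n + 2 = 3 / (n + 2) := by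
    rw [dual]; field_simp; ring
  rw [c_eq h, c_eq (h.dual hq), e4, dual]
  field_simp
  ring

end

/-! ### Identification of E'_s with a flex curve -/

section Flex

variable {p q : Param} {r n : ℂ}

theorem c_mul (h : IsFlexParam p r n) : p.c * (4 * r ^ 2 * n ^ 2) = (r ^ 2 * n ^ 2 + 1) ^ 2 := by
  have h0 := h.r_ne
  have h1 := h.n_ne
  rw [Param.c, h.s_eq]
  field_simp

theorem flexMu_mul_c (h : IsFlexParam p r n) : flexMu r n * p.c
    = -9 * (2 * n + 1) * (r ^ 2 * n ^ 2 + 1) ^ 2 / (n ^ 2 + 4 * n + 1) ^ 2 := by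
  rw [← c_mul h, flexMu]
  ring

theorem flex_rel₂ (h : IsFlexParam p r n) :
    3 * flexNu r n + 9 = flexMu r n * -(1 + p.c) := by
  have h6 := pow_ne_zero 2 h.quad_ne
  have hr := h.rel
  have hc := flexMu_mul_c h
  rw [mul_neg, mul_add, hc, flexNu, flexMu]
  generalize r ^ 2 = R at *
  rw [← mul_div_assoc, mul_one, ← add_div, ← neg_div, div_add' _ _ _ h6, div_left_inj' h6]
  linear_combination (-9 * n ^ 3) * hr

theorem flex_rel₄ (h : IsFlexParam p r n) :
    3 * flexNu r n ^ 2 + 2 * 9 * flexNu r n + -6 * flexK n = flexMu r n ^ 2 * p.c := by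
  have h6 := h.quad_ne
  have hr := h.rel
  have hc := flexMu_mul_c h
  rw [sq (flexMu r n), mul_assoc (flexMu r n), hc, flexNu, flexMu, flexK]
  generalize r ^ 2 = R at *
  clear hc
  generalize hQ : n ^ 2 + 4 * n + 1 = Q at h6 ⊢
  field_simp
  clear h h6
  grind

theorem flex_rel₆ (h : IsFlexParam p r n) :
    flexNu r n ^ 3 + 9 * flexNu r n ^ 2 + -6 * flexK n * flexNu r n + flexK n ^ 2
      = flexMu r n ^ 3 * 0 := by
  have h6 := h.quad_ne
  have hr := h.rel
  rw [flexNu, flexK]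
  generalize r ^ 2 = R at *
  generalize hQ : n ^ 2 + 4 * n + 1 = Q at h6 ⊢
  field_simp
  clear h h6
  grind

/-- The isomorphism of the Weierstrass curve of `E'_s` with `flexCurve k`. -/
def flexAffine (h : IsFlexParam p r n) {ω : ℂ} (hω : ω ^ 2 = flexMu r n ^ 3) :
    (weierstrass p).Point →+ (flexCurve (flexK n)).Point :=
  affineHom (W := weierstrass p) (W' := flexCurve (flexK n)) rfl rfl rfl rfl (flexMu_ne h) hω
    (flex_rel₂ h) (flex_rel₄ h) (flex_rel₆ h)

theorem rep_flexAffine (h : IsFlexParam p r n) {ω : ℂ} (hω : ω ^ 2 = flexMu r n ^ 3)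
    {T : (weierstrass p).Point} {X Y Z : ℂ} (hT : Rep T X Y Z) :
    Rep (flexAffine h hω T) (flexMu r n * X + flexNu r n * Z) (ω * Y) Z :=
  Rep.affineHom (W := weierstrass p) (W' := flexCurve (flexK n)) (h₁ := rfl) (h₃ := rfl)
    (h₁' := rfl) (h₃' := rfl) (hμ := flexMu_ne h) (hω := hω) (e₂ := flex_rel₂ h)
    (e₄ := flex_rel₄ h) (e₆ := flex_rel₆ h) hT

/-- The isomorphism of `E'_s` with `flexCurve k`. -/
def flexHom (h : IsFlexParam p r n) {ω : ℂ} (hω : ω ^ 2 = flexMu r n ^ 3) :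
    E' p →+ (flexCurve (flexK n)).Point :=
  (flexAffine h hω).comp (shift p).toAddMonoidHom

theorem flexHom_injective (h : IsFlexParam p r n) {ω : ℂ} (hω : ω ^ 2 = flexMu r n ^ 3) :
    Function.Injective (flexHom h hω) := by
  have : Function.Injective (flexAffine h hω) :=
    affineHom_injective (W := weierstrass p) (W' := flexCurve (flexK n)) rfl rfl rfl rfl
      (flexMu_ne h) hω (flex_rel₂ h) (flex_rel₄ h) (flex_rel₆ h)
  exact this.comp (shift p).injective

theorem rep_flexHom (h : IsFlexParam p r n) {ω : ℂ} (hω : ω ^ 2 = flexMu r n ^ 3) {Q : E' p}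
    {ρ X Y Z : ℂ} (hρ : ρ ≠ 0) (hX : Q.X = ρ * X) (hY : Q.Y = ρ ^ 2 * Y) (hZ : Q.Z = ρ * Z) :
    Rep (flexHom h hω Q) (flexMu r n * (p.c * (X - Z)) + flexNu r n * (X - p.c * Z))
      (ω * (p.c * (1 - p.c) * Y)) (X - p.c * Z) :=
  rep_flexAffine h hω (rep_shift_of_eq p hρ hX hY hZ)

theorem flex_lin₁ (h : IsFlexParam p r n) : flexMu r n * (p.s ^ 2 + 1) + 2 * flexNu r n
    = 2 * (flexK n * (n ^ 2 + 4 * n + 1) / (3 * (n + 1))) := by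
  have h6 := h.quad_ne
  have h3 := h.add_ne
  have hr := h.rel
  rw [h.s_eq, flexMu, flexNu, flexK, mul_pow]
  generalize r ^ 2 = R at *
  generalize hQ : n ^ 2 + 4 * n + 1 = Q at h6 ⊢
  field_simp
  clear h h6 h3
  grind

theorem flex_lin₂ (h : IsFlexParam p r n) : flexMu r n * (p.s ^ 2 + 1) + 2 * flexNu r n * p.s ^ 2
    = 2 * (p.s * r * (flexK n * (n ^ 2 + 4 * n + 1) / (3 * (n + 1)))) := by
  have h6 := h.quad_ne
  have h3 := h.add_ne
  rw [h.s_eq, flexMu, flexNu, flexK]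
  generalize hQ : n ^ 2 + 4 * n + 1 = Q at h6 ⊢
  field_simp
  clear h h6 h3
  grind

/-- On E_s the function f is a Möbius function of x, with its zero at x = r (the point of order
three) and its pole at x = s (the origin). -/
theorem rep_flexHom_lam (h : IsFlexParam p r n) {ω : ℂ} (hω : ω ^ 2 = flexMu r n ^ 3) (P : E p) :
    ∃ Y, Rep (flexHom h hω (lam p P)) (flexK n * ((n ^ 2 + 4 * n + 1) * (P.X - r * P.Z))) Y
      (3 * (n + 1) * (P.X - p.s * P.Z)) := by
  have h1 : Rep (flexHom h hω (lam p P)) _ _ _ := rep_flexAffine h hω (rep_lam p P)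
  have hs := p.s_ne
  have hs' := p.sq_add_ne
  have h3 := h.add_ne
  have l₁ := flex_lin₁ h
  have l₂ := flex_lin₂ h
  have hd : (p.s ^ 2 + 1) * (2 * p.s) ≠ 0 := mul_ne_zero hs' (mul_ne_zero two_ne_zero hs)
  have h2 := h1.smul (r := 3 * (n + 1) / ((p.s ^ 2 + 1) * (2 * p.s)))
    (div_ne_zero (mul_ne_zero (by norm_num) h3) hd)
  have eX : 3 * (n + 1) / ((p.s ^ 2 + 1) * (2 * p.s)) *
      (flexMu r n * ((p.s ^ 2 + 1) ^ 2 * (p.s * P.X - P.Z)) +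
        flexNu r n * ((p.s ^ 2 + 1) * (2 * p.s * (P.X - p.s * P.Z))))
      = flexK n * ((n ^ 2 + 4 * n + 1) * (P.X - r * P.Z)) := by
    have e : flexK n * ((n ^ 2 + 4 * n + 1) * (P.X - r * P.Z))
        = 3 * (n + 1) * (flexK n * (n ^ 2 + 4 * n + 1) / (3 * (n + 1)) * (P.X - r * P.Z)) := by
      field_simp
    rw [e, div_mul_eq_mul_div, div_eq_iff hd]
    generalize flexK n * (n ^ 2 + 4 * n + 1) / (3 * (n + 1)) = K at *
    linear_combination (3 * (n + 1) * (p.s ^ 2 + 1)) * (p.s * P.X * l₁ - P.Z * l₂)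
  have eZ : 3 * (n + 1) / ((p.s ^ 2 + 1) * (2 * p.s)) *
      ((p.s ^ 2 + 1) * (2 * p.s * (P.X - p.s * P.Z))) = 3 * (n + 1) * (P.X - p.s * P.Z) := by
    field_simp
  rw [eX, eZ] at h2
  exact ⟨_, h2⟩

/-- Let A : B be the value of κ, so that z = A/B. With `flexMu_mul_c_add` this turns the
X-coordinate of φ₁ on the flex curve into (c₂ - c₁)k/4 · (A² - uB²), where u = `flexU n`. -/
theorem flexMu_mul_c_mul (h : IsFlexParam p r n) (hq : q.s = dual n * r) :
    flexMu r n * (p.c * (p.c - 1)) = flexK n * flexU n * (q.c - p.c) / 4 := by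
  have h1 := h.n_ne
  have h4 := h.two_ne
  have h5 := h.add_two_ne
  have h6 := h.quad_ne
  rw [c_mul_c_sub_one h, c_sub_c h hq, flexMu, flexK, flexU]
  generalize n ^ 2 + 4 * n + 1 = Q at *
  field_simp
  ring

theorem flexMu_mul_c_add (h : IsFlexParam p r n) :
    flexMu r n * p.c + flexNu r n = flexK n * (1 - flexU n) / 4 := by
  have h1 := h.n_ne
  have h6 := h.quad_ne
  have hr := h.rel
  rw [flexMu_mul_c h, flexK, flexU, flexNu]
  generalize r ^ 2 = R at *
  generalize hQ : n ^ 2 + 4 * n + 1 = Q at h6 ⊢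
  field_simp
  clear h h6
  grind

/-- Obtained by comparing `flexMu_mul_c_mul` for n and for `dual n`; it links the two extreme
coefficients of the sextic form on the fiber product. -/
theorem flexK_mul_c (h : IsFlexParam p r n) (hq : q.s = dual n * r) :
    flexK n * flexU n ^ 3 * (q.c * (q.c - 1)) = -(flexK (dual n) * (p.c * (p.c - 1))) := by
  have e₁ := flexMu_mul_c_mul h hq
  have e₂ := flexMu_mul_c_mul (h.dual hq) (q := p)
    (by rw [dual_dual h.add_two_ne, h.s_eq])
  rw [flexMu_dual h, flexU_dual h] at e₂
  have hu := flexU_ne h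
  have e₂' : flexU n ^ 2 * flexMu r n * (q.c * (q.c - 1)) = flexK (dual n) * (p.c - q.c) / 4 := by
    rw [← mul_right_inj' (inv_ne_zero hu)]
    have : (flexU n)⁻¹ * (flexU n ^ 2 * flexMu r n * (q.c * (q.c - 1)))
      = flexU n * flexMu r n * (q.c * (q.c - 1)) := by field_simp
    rw [this, e₂]
    ring
  apply mul_left_cancel₀ (flexMu_ne h)
  linear_combination flexK n * flexU n * e₂' + flexK (dual n) * e₁

theorem Y_sq (h : IsFlexParam p r n) {S : E p} (hX : S.X = r) (hZ : S.Z = 1) :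
    S.Y ^ 2 = -((n - 1) * (n + 1)) ^ 2 / (n ^ 2 * (2 * n + 1)) := by
  have h0 := h.r_ne
  have h1 := h.n_ne
  have h4 := h.two_ne
  have hr := h.rel
  have hY : (n * r) ^ 2 * S.Y ^ 2 = (r ^ 2 - (n * r) ^ 2) * ((n * r) ^ 2 * r ^ 2 - 1) := by
    rw [S.eqn]
    simp only [formE, h.s_eq, hX, hZ]
    field_simp
  rw [eq_div_iff (mul_ne_zero (pow_ne_zero 2 h1) h4)]
  apply mul_left_cancel₀ (pow_ne_zero 2 h0)
  linear_combination (2 * n + 1) * hY + r ^ 2 * (1 - n ^ 2) * n * hr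

end Flex

/-! ### The covering maps -/

section Covering

variable {p q : Param} {t : ℂ}

theorem C.exists_point (t X Z : ℂ) (h : X ≠ 0 ∨ Z ≠ 0) :
    ∃ (Q : C t) (ρ Y : ℂ), ρ ≠ 0 ∧ Q.X = ρ * X ∧ Q.Y = ρ ^ 3 * Y ∧ Q.Z = ρ * Z := by
  obtain ⟨y, hy⟩ := IsAlgClosed.exists_pow_nat_eq ((formC t).eval X Z) (n := 2) (by norm_num)
  obtain ⟨ρ, h1, h2, h3, h4⟩ := Cover.ofCoords_spec X y Z hy h
  exact ⟨_, ρ, y, h1, h2, h3, h4⟩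

theorem proj₁_spec (hs : p.c ≠ q.c) (P : Cover (formFib p q)) :
    ∃ σ : ℂ, σ ≠ 0 ∧ (proj₁ hs P).X = σ * (q.c * P.X ^ 2 - p.c * P.Z ^ 2) ∧
      (proj₁ hs P).Y = σ ^ 2 * (P.X * P.Y) ∧ (proj₁ hs P).Z = σ * (P.X ^ 2 - P.Z ^ 2) :=
  Cover.ofCoords_spec _ _ _ _ _

theorem proj₂_spec (hs : p.c ≠ q.c) (P : Cover (formFib p q)) :
    ∃ σ : ℂ, σ ≠ 0 ∧ (proj₂ hs P).X = σ * (q.c * P.X ^ 2 - p.c * P.Z ^ 2) ∧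
      (proj₂ hs P).Y = σ ^ 2 * (P.Z * P.Y) ∧ (proj₂ hs P).Z = σ * (P.X ^ 2 - P.Z ^ 2) :=
  Cover.ofCoords_spec _ _ _ _ _

theorem phi₁_spec (hs : p.c ≠ q.c) (κ : CoverIso (formC t) (formFib p q)) {Q : C t} {ρ X Y Z : ℂ}
    (hρ : ρ ≠ 0) (hX : Q.X = ρ * X) (hY : Q.Y = ρ ^ 3 * Y) (hZ : Q.Z = ρ * Z) :
    ∃ σ ≠ 0,
      (phi₁ hs κ Q).X = σ * (q.c * (κ.a * X + κ.b * Z) ^ 2 - p.c * (κ.c * X + κ.d * Z) ^ 2) ∧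
      (phi₁ hs κ Q).Y = σ ^ 2 * ((κ.a * X + κ.b * Z) * (κ.e * Y)) ∧
      (phi₁ hs κ Q).Z = σ * ((κ.a * X + κ.b * Z) ^ 2 - (κ.c * X + κ.d * Z) ^ 2) := by
  obtain ⟨r, hr, hX', hY', hZ'⟩ := κ.map_spec Q
  obtain ⟨r', hr', h1, h2, h3⟩ := proj₁_spec hs (κ.map Q)
  refine ⟨r' * (r * ρ) ^ 2, mul_ne_zero hr' (pow_ne_zero 2 (mul_ne_zero hr hρ)), h1.trans ?_,
    h2.trans ?_, h3.trans ?_⟩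
  all_goals
    simp only [hX', hY', hZ', hX, hY, hZ]
    ring

theorem phi₂_spec (hs : p.c ≠ q.c) (κ : CoverIso (formC t) (formFib p q)) {Q : C t} {ρ X Y Z : ℂ}
    (hρ : ρ ≠ 0) (hX : Q.X = ρ * X) (hY : Q.Y = ρ ^ 3 * Y) (hZ : Q.Z = ρ * Z) :
    ∃ σ ≠ 0,
      (phi₂ hs κ Q).X = σ * (q.c * (κ.a * X + κ.b * Z) ^ 2 - p.c * (κ.c * X + κ.d * Z) ^ 2) ∧
      (phi₂ hs κ Q).Y = σ ^ 2 * ((κ.c * X + κ.d * Z) * (κ.e * Y)) ∧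
      (phi₂ hs κ Q).Z = σ * ((κ.a * X + κ.b * Z) ^ 2 - (κ.c * X + κ.d * Z) ^ 2) := by
  obtain ⟨r, hr, hX', hY', hZ'⟩ := κ.map_spec Q
  obtain ⟨r', hr', h1, h2, h3⟩ := proj₂_spec hs (κ.map Q)
  refine ⟨r' * (r * ρ) ^ 2, mul_ne_zero hr' (pow_ne_zero 2 (mul_ne_zero hr hρ)), h1.trans ?_,
    h2.trans ?_, h3.trans ?_⟩
  all_goals
    simp only [hX', hY', hZ', hX, hY, hZ]
    ring

theorem tau_spec (ht : t ≠ 0) {Q : C t} {ρ X Y Z : ℂ}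
    (hρ : ρ ≠ 0) (hX : Q.X = ρ * X) (hY : Q.Y = ρ ^ 3 * Y) (hZ : Q.Z = ρ * Z) :
    ∃ σ ≠ 0, ((tau ht).map Q).X = σ * (t ^ 4 * Z) ∧ ((tau ht).map Q).Y = σ ^ 3 * (t ^ 6 * Y) ∧
      ((tau ht).map Q).Z = σ * X := by
  obtain ⟨r, hr, hX', hY', hZ'⟩ := (tau ht).map_spec Q
  refine ⟨r * ρ, mul_ne_zero hr hρ, hX'.trans ?_, hY'.trans ?_, hZ'.trans ?_⟩
  all_goals
    simp only [tau, hX, hY, hZ]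
    ring

theorem iota_spec {Q : C t} {ρ X Y Z : ℂ}
    (hρ : ρ ≠ 0) (hX : Q.X = ρ * X) (hY : Q.Y = ρ ^ 3 * Y) (hZ : Q.Z = ρ * Z) :
    ∃ σ ≠ 0, ((iota t).map Q).X = σ * X ∧ ((iota t).map Q).Y = σ ^ 3 * -Y ∧
      ((iota t).map Q).Z = σ * Z := by
  obtain ⟨r, hr, hX', hY', hZ'⟩ := (iota t).map_spec Q
  refine ⟨r * ρ, mul_ne_zero hr hρ, hX'.trans ?_, hY'.trans ?_, hZ'.trans ?_⟩
  all_goals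
    simp only [iota, hX, hY, hZ]
    ring

theorem sigma_spec {ζ : ℂ} (hζ : IsPrimitiveRoot ζ 3) {Q : C t} {ρ X Y Z : ℂ}
    (hρ : ρ ≠ 0) (hX : Q.X = ρ * X) (hY : Q.Y = ρ ^ 3 * Y) (hZ : Q.Z = ρ * Z) :
    ∃ σ ≠ 0, ((sigma t hζ).map Q).X = σ * (ζ * X) ∧ ((sigma t hζ).map Q).Y = σ ^ 3 * Y ∧
      ((sigma t hζ).map Q).Z = σ * Z := by
  obtain ⟨r, hr, hX', hY', hZ'⟩ := (sigma t hζ).map_spec Q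
  refine ⟨r * ρ, mul_ne_zero hr hρ, hX'.trans ?_, hY'.trans ?_, hZ'.trans ?_⟩
  all_goals
    simp only [sigma, hX, hY, hZ]
    ring

theorem psi_spec {s : Param} {S : E s} {r : ℂ} (hX : S.X = r) (hZ : S.Z = 1) :
    ∃ σ ≠ 0, (psi s S).X = σ * (r ^ 2 + 1) ^ 2 ∧
      (psi s S).Y = σ ^ 2 * (2 * r * (r ^ 4 - 1) * S.Y) ∧ (psi s S).Z = σ * (4 * r ^ 2) := by
  have hspec : ∃ σ : ℂ, σ ≠ 0 ∧ (psi s S).X = σ * (S.X ^ 2 + S.Z ^ 2) ^ 2 ∧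
      (psi s S).Y = σ ^ 2 * (2 * S.X * S.Z * (S.X ^ 4 - S.Z ^ 4) * S.Y) ∧
      (psi s S).Z = σ * (4 * S.X ^ 2 * S.Z ^ 2) := Cover.ofCoords_spec _ _ _ _ _
  obtain ⟨σ, hσ, h1, h2, h3⟩ := hspec
  refine ⟨σ, hσ, h1.trans ?_, h2.trans ?_, h3.trans ?_⟩
  all_goals
    simp only [hX, hZ]
    ring

/-- Equal points have proportional coordinates. -/
theorem Cover.proportional_of_eq {F : BinForm 2} {P Q : Cover F} {σ σ' X Y Z X' Y' Z' : ℂ}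
    (h : P = Q) (hσ : σ ≠ 0) (hσ' : σ' ≠ 0) (hX : P.X = σ * X) (hY : P.Y = σ ^ 2 * Y)
    (hZ : P.Z = σ * Z) (hX' : Q.X = σ' * X') (hY' : Q.Y = σ' ^ 2 * Y') (hZ' : Q.Z = σ' * Z') :
    ∃ s ≠ 0, X = s * X' ∧ Y = s ^ 2 * Y' ∧ Z = s * Z' := by
  subst h
  refine ⟨σ' / σ, div_ne_zero hσ' hσ, ?_, ?_, ?_⟩
  · rw [div_mul_eq_mul_div, eq_div_iff hσ]; linear_combination hX' - hX
  · rw [div_pow, div_mul_eq_mul_div, eq_div_iff (pow_ne_zero 2 hσ)]; linear_combination hY' - hY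
  · rw [div_mul_eq_mul_div, eq_div_iff hσ]; linear_combination hZ' - hZ

/-- The x-coordinate of φ₁ is a Möbius function of z², so z² is invariant under x ↦ t⁴/x. Evaluation
at two points gives the coefficients up to one sign, which the y-coordinate of φ₁ decides. -/
theorem coeffs_of_tau (hs : p.c ≠ q.c) (ht : t ≠ 0) (κ : CoverIso (formC t) (formFib p q))
    (h : ∀ Q : C t, phi₁ hs κ ((tau ht).map Q) = phi₁ hs κ Q) :
    κ.b = κ.a * t ^ 2 ∧ κ.d = -(κ.c * t ^ 2) := by
  have hd := κ.det_ne
  have he := κ.e_ne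
  have hcc : q.c - p.c ≠ 0 := sub_ne_zero.mpr hs.symm
  have key : ∀ (Q : C t) (ρ X Y Z : ℂ), ρ ≠ 0 → Q.X = ρ * X → Q.Y = ρ ^ 3 * Y → Q.Z = ρ * Z →
      ∃ s ≠ 0, (κ.a * (t ^ 4 * Z) + κ.b * X) ^ 2 = s * (κ.a * X + κ.b * Z) ^ 2 ∧
        (κ.c * (t ^ 4 * Z) + κ.d * X) ^ 2 = s * (κ.c * X + κ.d * Z) ^ 2 ∧
        (κ.a * (t ^ 4 * Z) + κ.b * X) * (κ.e * (t ^ 6 * Y))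
          = s ^ 2 * ((κ.a * X + κ.b * Z) * (κ.e * Y)) := by
    intro Q ρ X Y Z hρ hX hY hZ
    obtain ⟨σ, hσ, tX, tY, tZ⟩ := tau_spec ht hρ hX hY hZ
    obtain ⟨σ₁, hσ₁, h1, h2, h3⟩ := phi₁_spec hs κ hσ tX tY tZ
    obtain ⟨σ₂, hσ₂, h1', h2', h3'⟩ := phi₁_spec hs κ hρ hX hY hZ
    obtain ⟨s, hs0, e1, e2, e3⟩ :=
      Cover.proportional_of_eq (h Q) hσ₁ hσ₂ h1 h2 h3 h1' h2' h3'
    refine ⟨s, hs0, ?_, ?_, e2⟩ <;> apply mul_left_cancel₀ hcc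
    · linear_combination e1 - p.c * e3
    · linear_combination e1 - q.c * e3
  obtain ⟨s, hs0, e1, e2, e3⟩ := key (zeroPlus t) 1 0 (t ^ 6) 1 one_ne_zero
    (by simp [zeroPlus]) (by simp [zeroPlus]) (by simp [zeroPlus])
  -- A second test point: x = 2t² is neither 0 nor one of the fixed points ±t² of x ↦ t⁴/x.
  obtain ⟨Q, ρ, Y, hρ, hX, hY, hZ⟩ := C.exists_point t (2 * t ^ 2) 1 (Or.inr one_ne_zero)
  obtain ⟨s', hs0', e1', e2', -⟩ := key Q ρ _ Y 1 hρ hX hY hZ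
  have ht8 : t ^ 8 ≠ 0 := pow_ne_zero _ ht
  have ha : κ.a ≠ 0 := by
    intro h
    have : κ.b ^ 2 = 0 := by
      apply mul_left_cancel₀ hs0
      rw [h] at e1
      linear_combination -e1
    rw [pow_eq_zero_iff two_ne_zero] at this
    exact hd (by rw [h, this]; ring)
  have hc : κ.c ≠ 0 := by
    intro h
    have : κ.d ^ 2 = 0 := by
      apply mul_left_cancel₀ hs0
      rw [h] at e2
      linear_combination -e2
    rw [pow_eq_zero_iff two_ne_zero] at this
    exact hd (by rw [h, this]; ring)
  have h1 : κ.a * κ.d + κ.b * κ.c = 0 := by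
    have : t ^ 8 * ((κ.a * κ.d - κ.b * κ.c) * (κ.a * κ.d + κ.b * κ.c)) = 0 := by
      linear_combination κ.d ^ 2 * e1 - κ.b ^ 2 * e2
    exact (mul_eq_zero.mp ((mul_eq_zero.mp this).resolve_left ht8)).resolve_left hd
  have h2 : κ.b * κ.d + κ.a * κ.c * t ^ 4 = 0 := by
    have : (12 * t ^ 6 * (κ.a * κ.d - κ.b * κ.c)) * (κ.b * κ.d + κ.a * κ.c * t ^ 4) = 0 := by
      linear_combination -((κ.c * (2 * t ^ 2) + κ.d) ^ 2 * e1')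
        + (κ.a * (2 * t ^ 2) + κ.b) ^ 2 * e2'
        + 15 * t ^ 8 * (κ.b * κ.c - κ.a * κ.d) * h1
    exact (mul_eq_zero.mp this).resolve_left
      (mul_ne_zero (mul_ne_zero (by norm_num) (pow_ne_zero _ ht)) hd)
  have h3 : κ.b ^ 2 = κ.a ^ 2 * t ^ 4 := by
    apply mul_left_cancel₀ hc
    linear_combination κ.b * h1 - κ.a * h2
  have h4 : s = t ^ 4 := by
    apply mul_right_cancel₀ (mul_ne_zero (pow_ne_zero 2 ha) (pow_ne_zero 4 ht))
    linear_combination -e1 - s * h3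
  have h5 : κ.b = κ.a * t ^ 2 := by
    rw [h4] at e3
    apply mul_left_cancel₀ (mul_ne_zero he (pow_ne_zero 14 ht))
    linear_combination -e3
  refine ⟨h5, ?_⟩
  apply mul_left_cancel₀ ha
  linear_combination h1 - κ.c * h5

end Covering

/-! ### Normal form of a model -/

section Model

variable {p q : Param} {r n t : ℂ}

theorem Y_sq_eq (h : IsFlexParam p r n) (hq : q.s = dual n * r) {S₁ : E p} {S₂ : E q}
    (hX₁ : S₁.X = r) (hZ₁ : S₁.Z = 1) (hX₂ : S₂.X = r) (hZ₂ : S₂.Z = 1) :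
    S₁.Y ^ 2 = flexU n * S₂.Y ^ 2 ∧ S₂.Y ≠ 0 := by
  have h' := h.dual hq
  have h1 := h.n_ne
  have h4 := h.two_ne
  have h5 := h.add_two_ne
  have e1 : dual n - 1 = -3 * (n + 1) / (n + 2) := by
    rw [dual]; field_simp; ring
  have e2 : dual n + 1 = -(n - 1) / (n + 2) := by
    rw [dual]; field_simp; ring
  have e3 : 2 * dual n + 1 = -3 * n / (n + 2) := by
    rw [dual]; field_simp; ring
  constructor
  · rw [Y_sq h hX₁ hZ₁, Y_sq h' hX₂ hZ₂, e1, e2, e3, dual, flexU]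
    field_simp
  · intro h0
    have := Y_sq h' hX₂ hZ₂
    rw [h0, eq_div_iff (mul_ne_zero (pow_ne_zero 2 h'.n_ne) h'.two_ne)] at this
    exact pow_ne_zero 2 (mul_ne_zero h'.sub_ne h'.add_ne) (by linear_combination this)

/-- The points ψ(S₁), ψ(S₂) have the same x-coordinate, so z at 0⁺ is the quotient of their
y-coordinates, whose square is u = `flexU n`. -/
theorem coeffs_of_isModel (hs : p.c ≠ q.c) (ht : t ≠ 0) {κ : CoverIso (formC t) (formFib p q)}
    {S₁ : E p} {S₂ : E q} (h : IsFlexParam p r n) (hq : q.s = dual n * r)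
    (hX₁ : S₁.X = r) (hZ₁ : S₁.Z = 1) (hX₂ : S₂.X = r) (hZ₂ : S₂.Z = 1)
    (hκ : IsModel hs S₁ S₂ ht κ) :
    κ.b = κ.a * t ^ 2 ∧ κ.d = -(κ.c * t ^ 2) ∧ κ.a ^ 2 = flexU n * κ.c ^ 2 := by
  obtain ⟨h1, -, h3, h4⟩ := hκ
  obtain ⟨hb, hd⟩ := coeffs_of_tau hs ht κ h1
  refine ⟨hb, hd, ?_⟩
  have he := κ.e_ne
  have hr := h.r_ne
  obtain ⟨hY, hY0⟩ := Y_sq_eq h hq hX₁ hZ₁ hX₂ hZ₂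
  obtain ⟨σ₁, hσ₁, a1, a2, a3⟩ := psi_spec hX₁ hZ₁
  obtain ⟨σ₂, hσ₂, b1, b2, b3⟩ := psi_spec hX₂ hZ₂
  obtain ⟨σ₃, hσ₃, c1, c2, c3⟩ := phi₁_spec hs κ (Q := zeroPlus t) (X := 0) (Y := t ^ 6) (Z := 1)
    one_ne_zero (by simp [zeroPlus]) (by simp [zeroPlus]) (by simp [zeroPlus])
  obtain ⟨σ₄, hσ₄, d1, d2, d3⟩ := phi₂_spec hs κ (Q := zeroPlus t) (X := 0) (Y := t ^ 6) (Z := 1)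
    one_ne_zero (by simp [zeroPlus]) (by simp [zeroPlus]) (by simp [zeroPlus])
  obtain ⟨s, hs0, x1, y1, z1⟩ := Cover.proportional_of_eq h3 hσ₃ hσ₁ c1 c2 c3 a1 a2 a3
  obtain ⟨s', hs0', x2, y2, z2⟩ := Cover.proportional_of_eq h4 hσ₄ hσ₂ d1 d2 d3 b1 b2 b3
  obtain rfl : s = s' := by
    apply mul_right_cancel₀ (mul_ne_zero (by norm_num : (4 : ℂ) ≠ 0) (pow_ne_zero 2 hr))
    rw [← z1, ← z2]
  rw [hb] at y1
  rw [hd] at y2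
  have e : κ.a * S₂.Y = -(κ.c * S₁.Y) := by
    apply mul_left_cancel₀ (mul_ne_zero he (pow_ne_zero 8 ht))
    linear_combination S₂.Y * y1 - S₁.Y * y2
  apply mul_right_cancel₀ (pow_ne_zero 2 hY0)
  linear_combination (κ.a * S₂.Y - κ.c * S₁.Y) * e + κ.c ^ 2 * hY

/-- At x = -t² and x = t² one of the two linear forms of κ vanishes, so that a single monomial of
the form on the fiber product survives. The two resulting equations determine t⁶ + t⁻⁶ and e². -/
theorem e_sq_of_coeffs (ht : t ≠ 0) {κ : CoverIso (formC t) (formFib p q)}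
    (h : IsFlexParam p r n) (hq : q.s = dual n * r)
    (hb : κ.b = κ.a * t ^ 2) (hd : κ.d = -(κ.c * t ^ 2)) (ha : κ.a ^ 2 = flexU n * κ.c ^ 2) :
    flexK n * t ^ 6 = -(t ^ 6 + 1) ^ 2 ∧
    κ.e ^ 2 * flexK n = 64 * κ.c ^ 6 * (q.c - p.c) * (p.c * (p.c - 1)) := by
  have he := κ.e_ne
  have h1 := κ.eqn (-t ^ 2) 1
  have h2 := κ.eqn (t ^ 2) 1
  simp only [formFib, formC, hb, hd] at h1 h2
  have h1' : 64 * κ.c ^ 6 * (q.c - p.c) * (p.c * (p.c - 1)) * t ^ 6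
      = -κ.e ^ 2 * (t ^ 6 + 1) ^ 2 := by
    apply mul_left_cancel₀ (pow_ne_zero 6 ht)
    linear_combination -h1
  have h2' : 64 * κ.c ^ 6 * (q.c - p.c) * (flexU n ^ 3 * (q.c * (q.c - 1))) * t ^ 6
      = -κ.e ^ 2 * (t ^ 6 - 1) ^ 2 := by
    have : (κ.a ^ 2) ^ 3 = (flexU n * κ.c ^ 2) ^ 3 := by rw [ha]
    apply mul_left_cancel₀ (pow_ne_zero 6 ht)
    linear_combination h2 - 64 * (q.c - p.c) * (q.c * (q.c - 1)) * t ^ 12 * this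
  have h3 := flexK_mul_c h hq
  have h4 := flexK_add_dual h
  have hk : flexK n * t ^ 6 = -(t ^ 6 + 1) ^ 2 := by
    have : κ.e ^ 2 * (flexK n * (t ^ 6 - 1) ^ 2 + flexK (dual n) * (t ^ 6 + 1) ^ 2) = 0 := by
      linear_combination -64 * κ.c ^ 6 * (q.c - p.c) * t ^ 6 * h3 + flexK n * h2'
        + flexK (dual n) * h1'
    have := (mul_eq_zero.mp this).resolve_left (pow_ne_zero 2 he)
    linear_combination -this / 4 + (t ^ 6 + 1) ^ 2 / 4 * h4
  refine ⟨hk, ?_⟩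
  apply mul_right_cancel₀ (pow_ne_zero 6 ht)
  linear_combination -h1' + κ.e ^ 2 * hk

/-- Coordinates on the curves `E'_{s₁}` and `E'_{s₂}` in which everything becomes explicit. -/
structure FlexModel (hs : p.c ≠ q.c) (κ : CoverIso (formC t) (formFib p q)) where
  k : ℂ
  l : ℂ
  k_ne : k ≠ 0
  l_ne : l ≠ 0
  add_eq : k + l = -4
  rel : k * t ^ 6 = -(t ^ 6 + 1) ^ 2
  ν₁ : E' p →+ (flexCurve k).Point
  ν₂ : E' q →+ (flexCurve l).Point
  injective₁ : Function.Injective ν₁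
  injective₂ : Function.Injective ν₂
  rep₁ : ∀ {Q : C t} {ρ X Y Z : ℂ}, ρ ≠ 0 → Q.X = ρ * X → Q.Y = ρ ^ 3 * Y → Q.Z = ρ * Z →
    Rep (ν₁ (phi₁ hs κ Q)) (k * (X * (t ^ 2 * Z))) (k * (Y * (X + t ^ 2 * Z)))
      ((X + t ^ 2 * Z) ^ 2)
  rep₂ : ∀ {Q : C t} {ρ X Y Z : ℂ}, ρ ≠ 0 → Q.X = ρ * X → Q.Y = ρ ^ 3 * Y → Q.Z = ρ * Z →
    Rep (ν₂ (phi₂ hs κ Q)) (l * (-X * (t ^ 2 * Z))) (l * (Y * (-X + t ^ 2 * Z)))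
      ((-X + t ^ 2 * Z) ^ 2)
  u : ℂ × ℂ
  v : ℂ × ℂ
  det_ne : u.1 * v.2 - u.2 * v.1 ≠ 0
  rep_lam₁ : ∀ P : E p, ∃ Y, Rep (ν₁ (lam p P)) (k * (u.1 * P.X + u.2 * P.Z)) Y
    (v.1 * P.X + v.2 * P.Z)
  rep_lam₂ : ∀ P : E q, ∃ Y, Rep (ν₂ (lam q P)) (l * (u.1 * P.X + u.2 * P.Z)) Y
    ((u.1 * P.X + u.2 * P.Z) - (v.1 * P.X + v.2 * P.Z))

theorem nonempty_flexModel (hs : p.c ≠ q.c) (ht : t ≠ 0) {κ : CoverIso (formC t) (formFib p q)}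
    (h : IsFlexParam p r n) (hq : q.s = dual n * r)
    (hb : κ.b = κ.a * t ^ 2) (hd : κ.d = -(κ.c * t ^ 2)) (ha : κ.a ^ 2 = flexU n * κ.c ^ 2) :
    Nonempty (FlexModel hs κ) := by
  obtain ⟨hk, he⟩ := e_sq_of_coeffs ht h hq hb hd ha
  have h' := h.dual hq
  have hp : p.s = dual (dual n) * r := by rw [dual_dual h.add_two_ne, h.s_eq]
  have hu := flexU_ne h
  have hkn := flexK_ne h
  have hln := flexK_ne h'
  have he0 := κ.e_ne
  have hD : q.c - p.c ≠ 0 := sub_ne_zero.mpr hs.symm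
  have hc₁ : p.c * (1 - p.c) ≠ 0 := mul_ne_zero p.c_ne_zero (sub_ne_zero.mpr p.c_ne_one.symm)
  have hc₂ : q.c * (1 - q.c) ≠ 0 := mul_ne_zero q.c_ne_zero (sub_ne_zero.mpr q.c_ne_one.symm)
  have hc : κ.c ≠ 0 := by
    intro h0
    apply κ.det_ne
    rw [hd, h0]
    ring
  have ha0 : κ.a ≠ 0 := by
    intro h0
    apply κ.det_ne
    rw [hb, h0]
    ring
  have m₁ := flexMu_mul_c_mul h hq
  have a₁ := flexMu_mul_c_add h
  have m₂ := flexMu_mul_c_mul h' hp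
  have a₂ := flexMu_mul_c_add h'
  rw [flexU_dual h] at m₂ a₂
  -- Of the two square roots of μ³, the one under which the Y-coordinate of φ₁(Q) becomes k Y (X +
  -- T) exactly; likewise for φ₂ below.
  have hω₁ : (flexK n * (q.c - p.c) ^ 2 * κ.a ^ 3 / (p.c * (1 - p.c) * κ.e)) ^ 2
      = flexMu r n ^ 3 := by
    rw [div_pow, div_eq_iff (pow_ne_zero 2 (mul_ne_zero hc₁ he0))]
    have a6 : (κ.a ^ 2) ^ 3 = (flexU n * κ.c ^ 2) ^ 3 := by rw [ha]
    have m3 := congrArg (· ^ 3) m₁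
    apply mul_left_cancel₀ hkn
    linear_combination flexK n ^ 3 * (q.c - p.c) ^ 4 * a6 - 64 * κ.c ^ 6 * (q.c - p.c) * m3
      - flexMu r n ^ 3 * (p.c * (p.c - 1)) ^ 2 * he
  have hω₂ : (-flexK (dual n) * (q.c - p.c) ^ 2 * κ.c ^ 3 / (q.c * (1 - q.c) * κ.e)) ^ 2
      = flexMu r (dual n) ^ 3 := by
    rw [div_pow, div_eq_iff (pow_ne_zero 2 (mul_ne_zero hc₂ he0))]
    have e2 : κ.e ^ 2 * flexK (dual n)
        = -(64 * κ.c ^ 6 * (q.c - p.c) * flexU n ^ 3 * (q.c * (q.c - 1))) := by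
      apply mul_left_cancel₀ hkn
      linear_combination flexK (dual n) * he
        + 64 * κ.c ^ 6 * (q.c - p.c) * flexK_mul_c h hq
    have m2 : flexU n * (flexMu r (dual n) * (q.c * (q.c - 1)))
        = -(flexK (dual n) * (q.c - p.c)) / 4 := by
      rw [m₂]
      field_simp
      ring
    have m3 := congrArg (· ^ 3) m2
    apply mul_left_cancel₀ hln
    linear_combination 64 * κ.c ^ 6 * (q.c - p.c) * m3
      - flexMu r (dual n) ^ 3 * (q.c * (q.c - 1)) ^ 2 * e2
  -- The common coordinates are U = (n² + 4n + 1)(x - r) and V = 3(n + 1)(x - s₁). Then U - V = (n -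
  -- 1)(n + 2)(x - s₂), so the same U serves both curves.
  refine ⟨⟨flexK n, flexK (dual n), hkn, hln, flexK_add_dual h, hk, flexHom h hω₁,
    flexHom h' hω₂, flexHom_injective h hω₁, flexHom_injective h' hω₂, ?_, ?_,
    ((n ^ 2 + 4 * n + 1), -((n ^ 2 + 4 * n + 1) * r)), (3 * (n + 1), -(3 * (n + 1) * (n * r))),
    ?_, ?_, ?_⟩⟩
  · intro Q ρ X Y Z hρ hX hY hZ
    obtain ⟨σ, hσ, e1, e2, e3⟩ := phi₁_spec hs κ hρ hX hY hZ
    have := (rep_flexHom h hω₁ hσ e1 e2 e3).smul (r := ((q.c - p.c) * κ.a ^ 2)⁻¹)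
      (inv_ne_zero (mul_ne_zero hD (pow_ne_zero 2 ha0)))
    rw [hb, hd] at this
    have hp0 := p.c_ne_zero
    have hp1 := sub_ne_zero.mpr p.c_ne_one.symm
    convert this using 1
    · rw [eq_inv_mul_iff_mul_eq₀ (mul_ne_zero hD (pow_ne_zero 2 ha0))]
      linear_combination -(q.c - p.c) * (κ.a * X + κ.a * t ^ 2 * Z) ^ 2 * a₁
        - ((κ.a * X + κ.a * t ^ 2 * Z) ^ 2 - (κ.c * X + -(κ.c * t ^ 2) * Z) ^ 2) * m₁
        - (q.c - p.c) * flexK n / 4 * (X - t ^ 2 * Z) ^ 2 * ha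
    · field_simp
    · rw [eq_inv_mul_iff_mul_eq₀ (mul_ne_zero hD (pow_ne_zero 2 ha0))]
      ring
  · intro Q ρ X Y Z hρ hX hY hZ
    obtain ⟨σ, hσ, e1, e2, e3⟩ := phi₂_spec hs κ hρ hX hY hZ
    have := (rep_flexHom h' hω₂ hσ e1 e2 e3).smul (r := ((q.c - p.c) * κ.c ^ 2)⁻¹)
      (inv_ne_zero (mul_ne_zero hD (pow_ne_zero 2 hc)))
    rw [hb, hd] at this
    have hp0 := q.c_ne_zero
    have hp1 := sub_ne_zero.mpr q.c_ne_one.symm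
    convert this using 1
    · rw [eq_inv_mul_iff_mul_eq₀ (mul_ne_zero hD (pow_ne_zero 2 hc))]
      have hu' : (flexU n)⁻¹ * κ.a ^ 2 = κ.c ^ 2 := by rw [ha]; field_simp
      linear_combination -(q.c - p.c) * (κ.c * X + -(κ.c * t ^ 2) * Z) ^ 2 * a₂
        - ((κ.a * X + κ.a * t ^ 2 * Z) ^ 2 - (κ.c * X + -(κ.c * t ^ 2) * Z) ^ 2) * m₂
        + (q.c - p.c) * flexK (dual n) / 4 * (X + t ^ 2 * Z) ^ 2 * hu'
    · field_simp
      ring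
    · rw [eq_inv_mul_iff_mul_eq₀ (mul_ne_zero hD (pow_ne_zero 2 hc))]
      ring
  · have : (n ^ 2 + 4 * n + 1) * -(3 * (n + 1) * (n * r))
        - -((n ^ 2 + 4 * n + 1) * r) * (3 * (n + 1))
        = (n ^ 2 + 4 * n + 1) * r * (3 * (n + 1)) * -(n - 1) := by ring
    simp only
    rw [this]
    exact mul_ne_zero (mul_ne_zero (mul_ne_zero h.quad_ne h.r_ne)
      (mul_ne_zero (by norm_num) h.add_ne)) (neg_ne_zero.mpr h.sub_ne)
  · intro P
    obtain ⟨Y, hY⟩ := rep_flexHom_lam h hω₁ P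
    refine ⟨Y, ?_⟩
    convert hY using 1
    · ring
    · rw [h.s_eq]; ring
  · intro P
    obtain ⟨Y, hY⟩ := rep_flexHom_lam h' hω₂ P
    have h5 := h.add_two_ne
    have e2 : dual n + 1 = -(n - 1) / (n + 2) := by
      rw [dual]; field_simp; ring
    have e5 : dual n ^ 2 + 4 * dual n + 1 = -3 * (n ^ 2 + 4 * n + 1) / (n + 2) ^ 2 := by
      rw [dual]; field_simp; ring
    have := hY.smul (r := -(n + 2) ^ 2 / 3)
      (div_ne_zero (neg_ne_zero.mpr (pow_ne_zero 2 h5)) (by norm_num))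
    rw [e2, e5, hq] at this
    have eX : -(n + 2) ^ 2 / 3 * (flexK (dual n) * (-3 * (n ^ 2 + 4 * n + 1) / (n + 2) ^ 2
        * (P.X - r * P.Z))) = flexK (dual n) * ((n ^ 2 + 4 * n + 1) * P.X
        + -((n ^ 2 + 4 * n + 1) * r) * P.Z) := by
      field_simp
      ring
    have eZ : -(n + 2) ^ 2 / 3 * (3 * (-(n - 1) / (n + 2)) * (P.X - dual n * r * P.Z))
        = (n ^ 2 + 4 * n + 1) * P.X + -((n ^ 2 + 4 * n + 1) * r) * P.Z
        - (3 * (n + 1) * P.X + -(3 * (n + 1) * (n * r)) * P.Z) := by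
      rw [dual]
      field_simp
      ring
    rw [eX, eZ] at this
    exact ⟨_, this⟩

end Model

/-! ### Existence of a model -/

section Existence

variable {p q : Param} {r n t : ℂ}

theorem r_pow_eq (h : IsFlexParam p r n) : (r ^ 2) ^ 2 = (n + 2) / (n * (2 * n + 1)) := by
  rw [eq_div_iff (mul_ne_zero h.n_ne h.two_ne), h.rel]

/-- At z² = u the function x = (c₂z² - c₁)/(z² - 1) takes the value (r² + 1)²/(4r²) = x(ψ(S_j)). -/
theorem c_psi_rel (h : IsFlexParam p r n) (hq : q.s = dual n * r) :
    (q.c * flexU n - p.c) * (4 * r ^ 2) = (flexU n - 1) * (r ^ 2 + 1) ^ 2 := by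
  have h1 := h.n_ne
  have h4 := h.two_ne
  have h5 := h.add_two_ne
  have hR := r_pow_eq h
  have hc : p.c * (4 * r ^ 2) = (r ^ 2) ^ 2 * n ^ 2 + 2 * r ^ 2 + 1 / n ^ 2 := by
    have := c_mul h
    field_simp
    linear_combination this
  have hE := c_sub_c h hq
  have key : (flexU n - 1) * ((r ^ 2) ^ 2 * n ^ 2 + 1 / n ^ 2 - (r ^ 2) ^ 2 - 1)
      - 4 * flexU n * ((r ^ 2) ^ 2 * ((n ^ 2 + 4 * n + 1) * (n - 1) ^ 2 * (n + 1) ^ 2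
      / (2 * n * (2 * n + 1) * (n + 2) ^ 2))) = 0 := by
    rw [hR, flexU]
    clear hR hc hE h
    field_simp
    ring
  linear_combination key + (flexU n - 1) * hc + 4 * r ^ 2 * flexU n * hE

/-- Comparison of the coefficients of P M² in the two sextic forms, where P = (X + T)² and M = (X -
T)². The instance for `dual n` handles P²M. -/
theorem gamma_rel (h : IsFlexParam p r n) (hq : q.s = dual n * r) :
    flexK n * (flexU n * (3 * (p.c * (p.c - 1)) + (2 * p.c - 1) * (q.c - p.c)))
      = (36 + 3 * flexK n) * (p.c * (p.c - 1)) := by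
  have h1 := h.n_ne
  have h4 := h.two_ne
  have h5 := h.add_two_ne
  have h6 := h.quad_ne
  have hR := r_pow_eq h
  have h2 : (2 * p.c - 1) * (q.c - p.c) = (r ^ 2) ^ 2 * ((n ^ 4 + 2 * n ^ 3 + 2 * n + 1)
      / (2 * n * (n + 2)) * (-((n ^ 2 + 4 * n + 1) * (n - 1) ^ 2 * (n + 1) ^ 2)
      / (2 * n * (2 * n + 1) * (n + 2) ^ 2))) := by
    rw [c_sub_c h hq, c_eq h]
    field_simp
    ring
  rw [h2, hR, c_mul_c_sub_one h, flexU, flexK]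
  clear h2 hR h
  rw [mul_comm (36 + _)]
  have e : 36 + 3 * (-54 * n * (n + 1) ^ 4 / (n ^ 2 + 4 * n + 1) ^ 3)
      = (36 * (n ^ 2 + 4 * n + 1) ^ 3 - 162 * n * (n + 1) ^ 4) / (n ^ 2 + 4 * n + 1) ^ 3 := by
    have hQ := pow_ne_zero 3 h6
    rw [eq_div_iff hQ, add_mul, mul_assoc 3, div_mul_cancel₀ _ hQ]
    ring
  rw [e]
  generalize hQ : n ^ 2 + 4 * n + 1 = Q at *
  field_simp
  rw [← hQ]
  ring

theorem exists_isModel (hs : p.c ≠ q.c) {S₁ : E p} {S₂ : E q} (h : IsFlexParam p r n)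
    (hq : q.s = dual n * r) (hX₁ : S₁.X = r) (hZ₁ : S₁.Z = 1) (hX₂ : S₂.X = r) (hZ₂ : S₂.Z = 1) :
    ∃ (t : ℂ) (ht : t ≠ 0) (κ : CoverIso (formC t) (formFib p q)),
      t ^ 12 ≠ 1 ∧ IsModel hs S₁ S₂ ht κ := by
  have h' := h.dual hq
  have hp : p.s = dual (dual n) * r := by rw [dual_dual h.add_two_ne, h.s_eq]
  have hr := h.r_ne
  have hu := flexU_ne h
  have hkn := flexK_ne h
  have hln := flexK_ne h'
  have hkl := flexK_add_dual h
  -- T = t⁶ is forced by k t⁶ = -(t⁶ + 1)². The values T = -1 and T = 1 would mean k = 0 and l = 0.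
  obtain ⟨T, hT⟩ : ∃ T : ℂ, T ^ 2 + (2 + flexK n) * T + 1 = 0 := by
    obtain ⟨w, hw⟩ := IsAlgClosed.exists_pow_nat_eq ((2 + flexK n) ^ 2 - 4) (n := 2) (by norm_num)
    exact ⟨(w - (2 + flexK n)) / 2, by linear_combination hw / 4⟩
  have hT0 : T ≠ 0 := by
    rintro rfl
    norm_num at hT
  obtain ⟨t, rfl⟩ := IsAlgClosed.exists_pow_nat_eq T (n := 6) (by norm_num)
  have ht : t ≠ 0 := by
    rintro rfl
    norm_num at hT0
  have ht12 : t ^ 12 ≠ 1 := by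
    intro h0
    have : (t ^ 6 - 1) * (t ^ 6 + 1) = 0 := by linear_combination h0
    rcases mul_eq_zero.mp this with h1 | h1
    · exact hln (by linear_combination hkl - hT + (t ^ 6 + 3 + flexK n) * h1)
    · exact hkn (by linear_combination -hT + (t ^ 6 + 1 + flexK n) * h1)
  obtain ⟨hY, hY0⟩ := Y_sq_eq h hq hX₁ hZ₁ hX₂ hZ₂
  have hz : (S₁.Y / S₂.Y) ^ 2 = flexU n := by
    rw [div_pow, hY]
    field_simp
  have hz0 : S₁.Y / S₂.Y ≠ 0 := by
    intro h0
    rw [h0] at hz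
    exact hu (by rw [← hz]; ring)
  have hD : q.c - p.c ≠ 0 := sub_ne_zero.mpr hs.symm
  have hC : p.c * (p.c - 1) ≠ 0 := mul_ne_zero p.c_ne_zero (sub_ne_zero.mpr p.c_ne_one)
  obtain ⟨z, hz'⟩ : ∃ z, z = S₁.Y / S₂.Y := ⟨_, rfl⟩
  rw [← hz'] at hz hz0
  -- The value of e required by φ₂(0⁺) = ψ(S₂).
  obtain ⟨e, he⟩ : ∃ e, e = (flexU n - 1) ^ 2 * (r ^ 4 - 1) * r * S₂.Y / (8 * r ^ 4) := ⟨_, rfl⟩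
  have he2 : e ^ 2 * flexK n = 64 * (q.c - p.c) * (p.c * (p.c - 1)) := by
    have h1 := h.n_ne
    have h4 := h.two_ne
    have h5 := h.add_two_ne
    have h6 := h.quad_ne
    have hR := r_pow_eq h
    have e1 : dual n - 1 = -3 * (n + 1) / (n + 2) := by
      rw [dual]; field_simp; ring
    have e2 : dual n + 1 = -(n - 1) / (n + 2) := by
      rw [dual]; field_simp; ring
    have e3 : 2 * dual n + 1 = -3 * n / (n + 2) := by
      rw [dual]; field_simp; ring
    have e4 : flexU n - 1 = -2 * (n ^ 2 + 4 * n + 1) / (3 * n) := by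
      rw [flexU]; field_simp; ring
    have e5 : (n + 2) / (n * (2 * n + 1)) - 1 = -2 * (n - 1) * (n + 1) / (n * (2 * n + 1)) := by
      rw [div_sub_one (mul_ne_zero h1 h4)]
      ring
    have he' : e ^ 2 = r ^ 2 * ((flexU n - 1) ^ 4 * ((r ^ 2) ^ 2 - 1) ^ 2 * S₂.Y ^ 2
        / (64 * ((r ^ 2) ^ 2) ^ 2)) := by
      rw [he]; field_simp; ring
    rw [he', Y_sq h' hX₂ hZ₂, hR, e1, e2, e3, e4, e5, dual, c_sub_c h hq, c_mul_c_sub_one h, flexK]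
    clear he' he e1 e2 e3 e4 e5 hR
    generalize n ^ 2 + 4 * n + 1 = Q at *
    field_simp
    ring
  have he0 : e ≠ 0 := by
    rintro h0
    rw [h0] at he2
    exact mul_ne_zero (mul_ne_zero (by norm_num : (64 : ℂ) ≠ 0) hD) hC (by rw [← he2]; ring)
  have hγ := gamma_rel h hq
  have hβ := gamma_rel h' hp
  have hC₂ := flexK_mul_c h hq
  have eqn : ∀ X Z, (formFib p q).eval (z * X + z * t ^ 2 * Z) (-1 * X + t ^ 2 * Z)
      = e ^ 2 * (formC t).eval X Z := by
    intro X Z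
    have hA : (z * X + z * t ^ 2 * Z) ^ 2 = flexU n * (X + t ^ 2 * Z) ^ 2 := by
      rw [← hz]; ring
    -- The form of C_t as a cubic in the squares of X + T and X - T. After division by the factor of
    -- `he2`, the form on the fiber product has the same four coefficients.
    have hpoly : (4 + flexK n) * ((X + t ^ 2 * Z) ^ 2) ^ 3
        + (24 - 3 * flexK n) * ((X + t ^ 2 * Z) ^ 2) ^ 2 * (-1 * X + t ^ 2 * Z) ^ 2
        + (36 + 3 * flexK n) * (X + t ^ 2 * Z) ^ 2 * ((-1 * X + t ^ 2 * Z) ^ 2) ^ 2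
        - flexK n * ((-1 * X + t ^ 2 * Z) ^ 2) ^ 3
        = 64 * ((X ^ 3 - Z ^ 3) * (X ^ 3 - t ^ 12 * Z ^ 3)) := by
      linear_combination 64 * X ^ 3 * Z ^ 3 * hT
    have hl : flexK (dual n) = -4 - flexK n := by linear_combination hkl
    have hβ' : flexK n * (flexU n ^ 2 * (3 * (q.c * (q.c - 1)) + (2 * q.c - 1) * (p.c - q.c)))
        = -((36 + 3 * flexK (dual n)) * (p.c * (p.c - 1))) := by
      rw [flexU_dual h] at hβ
      have : flexK (dual n) * (3 * (q.c * (q.c - 1)) + (2 * q.c - 1) * (p.c - q.c))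
          = (36 + 3 * flexK (dual n)) * (q.c * (q.c - 1)) * flexU n := by
        rw [← hβ]; field_simp
      apply mul_left_cancel₀ hln
      linear_combination flexK n * flexU n ^ 2 * this + (36 + 3 * flexK (dual n)) * hC₂
    rw [hl] at hβ' hC₂
    simp only [formFib, formC]
    rw [hA]
    generalize (X + t ^ 2 * Z) ^ 2 = P at *
    generalize (-1 * X + t ^ 2 * Z) ^ 2 = M at *
    apply mul_left_cancel₀ hkn
    linear_combination (q.c - p.c) * (P ^ 3 * hC₂ - P ^ 2 * M * hβ' + P * M ^ 2 * hγ)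
      - (X ^ 3 - Z ^ 3) * (X ^ 3 - t ^ 12 * Z ^ 3) * he2
      + (q.c - p.c) * (p.c * (p.c - 1)) * hpoly
  let κ : CoverIso (formC t) (formFib p q) :=
    { a := z, b := z * t ^ 2, c := -1, d := t ^ 2, e := e, det_ne := by
        have : z * t ^ 2 - z * t ^ 2 * -1 = 2 * z * t ^ 2 := by ring
        rw [this]
        exact mul_ne_zero (mul_ne_zero two_ne_zero hz0) (pow_ne_zero 2 ht)
      e_ne := he0, eqn := eqn }
  have key : ∃ s ≠ 0, (q.c * flexU n - p.c) * t ^ 4 = s * (r ^ 2 + 1) ^ 2 ∧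
      (flexU n - 1) * t ^ 4 = s * (4 * r ^ 2) ∧
      t ^ 8 * e = s ^ 2 * (2 * r * (r ^ 4 - 1) * S₂.Y) := by
    have h1 := h.n_ne
    have e4 : flexU n - 1 = -2 * (n ^ 2 + 4 * n + 1) / (3 * n) := by
      rw [flexU]; field_simp; ring
    have hu1 : flexU n - 1 ≠ 0 := by
      rw [e4]
      exact div_ne_zero (mul_ne_zero (by norm_num) h.quad_ne) (mul_ne_zero (by norm_num) h1)
    have h4r : 4 * r ^ 2 ≠ 0 := mul_ne_zero (by norm_num) (pow_ne_zero 2 hr)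
    refine ⟨(flexU n - 1) * t ^ 4 / (4 * r ^ 2), div_ne_zero (mul_ne_zero hu1 (pow_ne_zero 4 ht))
      h4r, ?_, by rw [div_mul_cancel₀ _ h4r], ?_⟩
    · rw [div_mul_eq_mul_div, eq_div_iff h4r]
      linear_combination t ^ 4 * c_psi_rel h hq
    · rw [he]
      field_simp
      ring
  obtain ⟨s, hs0, k1, k2, k3⟩ := key
  have hy : z * S₂.Y = S₁.Y := by rw [hz']; field_simp
  refine ⟨t, ht, κ, ht12, ?_, ?_, ?_, ?_⟩
  · intro Q
    obtain ⟨σ, hσ, tX, tY, tZ⟩ := tau_spec ht (Q := Q) (X := Q.X) (Y := Q.Y) (Z := Q.Z)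
      one_ne_zero (by ring) (by ring) (by ring)
    obtain ⟨σ₁, hσ₁, e1, e2, e3⟩ := phi₁_spec hs κ hσ tX tY tZ
    obtain ⟨σ₂, hσ₂, d1, d2, d3⟩ := phi₁_spec hs κ (Q := Q) (X := Q.X) (Y := Q.Y) (Z := Q.Z)
      one_ne_zero (by ring) (by ring) (by ring)
    refine Cover.eq_of_proportional (σ₁ * t ^ 4 / σ₂)
      (div_ne_zero (mul_ne_zero hσ₁ (pow_ne_zero 4 ht)) hσ₂) ?_ ?_ ?_
    · rw [e1, d1]; simp only [κ]; field_simp; ring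
    · rw [e2, d2]; simp only [κ]; field_simp; ring
    · rw [e3, d3]; simp only [κ]; field_simp; ring
  · intro Q
    obtain ⟨σ', hσ', iX, iY, iZ⟩ := iota_spec (Q := Q) (X := Q.X) (Y := Q.Y) (Z := Q.Z)
      one_ne_zero (by ring) (by ring) (by ring)
    obtain ⟨σ, hσ, tX, tY, tZ⟩ := tau_spec ht hσ' iX iY iZ
    obtain ⟨σ₁, hσ₁, e1, e2, e3⟩ := phi₂_spec hs κ hσ tX tY tZ
    obtain ⟨σ₂, hσ₂, d1, d2, d3⟩ := phi₂_spec hs κ (Q := Q) (X := Q.X) (Y := Q.Y) (Z := Q.Z)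
      one_ne_zero (by ring) (by ring) (by ring)
    refine Cover.eq_of_proportional (σ₁ * t ^ 4 / σ₂)
      (div_ne_zero (mul_ne_zero hσ₁ (pow_ne_zero 4 ht)) hσ₂) ?_ ?_ ?_
    · rw [e1, d1]; simp only [κ]; field_simp; ring
    · rw [e2, d2]; simp only [κ]; field_simp; ring
    · rw [e3, d3]; simp only [κ]; field_simp; ring
  · obtain ⟨σ₁, hσ₁, a1, a2, a3⟩ := psi_spec hX₁ hZ₁
    obtain ⟨σ₂, hσ₂, d1, d2, d3⟩ := phi₁_spec hs κ (Q := zeroPlus t) (X := 0) (Y := t ^ 6) (Z := 1)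
      one_ne_zero (by simp [zeroPlus]) (by simp [zeroPlus]) (by simp [zeroPlus])
    refine Cover.eq_of_proportional (σ₂ * s / σ₁) (div_ne_zero (mul_ne_zero hσ₂ hs0) hσ₁) ?_ ?_ ?_
    · rw [d1, a1]; simp only [κ]; field_simp
      linear_combination k1 + q.c * t ^ 4 * hz
    · rw [d2, a2, ← hy]; simp only [κ]; field_simp
      linear_combination k3
    · rw [d3, a3]; simp only [κ]; field_simp
      linear_combination k2 + t ^ 4 * hz
  · obtain ⟨σ₁, hσ₁, a1, a2, a3⟩ := psi_spec hX₂ hZ₂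
    obtain ⟨σ₂, hσ₂, d1, d2, d3⟩ := phi₂_spec hs κ (Q := zeroPlus t) (X := 0) (Y := t ^ 6) (Z := 1)
      one_ne_zero (by simp [zeroPlus]) (by simp [zeroPlus]) (by simp [zeroPlus])
    refine Cover.eq_of_proportional (σ₂ * s / σ₁) (div_ne_zero (mul_ne_zero hσ₂ hs0) hσ₁) ?_ ?_ ?_
    · rw [d1, a1]; simp only [κ]; field_simp
      linear_combination k1 + q.c * t ^ 4 * hz
    · rw [d2, a2]; simp only [κ]; field_simp
      linear_combination k3
    · rw [d3, a3]; simp only [κ]; field_simp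
      linear_combination k2 + t ^ 4 * hz

end Existence

/-! ### Pull-back and push-forward of divisors -/

section Divisors

variable {A B : Type}

/-- The multiplicity two at fixed points of the involution makes the formula uniform. -/
theorem pullPoint_eq {f : A → B} {α : A → A} {P : B} {Q : A} (hα : α (α Q) = Q)
    (hf : f ⁻¹' {P} = {Q, α Q}) :
    pullPoint f α P = Finsupp.single Q 1 + Finsupp.single (α Q) 1 := by
  rw [pullPoint, hf]
  by_cases h : Q = α Q
  · rw [← h, Set.pair_eq_singleton, finsum_mem_singleton, if_pos h.symm, ← Finsupp.single_add]
    norm_num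
  · rw [finsum_mem_pair h, if_neg (Ne.symm h), hα, if_neg h]

theorem pushForward_sub [AddCommGroup B] (f : A → B) (δ δ' : A →₀ ℤ) :
    pushForward f (δ - δ') = pushForward f δ - pushForward f δ' :=
  Finsupp.sum_sub_index fun _ _ _ => sub_smul _ _ _

theorem pushForward_pair [AddCommGroup B] (f : A → B) (Q Q' : A) :
    pushForward f (Finsupp.single Q 1 + Finsupp.single Q' 1) = f Q + f Q' := by
  have h1 : ∀ R, pushForward f (Finsupp.single R 1) = f R := fun R =>
    (Finsupp.sum_single_index (h := fun Q n => n • f Q) (zero_smul _ _)).trans (one_smul _ _)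
  rw [← h1 Q, ← h1 Q']
  exact Finsupp.sum_add_index' (h := fun Q n => n • f Q) (fun _ => zero_smul _ _)
    fun _ _ _ => add_smul _ _ _

end Divisors

section Fibers

variable {p q : Param} {t : ℂ}

theorem C.coords (Q : C t) : (1 : ℂ) ≠ 0 ∧ Q.X = 1 * Q.X ∧ Q.Y = 1 ^ 3 * Q.Y ∧ Q.Z = 1 * Q.Z :=
  ⟨one_ne_zero, by ring, by ring, by ring⟩

theorem C.eq_of_coords {Q Q' : C t} {ρ ρ' X Y Z r : ℂ} (hρ : ρ ≠ 0) (hρ' : ρ' ≠ 0) (hr : r ≠ 0)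
    (hX : Q.X = ρ * X) (hY : Q.Y = ρ ^ 3 * Y) (hZ : Q.Z = ρ * Z)
    (hX' : Q'.X = ρ' * (r * X)) (hY' : Q'.Y = ρ' ^ 3 * (r ^ 3 * Y)) (hZ' : Q'.Z = ρ' * (r * Z)) :
    Q' = Q := by
  refine Cover.eq_of_proportional (ρ' * r / ρ) (div_ne_zero (mul_ne_zero hρ' hr) hρ) ?_ ?_ ?_
  · rw [hX, hX']; field_simp
  · rw [hY, hY']; field_simp
  · rw [hZ, hZ']; field_simp

theorem tau_tau (ht : t ≠ 0) (Q : C t) : (tau ht).map ((tau ht).map Q) = Q := by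
  obtain ⟨h0, hX, hY, hZ⟩ := C.coords Q
  obtain ⟨σ, hσ, tX, tY, tZ⟩ := tau_spec ht h0 hX hY hZ
  obtain ⟨σ', hσ', sX, sY, sZ⟩ := tau_spec ht hσ tX tY tZ
  refine C.eq_of_coords (r := t ^ 4) h0 hσ' (pow_ne_zero 4 ht) hX hY hZ sX ?_ sZ
  rw [sY]; ring

theorem tau_iota (ht : t ≠ 0) (Q : C t) :
    (tau ht).map ((iota t).map Q) = (iota t).map ((tau ht).map Q) := by
  obtain ⟨h0, hX, hY, hZ⟩ := C.coords Q
  obtain ⟨σ, hσ, tX, tY, tZ⟩ := tau_spec ht h0 hX hY hZ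
  obtain ⟨σ', hσ', sX, sY, sZ⟩ := iota_spec hσ tX tY tZ
  obtain ⟨ρ, hρ, iX, iY, iZ⟩ := iota_spec h0 hX hY hZ
  obtain ⟨ρ', hρ', jX, jY, jZ⟩ := tau_spec ht hρ iX iY iZ
  refine C.eq_of_coords (r := 1) hσ' hρ' one_ne_zero sX sY sZ ?_ ?_ ?_
  · rw [jX]; ring
  · rw [jY]; ring
  · rw [jZ]; ring

theorem iota_iota (Q : C t) : (iota t).map ((iota t).map Q) = Q := by
  obtain ⟨h0, hX, hY, hZ⟩ := C.coords Q
  obtain ⟨ρ, hρ, iX, iY, iZ⟩ := iota_spec h0 hX hY hZ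
  obtain ⟨ρ', hρ', jX, jY, jZ⟩ := iota_spec hρ iX iY iZ
  refine C.eq_of_coords (r := 1) h0 hρ' one_ne_zero hX hY hZ ?_ ?_ ?_
  · rw [jX]; ring
  · rw [jY]; ring
  · rw [jZ]; ring

theorem sigma_tau (ht : t ≠ 0) {ζ : ℂ} (hζ : IsPrimitiveRoot ζ 3) (Q : C t) :
    (sigma t hζ).map ((tau ht).map Q)
      = (tau ht).map ((sigma t hζ).map ((sigma t hζ).map Q)) := by
  obtain ⟨h0, hX, hY, hZ⟩ := C.coords Q
  obtain ⟨σ, hσ, tX, tY, tZ⟩ := tau_spec ht h0 hX hY hZ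
  obtain ⟨σ', hσ', sX, sY, sZ⟩ := sigma_spec hζ hσ tX tY tZ
  obtain ⟨ρ, hρ, iX, iY, iZ⟩ := sigma_spec hζ h0 hX hY hZ
  obtain ⟨ρ', hρ', jX, jY, jZ⟩ := sigma_spec hζ hρ iX iY iZ
  obtain ⟨ρ'', hρ'', kX, kY, kZ⟩ := tau_spec ht hρ' jX jY jZ
  have h3 := hζ.pow_eq_one
  refine (C.eq_of_coords (r := ζ) hρ'' hσ' (hζ.ne_zero (by norm_num)) kX kY kZ ?_ ?_ ?_)
  · rw [sX]
  · rw [sY, h3]; ring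
  · rw [sZ]; linear_combination -(σ' * Q.X) * h3

theorem sigma_iota {ζ : ℂ} (hζ : IsPrimitiveRoot ζ 3) (Q : C t) :
    (sigma t hζ).map ((iota t).map Q) = (iota t).map ((sigma t hζ).map Q) := by
  obtain ⟨h0, hX, hY, hZ⟩ := C.coords Q
  obtain ⟨σ, hσ, tX, tY, tZ⟩ := sigma_spec hζ h0 hX hY hZ
  obtain ⟨σ', hσ', sX, sY, sZ⟩ := iota_spec hσ tX tY tZ
  obtain ⟨ρ, hρ, iX, iY, iZ⟩ := iota_spec h0 hX hY hZ
  obtain ⟨ρ', hρ', jX, jY, jZ⟩ := sigma_spec hζ hρ iX iY iZ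
  refine C.eq_of_coords (r := 1) hσ' hρ' one_ne_zero sX sY sZ ?_ ?_ ?_
  · rw [jX]; ring
  · rw [jY]; ring
  · rw [jZ]; ring

theorem phi₁_iota (hs : p.c ≠ q.c) (κ : CoverIso (formC t) (formFib p q)) (Q : C t) :
    phi₁ hs κ ((iota t).map Q) = -phi₁ hs κ Q := by
  obtain ⟨h0, hX, hY, hZ⟩ := C.coords Q
  obtain ⟨ρ, hρ, iX, iY, iZ⟩ := iota_spec h0 hX hY hZ
  obtain ⟨σ, hσ, a1, a2, a3⟩ := phi₁_spec hs κ h0 hX hY hZ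
  obtain ⟨σ', hσ', b1, b2, b3⟩ := phi₁_spec hs κ hρ iX iY iZ
  rw [E'.neg_eq_flip]
  refine Cover.eq_of_proportional (σ' / σ) (div_ne_zero hσ' hσ) ?_ ?_ ?_
  · simp only [Cover.flip]; rw [a1, b1]; field_simp
  · simp only [Cover.flip]; rw [a2, b2]; field_simp
  · simp only [Cover.flip]; rw [a3, b3]; field_simp

theorem phi₂_iota (hs : p.c ≠ q.c) (κ : CoverIso (formC t) (formFib p q)) (Q : C t) :
    phi₂ hs κ ((iota t).map Q) = -phi₂ hs κ Q := by
  obtain ⟨h0, hX, hY, hZ⟩ := C.coords Q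
  obtain ⟨ρ, hρ, iX, iY, iZ⟩ := iota_spec h0 hX hY hZ
  obtain ⟨σ, hσ, a1, a2, a3⟩ := phi₂_spec hs κ h0 hX hY hZ
  obtain ⟨σ', hσ', b1, b2, b3⟩ := phi₂_spec hs κ hρ iX iY iZ
  rw [E'.neg_eq_flip]
  refine Cover.eq_of_proportional (σ' / σ) (div_ne_zero hσ' hσ) ?_ ?_ ?_
  · simp only [Cover.flip]; rw [a1, b1]; field_simp
  · simp only [Cover.flip]; rw [a2, b2]; field_simp
  · simp only [Cover.flip]; rw [a3, b3]; field_simp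

/-- Every point of the line is the common `x`-coordinate of `φ₁(Q)` and `φ₂(Q)` for some `Q`. -/
theorem exists_phi_cross (hs : p.c ≠ q.c) (κ : CoverIso (formC t) (formFib p q)) {A B : ℂ}
    (h : A ≠ 0 ∨ B ≠ 0) : ∃ Q : C t, (phi₁ hs κ Q).X * B = A * (phi₁ hs κ Q).Z ∧
      (phi₂ hs κ Q).X * B = A * (phi₂ hs κ Q).Z := by
  have hD : q.c - p.c ≠ 0 := sub_ne_zero.mpr hs.symm
  obtain ⟨X, hX⟩ := IsAlgClosed.exists_pow_nat_eq (A - p.c * B) (n := 2) (by norm_num)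
  obtain ⟨Z, hZ⟩ := IsAlgClosed.exists_pow_nat_eq (A - q.c * B) (n := 2) (by norm_num)
  have h0 : X ≠ 0 ∨ Z ≠ 0 := by
    by_contra! h0
    obtain ⟨rfl, rfl⟩ := h0
    have hB : B = 0 := by
      apply mul_left_cancel₀ hD
      linear_combination hZ - hX
    have hA : A = 0 := by linear_combination p.c * hB - hX
    rcases h with h | h
    · exact h hA
    · exact h hB
  obtain ⟨w, hw⟩ := IsAlgClosed.exists_pow_nat_eq ((formFib p q).eval X Z) (n := 2) (by norm_num)
  obtain ⟨r, hr, h1, h2, h3⟩ := Cover.ofCoords_spec X w Z hw h0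
  obtain ⟨σ₁, -, a1, -, a3⟩ := proj₁_spec hs (Cover.ofCoords _ X w Z hw h0)
  obtain ⟨σ₂, -, b1, -, b3⟩ := proj₂_spec hs (Cover.ofCoords _ X w Z hw h0)
  refine ⟨κ.symm.map (Cover.ofCoords _ X w Z hw h0), ?_, ?_⟩
  · rw [phi₁, κ.map_symm_map, a1, a3, h1, h3]
    linear_combination σ₁ * r ^ 2 * ((q.c * B - A) * hX + (A - p.c * B) * hZ)
  · rw [phi₂, κ.map_symm_map, b1, b3, h1, h3]
    linear_combination σ₂ * r ^ 2 * ((q.c * B - A) * hX + (A - p.c * B) * hZ)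

theorem phi₁_surjective (hs : p.c ≠ q.c) (κ : CoverIso (formC t) (formFib p q)) :
    Function.Surjective (phi₁ hs κ) := by
  intro P
  obtain ⟨Q, h, -⟩ := exists_phi_cross hs κ P.ne_zero
  rcases E'.eq_or_eq_neg p h with h | h
  · exact ⟨Q, h⟩
  · exact ⟨(iota t).map Q, by rw [phi₁_iota, h, neg_neg]⟩

theorem phi₂_surjective (hs : p.c ≠ q.c) (κ : CoverIso (formC t) (formFib p q)) :
    Function.Surjective (phi₂ hs κ) := by
  intro P
  obtain ⟨Q, -, h⟩ := exists_phi_cross hs κ P.ne_zero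
  rcases E'.eq_or_eq_neg q h with h | h
  · exact ⟨Q, h⟩
  · exact ⟨(iota t).map Q, by rw [phi₂_iota, h, neg_neg]⟩

/-- The sign ε is 1 for τ and -1 for τι. A square root σ of s is fixed by its action on X + εT; the
remaining sign on X - εT distinguishes Q from its image. -/
theorem eq_or_eq_of_fiber (ht : t ≠ 0) {ε s : ℂ} (hε : ε ^ 2 = 1) (hs0 : s ≠ 0) {Q Q' Q'' : C t}
    {ρ : ℂ} (hρ : ρ ≠ 0) (hX'' : Q''.X = ρ * (t ^ 4 * Q.Z)) (hY'' : Q''.Y = ρ ^ 3 * (ε * t ^ 6 * Q.Y))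
    (hZ'' : Q''.Z = ρ * Q.X)
    (h1 : (Q'.X + ε * (t ^ 2 * Q'.Z)) ^ 2 = s * (Q.X + ε * (t ^ 2 * Q.Z)) ^ 2)
    (h2 : (Q'.X - ε * (t ^ 2 * Q'.Z)) ^ 2 = s * (Q.X - ε * (t ^ 2 * Q.Z)) ^ 2)
    (h3 : (Q'.X + ε * (t ^ 2 * Q'.Z)) * Q'.Y = s ^ 2 * ((Q.X + ε * (t ^ 2 * Q.Z)) * Q.Y)) :
    Q' = Q ∨ Q' = Q'' := by
  have hε0 : ε ≠ 0 := by
    rintro rfl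
    norm_num at hε
  have ht2 : t ^ 2 ≠ 0 := pow_ne_zero 2 ht
  obtain ⟨σ, hσ, hσ0, hm⟩ : ∃ σ, σ ^ 2 = s ∧ σ ≠ 0 ∧
      Q'.X + ε * (t ^ 2 * Q'.Z) = σ * (Q.X + ε * (t ^ 2 * Q.Z)) := by
    obtain ⟨σ, hσ⟩ := IsAlgClosed.exists_pow_nat_eq s (n := 2) (by norm_num)
    have hσ0 : σ ≠ 0 := by
      rintro rfl
      exact hs0 (by rw [← hσ]; norm_num)
    rw [← hσ, ← mul_pow] at h1
    rcases sq_eq_sq_iff_eq_or_eq_neg.mp h1 with h | h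
    · exact ⟨σ, hσ, hσ0, h⟩
    · exact ⟨-σ, by rw [neg_sq, hσ], neg_ne_zero.mpr hσ0, by rw [h]; ring⟩
  subst hσ
  rw [hm] at h3
  rw [← mul_pow] at h2
  have eq₁ : ∀ {c : ℂ}, c ≠ 0 → Q'.X = c * Q.X → Q'.Z = c * Q.Z → Q'.Y = c ^ 3 * Q.Y → Q' = Q :=
    fun hc hX hZ hY => Cover.eq_of_proportional _ hc hX hY hZ
  have eq₂ : ∀ {c : ℂ}, c ≠ 0 → Q'.X = c * (t ^ 2 * Q.Z) → t ^ 2 * Q'.Z = c * Q.X →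
      Q'.Y = c ^ 3 * (ε * Q.Y) → Q' = Q'' := by
    intro c hc hX hZ hY
    refine Cover.eq_of_proportional (c / (ρ * t ^ 2)) (div_ne_zero hc (mul_ne_zero hρ ht2)) ?_ ?_ ?_
    · rw [hX, hX'']; field_simp
    · rw [hY, hY'']; field_simp
    · rw [hZ'']; field_simp; linear_combination hZ
  have hcase : (Q'.X = σ * Q.X ∧ t ^ 2 * Q'.Z = σ * (t ^ 2 * Q.Z)) ∨
      (Q'.X = ε * σ * (t ^ 2 * Q.Z) ∧ t ^ 2 * Q'.Z = ε * σ * Q.X) := by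
    rcases sq_eq_sq_iff_eq_or_eq_neg.mp h2 with h | h
    · refine Or.inl ⟨by linear_combination (hm + h) / 2, ?_⟩
      linear_combination ε * (hm - h) / 2 - (t ^ 2 * Q'.Z - σ * (t ^ 2 * Q.Z)) * hε
    · refine Or.inr ⟨by linear_combination (hm + h) / 2, ?_⟩
      linear_combination ε * (hm - h) / 2 - (t ^ 2 * Q'.Z) * hε
  -- Then `h3` carries no information on Y. The x-coordinate is fixed by the involution, Y is known
  -- up to sign from the curve, and both signs occur in the fiber.
  by_cases h0 : Q.X + ε * (t ^ 2 * Q.Z) = 0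
  · have hY2 : Q'.Y ^ 2 = (σ ^ 3 * Q.Y) ^ 2 := by
      have e1 : Q'.X = σ * Q.X ∧ t ^ 2 * Q'.Z = σ * (t ^ 2 * Q.Z) ∨
          Q'.X = -σ * Q.X ∧ t ^ 2 * Q'.Z = -σ * (t ^ 2 * Q.Z) := by
        refine hcase.imp id fun h => ⟨?_, ?_⟩
        · linear_combination h.1 + σ * h0
        · linear_combination h.2 + ε * σ * h0 - σ * t ^ 2 * Q.Z * hε
      have e2 : ∀ c, Q'.X = c * Q.X → t ^ 2 * Q'.Z = c * (t ^ 2 * Q.Z) →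
          Q'.Y ^ 2 = (c ^ 3 * Q.Y) ^ 2 := by
        intro c hX hZ
        have hZ' : Q'.Z = c * Q.Z := mul_left_cancel₀ ht2 (by linear_combination hZ)
        rw [mul_pow, Q'.eqn, Q.eqn, hX, hZ', (formC t).homog]
        ring
      rcases e1 with ⟨hX, hZ⟩ | ⟨hX, hZ⟩
      · exact e2 _ hX hZ
      · rw [e2 _ hX hZ]; ring
    have hX0 : Q.X = -(ε * (t ^ 2 * Q.Z)) := by linear_combination h0
    rcases hcase with ⟨hX, hZ⟩ | ⟨hX, hZ⟩ <;>
      rcases sq_eq_sq_iff_eq_or_eq_neg.mp hY2 with hY | hY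
    · exact Or.inl (eq₁ hσ0 hX (mul_left_cancel₀ ht2 (by linear_combination hZ)) hY)
    · refine Or.inr (eq₂ (c := -(ε * σ)) (neg_ne_zero.mpr (mul_ne_zero hε0 hσ0)) ?_ ?_ ?_)
      · rw [hX, hX0]; ring
      · rw [hZ, hX0]; linear_combination -(σ * t ^ 2 * Q.Z) * hε
      · rw [hY]; linear_combination (σ ^ 3 * Q.Y) * (ε ^ 2 + 1) * hε
    · refine Or.inr (eq₂ (c := ε * σ) (mul_ne_zero hε0 hσ0) hX hZ ?_)
      rw [hY]; linear_combination -(σ ^ 3 * Q.Y) * (ε ^ 2 + 1) * hε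
    · refine Or.inl (eq₁ (c := -σ) (neg_ne_zero.mpr hσ0) ?_ (mul_left_cancel₀ ht2 ?_) ?_)
      · rw [hX, hX0]; ring
      · rw [hZ, hX0]; linear_combination -(σ * t ^ 2 * Q.Z) * hε
      · rw [hY]; ring
  · have hY : Q'.Y = σ ^ 3 * Q.Y := by
      apply mul_left_cancel₀ (mul_ne_zero hσ0 h0)
      linear_combination h3
    rcases hcase with ⟨hX, hZ⟩ | ⟨hX, hZ⟩
    · exact Or.inl (eq₁ hσ0 hX (mul_left_cancel₀ ht2 (by linear_combination hZ)) hY)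
    · refine Or.inr (eq₂ (c := ε * σ) (mul_ne_zero hε0 hσ0) hX hZ ?_)
      rw [hY]; linear_combination -(σ ^ 3 * Q.Y) * (ε ^ 2 + 1) * hε

theorem preimage_phi₁ (hs : p.c ≠ q.c) (ht : t ≠ 0) {κ : CoverIso (formC t) (formFib p q)}
    (hκ : ∀ Q : C t, phi₁ hs κ ((tau ht).map Q) = phi₁ hs κ Q)
    (hb : κ.b = κ.a * t ^ 2) (hd : κ.d = -(κ.c * t ^ 2)) (Q : C t) :
    phi₁ hs κ ⁻¹' {phi₁ hs κ Q} = {Q, (tau ht).map Q} := by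
  have hD : q.c - p.c ≠ 0 := sub_ne_zero.mpr hs.symm
  have he := κ.e_ne
  have hac : κ.a * κ.c ≠ 0 := by
    intro h
    apply κ.det_ne
    rw [hb, hd]
    linear_combination -2 * t ^ 2 * h
  have ha := left_ne_zero_of_mul hac
  have hc := right_ne_zero_of_mul hac
  ext Q'
  simp only [Set.mem_preimage, Set.mem_singleton_iff, Set.mem_insert_iff]
  constructor
  · intro h
    obtain ⟨h0, hX, hY, hZ⟩ := C.coords Q
    obtain ⟨h0', hX', hY', hZ'⟩ := C.coords Q'
    obtain ⟨ρ, hρ, tX, tY, tZ⟩ := tau_spec ht h0 hX hY hZ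
    obtain ⟨σ, hσ, a1, a2, a3⟩ := phi₁_spec hs κ h0 hX hY hZ
    obtain ⟨σ', hσ', b1, b2, b3⟩ := phi₁_spec hs κ h0' hX' hY' hZ'
    obtain ⟨s, hs0, c1, c2, c3⟩ := Cover.proportional_of_eq h hσ' hσ b1 b2 b3 a1 a2 a3
    rw [hb, hd] at c1 c3
    rw [hb] at c2
    refine eq_or_eq_of_fiber (ε := 1) (s := s) ht (by norm_num) hs0 hρ tX (by rw [tY]; ring) tZ
      ?_ ?_ ?_
    · apply mul_left_cancel₀ (mul_ne_zero hD (pow_ne_zero 2 ha))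
      linear_combination c1 - p.c * c3
    · apply mul_left_cancel₀ (mul_ne_zero hD (pow_ne_zero 2 hc))
      linear_combination c1 - q.c * c3
    · apply mul_left_cancel₀ (mul_ne_zero ha he)
      linear_combination c2
  · rintro (rfl | rfl)
    · rfl
    · exact hκ Q

theorem preimage_phi₂ (hs : p.c ≠ q.c) (ht : t ≠ 0) {κ : CoverIso (formC t) (formFib p q)}
    (hκ : ∀ Q : C t, phi₂ hs κ ((tau ht).map ((iota t).map Q)) = phi₂ hs κ Q)
    (hb : κ.b = κ.a * t ^ 2) (hd : κ.d = -(κ.c * t ^ 2)) (Q : C t) :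
    phi₂ hs κ ⁻¹' {phi₂ hs κ Q} = {Q, (tau ht).map ((iota t).map Q)} := by
  have hD : q.c - p.c ≠ 0 := sub_ne_zero.mpr hs.symm
  have he := κ.e_ne
  have hac : κ.a * κ.c ≠ 0 := by
    intro h
    apply κ.det_ne
    rw [hb, hd]
    linear_combination -2 * t ^ 2 * h
  have ha := left_ne_zero_of_mul hac
  have hc := right_ne_zero_of_mul hac
  ext Q'
  simp only [Set.mem_preimage, Set.mem_singleton_iff, Set.mem_insert_iff]
  constructor
  · intro h
    obtain ⟨h0, hX, hY, hZ⟩ := C.coords Q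
    obtain ⟨h0', hX', hY', hZ'⟩ := C.coords Q'
    obtain ⟨ρ₁, hρ₁, iX, iY, iZ⟩ := iota_spec h0 hX hY hZ
    obtain ⟨ρ, hρ, tX, tY, tZ⟩ := tau_spec ht hρ₁ iX iY iZ
    obtain ⟨σ, hσ, a1, a2, a3⟩ := phi₂_spec hs κ h0 hX hY hZ
    obtain ⟨σ', hσ', b1, b2, b3⟩ := phi₂_spec hs κ h0' hX' hY' hZ'
    obtain ⟨s, hs0, c1, c2, c3⟩ := Cover.proportional_of_eq h hσ' hσ b1 b2 b3 a1 a2 a3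
    rw [hb, hd] at c1 c3
    rw [hd] at c2
    refine eq_or_eq_of_fiber (ε := -1) (s := s) ht (by norm_num) hs0 hρ tX (by rw [tY]; ring) tZ
      ?_ ?_ ?_
    · apply mul_left_cancel₀ (mul_ne_zero hD (pow_ne_zero 2 hc))
      linear_combination c1 - q.c * c3
    · apply mul_left_cancel₀ (mul_ne_zero hD (pow_ne_zero 2 ha))
      linear_combination c1 - p.c * c3
    · apply mul_left_cancel₀ (mul_ne_zero hc he)
      linear_combination c2
  · rintro (rfl | rfl)
    · rfl
    · exact hκ Q

end Fibers

/-! ### The isogenies in terms of points of C_t -/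

section IsogenyFormula

variable {p q : Param} {t : ℂ} (hs : p.c ≠ q.c) (ht : t ≠ 0)
  {κ : CoverIso (formC t) (formFib p q)} {ζ : ℂ} (hζ : IsPrimitiveRoot ζ 3)

/-- The divisor over φ₂(Q) is Q + τιQ. As στι = τισ², φ₁τ = φ₁ and φ₁ι = -φ₁, applying σ and φ₁
gives φ₁(σQ) - φ₁(σ²Q). -/
theorem isog₂₁'_phi₂ (hκ₁ : ∀ Q : C t, phi₁ hs κ ((tau ht).map Q) = phi₁ hs κ Q)
    (hfib : ∀ Q : C t, phi₂ hs κ ⁻¹' {phi₂ hs κ Q} = {Q, (tau ht).map ((iota t).map Q)})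
    (Q Q₀ : C t) (h₀ : phi₂ hs κ Q₀ = 0) :
    isog₂₁' hs ht κ hζ (phi₂ hs κ Q)
      = (phi₁ hs κ ((sigma t hζ).map Q) - phi₁ hs κ ((sigma t hζ).map ((sigma t hζ).map Q)))
        - (phi₁ hs κ ((sigma t hζ).map Q₀)
          - phi₁ hs κ ((sigma t hζ).map ((sigma t hζ).map Q₀))) := by
  have hα : ∀ R : C t, (tau ht).map ((iota t).map ((tau ht).map ((iota t).map R))) = R := by
    intro R
    rw [← tau_iota, iota_iota, tau_tau]
  have key : ∀ R : C t, pushForward (phi₁ hs κ) (Finsupp.mapDomain (sigma t hζ).map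
      (pullPoint (phi₂ hs κ) (fun Q => (tau ht).map ((iota t).map Q)) (phi₂ hs κ R)))
      = phi₁ hs κ ((sigma t hζ).map R)
        - phi₁ hs κ ((sigma t hζ).map ((sigma t hζ).map R)) := by
    intro R
    rw [pullPoint_eq (hα R) (hfib R), Finsupp.mapDomain_add, Finsupp.mapDomain_single,
      Finsupp.mapDomain_single, pushForward_pair, sigma_tau, hκ₁, sigma_iota, sigma_iota,
      phi₁_iota, sub_eq_add_neg]
  rw [isog₂₁', pullBack, ← h₀]
  rw [show ∀ a b : C t →₀ ℤ, Finsupp.mapDomain (sigma t hζ).map (a - b)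
      = Finsupp.mapDomain (sigma t hζ).map a - Finsupp.mapDomain (sigma t hζ).map b from
      fun a b => map_sub (Finsupp.mapDomain.addMonoidHom (sigma t hζ).map) a b,
    pushForward_sub, key, key]

theorem isog₁₂'_phi₁
    (hκ₂ : ∀ Q : C t, phi₂ hs κ ((tau ht).map ((iota t).map Q)) = phi₂ hs κ Q)
    (hfib : ∀ Q : C t, phi₁ hs κ ⁻¹' {phi₁ hs κ Q} = {Q, (tau ht).map Q})
    (Q Q₀ : C t) (h₀ : phi₁ hs κ Q₀ = 0) :
    isog₁₂' hs ht κ hζ (phi₁ hs κ Q)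
      = (phi₂ hs κ ((sigma t hζ).map Q) - phi₂ hs κ ((sigma t hζ).map ((sigma t hζ).map Q)))
        - (phi₂ hs κ ((sigma t hζ).map Q₀)
          - phi₂ hs κ ((sigma t hζ).map ((sigma t hζ).map Q₀))) := by
  have hτ : ∀ R : C t, phi₂ hs κ ((tau ht).map R) = -phi₂ hs κ R := by
    intro R
    rw [← phi₂_iota, ← hκ₂ ((iota t).map R), iota_iota]
  have key : ∀ R : C t, pushForward (phi₂ hs κ) (Finsupp.mapDomain (sigma t hζ).map
      (pullPoint (phi₁ hs κ) (tau ht).map (phi₁ hs κ R)))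
      = phi₂ hs κ ((sigma t hζ).map R)
        - phi₂ hs κ ((sigma t hζ).map ((sigma t hζ).map R)) := by
    intro R
    rw [pullPoint_eq (tau_tau ht R) (hfib R), Finsupp.mapDomain_add, Finsupp.mapDomain_single,
      Finsupp.mapDomain_single, pushForward_pair, sigma_tau, hτ, sub_eq_add_neg]
  rw [isog₁₂', pullBack, ← h₀]
  rw [show ∀ a b : C t →₀ ℤ, Finsupp.mapDomain (sigma t hζ).map (a - b)
      = Finsupp.mapDomain (sigma t hζ).map a - Finsupp.mapDomain (sigma t hζ).map b from
      fun a b => map_sub (Finsupp.mapDomain.addMonoidHom (sigma t hζ).map) a b,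
    pushForward_sub, key, key]

end IsogenyFormula

/-! ### The isogenies in flex coordinates -/

namespace FlexModel

variable {p q : Param} {t : ℂ} {hs : p.c ≠ q.c} {κ : CoverIso (formC t) (formFib p q)}
  (M : FlexModel hs κ) {ζ : ℂ} (hζ : IsPrimitiveRoot ζ 3)

theorem k_add_four_ne : M.k + 4 ≠ 0 := fun h =>
  M.l_ne (by linear_combination M.add_eq - h)

theorem l_add_four_ne : M.l + 4 ≠ 0 := fun h =>
  M.k_ne (by linear_combination M.add_eq - h)

theorem add_eq' : M.l + M.k = -4 := by rw [add_comm, M.add_eq]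

theorem Y_sq (Q : C t) : Q.Y ^ 2
    = Q.X ^ 6 + (M.k + 2) * Q.X ^ 3 * (t ^ 2 * Q.Z) ^ 3 + (t ^ 2 * Q.Z) ^ 6 := by
  rw [Q.eqn]
  simp only [formC]
  linear_combination -(Q.X ^ 3 * Q.Z ^ 3) * M.rel

theorem Y_sq' (Q : C t) : Q.Y ^ 2
    = (-Q.X) ^ 6 + (M.l + 2) * (-Q.X) ^ 3 * (t ^ 2 * Q.Z) ^ 3 + (t ^ 2 * Q.Z) ^ 6 := by
  rw [M.Y_sq]
  linear_combination Q.X ^ 3 * (t ^ 2 * Q.Z) ^ 3 * M.add_eq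

theorem t_ne (M : FlexModel hs κ) : t ≠ 0 := by
  rintro rfl
  have := M.rel
  norm_num at this

theorem coords_ne (M : FlexModel hs κ) (Q : C t) : Q.X ≠ 0 ∨ t ^ 2 * Q.Z ≠ 0 :=
  Q.ne_zero.imp_right (mul_ne_zero (pow_ne_zero 2 M.t_ne))

/-- The coordinates of `φ₁(σ(Q)) - φ₁(σ²(Q))`. -/
theorem rep_phi₁_sub (Q : C t) :
    Rep (M.ν₁ (phi₁ hs κ ((sigma t hζ).map Q)
      - phi₁ hs κ ((sigma t hζ).map ((sigma t hζ).map Q))))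
      (isogX M.l ((t ^ 2 * Q.Z - Q.X) ^ 2) (-(Q.X * (t ^ 2 * Q.Z))))
      (isogY M.l (ζ - ζ ^ 2) ((t ^ 2 * Q.Z - Q.X) ^ 2) (Q.Y * (t ^ 2 * Q.Z - Q.X))
        (-(Q.X * (t ^ 2 * Q.Z))))
      (isogZ ((t ^ 2 * Q.Z - Q.X) ^ 2) (-(Q.X * (t ^ 2 * Q.Z)))) := by
  obtain ⟨h0, hX, hY, hZ⟩ := C.coords Q
  obtain ⟨ρ, hρ, iX, iY, iZ⟩ := sigma_spec hζ h0 hX hY hZ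
  obtain ⟨ρ', hρ', jX, jY, jZ⟩ := sigma_spec hζ hρ iX iY iZ
  rw [map_sub]
  have h2 := M.rep₁ hρ' jX jY jZ
  rw [← mul_assoc ζ ζ, ← sq] at h2
  exact sub_eq_isog M.k_ne M.k_add_four_ne M.add_eq (root_rel hζ) (M.coords_ne Q) (M.Y_sq Q)
    (M.rep₁ hρ iX iY iZ) h2

/-- The coordinates of `φ₂(σ(Q)) - φ₂(σ²(Q))`. -/
theorem rep_phi₂_sub (Q : C t) :
    Rep (M.ν₂ (phi₂ hs κ ((sigma t hζ).map Q)
      - phi₂ hs κ ((sigma t hζ).map ((sigma t hζ).map Q))))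
      (isogX M.k ((t ^ 2 * Q.Z - -Q.X) ^ 2) (-(-Q.X * (t ^ 2 * Q.Z))))
      (isogY M.k (ζ - ζ ^ 2) ((t ^ 2 * Q.Z - -Q.X) ^ 2) (Q.Y * (t ^ 2 * Q.Z - -Q.X))
        (-(-Q.X * (t ^ 2 * Q.Z))))
      (isogZ ((t ^ 2 * Q.Z - -Q.X) ^ 2) (-(-Q.X * (t ^ 2 * Q.Z)))) := by
  obtain ⟨h0, hX, hY, hZ⟩ := C.coords Q
  obtain ⟨ρ, hρ, iX, iY, iZ⟩ := sigma_spec hζ h0 hX hY hZ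
  obtain ⟨ρ', hρ', jX, jY, jZ⟩ := sigma_spec hζ hρ iX iY iZ
  rw [map_sub]
  have h1 := M.rep₂ hρ iX iY iZ
  have h2 := M.rep₂ hρ' jX jY jZ
  rw [← mul_assoc ζ ζ, ← sq, ← mul_neg] at h2
  rw [← mul_neg] at h1
  exact sub_eq_isog M.l_ne M.l_add_four_ne M.add_eq' (root_rel hζ)
    ((M.coords_ne Q).imp_left neg_ne_zero.mpr) (M.Y_sq' Q) h1 h2

/-- The zero of the second curve lies under X = T, where `isogZ` vanishes. So the base point
contributes nothing to the isogeny. -/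
theorem phi₁_sub_eq_zero (M : FlexModel hs κ) {Q : C t} (h : phi₂ hs κ Q = 0) :
    phi₁ hs κ ((sigma t hζ).map Q)
      - phi₁ hs κ ((sigma t hζ).map ((sigma t hζ).map Q)) = 0 := by
  obtain ⟨h0, hX, hY, hZ⟩ := C.coords Q
  have h1 := M.rep₂ h0 hX hY hZ
  have h2 := M.rep_phi₁_sub hζ Q
  apply M.injective₁
  rw [map_zero]
  rw [h, map_zero] at h1
  have h3 : t ^ 2 * Q.Z - Q.X = 0 := by
    rcases h1 with ⟨h1, -⟩ | ⟨-, n, h1⟩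
    · have := pow_eq_zero_iff two_ne_zero |>.mp h1
      linear_combination this
    · exact absurd h1.symm (Point.some_ne_zero n)
  rcases h2 with ⟨-, -, h2⟩ | ⟨h2, -⟩
  · exact h2
  · exact absurd (by rw [h3]; simp [isogZ]) h2

theorem phi₂_sub_eq_zero (M : FlexModel hs κ) {Q : C t} (h : phi₁ hs κ Q = 0) :
    phi₂ hs κ ((sigma t hζ).map Q)
      - phi₂ hs κ ((sigma t hζ).map ((sigma t hζ).map Q)) = 0 := by
  obtain ⟨h0, hX, hY, hZ⟩ := C.coords Q
  have h1 := M.rep₁ h0 hX hY hZ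
  have h2 := M.rep_phi₂_sub hζ Q
  apply M.injective₂
  rw [map_zero]
  rw [h, map_zero] at h1
  have h3 : t ^ 2 * Q.Z - -Q.X = 0 := by
    rcases h1 with ⟨h1, -⟩ | ⟨-, n, h1⟩
    · have := pow_eq_zero_iff two_ne_zero |>.mp h1
      linear_combination this
    · exact absurd h1.symm (Point.some_ne_zero n)
  rcases h2 with ⟨-, -, h2⟩ | ⟨h2, -⟩
  · exact h2
  · exact absurd (by rw [h3]; simp [isogZ]) h2

end FlexModel

/-- Homogeneity of the formulas for the three-isogeny. -/
theorem isog_homog (l δ W G U r : ℂ) :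
    isogX l (r * W) (r * U) = r ^ 3 * isogX l W U ∧
    isogY l δ (r * W) (r ^ 2 * G) (r * U) = (r ^ 3) ^ 2 * isogY l δ W G U ∧
    isogZ (r * W) (r * U) = r ^ 3 * isogZ W U := by
  refine ⟨?_, ?_, ?_⟩
  · simp only [isogX]; ring
  · simp only [isogY]; ring
  · simp only [isogZ]; ring

theorem flexQuartic_eq_zero {k V G U : ℂ} (hG : G ^ 2 = flexQuartic k V U) (hV : V = 0) :
    G = 0 := by
  rw [hV] at hG
  simpa [flexQuartic] using hG

namespace FlexModel

variable {p q : Param} {t : ℂ} {hs : p.c ≠ q.c} {κ : CoverIso (formC t) (formFib p q)}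
  (M : FlexModel hs κ) (ht : t ≠ 0) {ζ : ℂ} (hζ : IsPrimitiveRoot ζ 3)

theorem rep_isog₂₁' (hκ₁ : ∀ Q : C t, phi₁ hs κ ((tau ht).map Q) = phi₁ hs κ Q)
    (hfib : ∀ Q : C t, phi₂ hs κ ⁻¹' {phi₂ hs κ Q} = {Q, (tau ht).map ((iota t).map Q)})
    {P : E' q} {W G U : ℂ} (hP : Rep (M.ν₂ P) (M.l * U) (M.l * G) W)
    (hG : G ^ 2 = flexQuartic M.l W U) :
    Rep (M.ν₁ (isog₂₁' hs ht κ hζ P)) (isogX M.l W U) (isogY M.l (ζ - ζ ^ 2) W G U)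
      (isogZ W U) := by
  obtain ⟨Q, rfl⟩ := phi₂_surjective hs κ P
  obtain ⟨Q₀, h₀⟩ := phi₂_surjective hs κ 0
  rw [isog₂₁'_phi₂ hs ht hζ hκ₁ hfib Q Q₀ h₀, M.phi₁_sub_eq_zero hζ h₀, sub_zero]
  obtain ⟨h0, hX, hY, hZ⟩ := C.coords Q
  obtain ⟨r, hr, e1, e2, e3⟩ := (M.rep₂ h0 hX hY hZ).proportional hP
    (fun h => by rw [pow_eq_zero_iff two_ne_zero |>.mp h]; ring)
    (fun h => by rw [flexQuartic_eq_zero hG h, mul_zero])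
  have hU : U = r * -(Q.X * (t ^ 2 * Q.Z)) :=
    mul_left_cancel₀ M.l_ne (by linear_combination e1)
  have hG' : G = r ^ 2 * (Q.Y * (t ^ 2 * Q.Z - Q.X)) :=
    mul_left_cancel₀ M.l_ne (by linear_combination e2)
  have hW : W = r * (t ^ 2 * Q.Z - Q.X) ^ 2 := by linear_combination e3
  obtain ⟨a1, a2, a3⟩ := isog_homog M.l (ζ - ζ ^ 2) ((t ^ 2 * Q.Z - Q.X) ^ 2)
    (Q.Y * (t ^ 2 * Q.Z - Q.X)) (-(Q.X * (t ^ 2 * Q.Z))) r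
  rw [hU, hG', hW, a1, a2, a3]
  exact (M.rep_phi₁_sub hζ Q).smul (pow_ne_zero 3 hr)

theorem rep_isog₁₂' (hκ₂ : ∀ Q : C t, phi₂ hs κ ((tau ht).map ((iota t).map Q)) = phi₂ hs κ Q)
    (hfib : ∀ Q : C t, phi₁ hs κ ⁻¹' {phi₁ hs κ Q} = {Q, (tau ht).map Q})
    {P : E' p} {V G U : ℂ} (hP : Rep (M.ν₁ P) (M.k * U) (M.k * G) V)
    (hG : G ^ 2 = flexQuartic M.k V U) :
    Rep (M.ν₂ (isog₁₂' hs ht κ hζ P)) (isogX M.k V U) (isogY M.k (ζ - ζ ^ 2) V G U)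
      (isogZ V U) := by
  obtain ⟨Q, rfl⟩ := phi₁_surjective hs κ P
  obtain ⟨Q₀, h₀⟩ := phi₁_surjective hs κ 0
  rw [isog₁₂'_phi₁ hs ht hζ hκ₂ hfib Q Q₀ h₀, M.phi₂_sub_eq_zero hζ h₀, sub_zero]
  obtain ⟨h0, hX, hY, hZ⟩ := C.coords Q
  obtain ⟨r, hr, e1, e2, e3⟩ := (M.rep₁ h0 hX hY hZ).proportional hP
    (fun h => by rw [pow_eq_zero_iff two_ne_zero |>.mp h]; ring)
    (fun h => by rw [flexQuartic_eq_zero hG h, mul_zero])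
  have hU : U = r * -(-Q.X * (t ^ 2 * Q.Z)) :=
    mul_left_cancel₀ M.k_ne (by linear_combination e1)
  have hG' : G = r ^ 2 * (Q.Y * (t ^ 2 * Q.Z - -Q.X)) :=
    mul_left_cancel₀ M.k_ne (by linear_combination e2)
  have hV : V = r * (t ^ 2 * Q.Z - -Q.X) ^ 2 := by linear_combination e3
  obtain ⟨a1, a2, a3⟩ := isog_homog M.k (ζ - ζ ^ 2) ((t ^ 2 * Q.Z - -Q.X) ^ 2)
    (Q.Y * (t ^ 2 * Q.Z - -Q.X)) (-(-Q.X * (t ^ 2 * Q.Z))) r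
  rw [hU, hG', hV, a1, a2, a3]
  exact (M.rep_phi₂_sub hζ Q).smul (pow_ne_zero 3 hr)

/-- Coordinates of a point of a flex curve that satisfy the normalized equation. -/
theorem _root_.PoonenPairs.Rep.exists_sqrt {k : ℂ} (hk : k ≠ 0) {T : (flexCurve k).Point}
    {U Y V : ℂ} (h : Rep T (k * U) Y V) :
    ∃ G, G ^ 2 = flexQuartic k V U ∧ Rep T (k * U) (k * G) V := by
  rcases h with ⟨rfl, hX, rfl⟩ | ⟨hV, n, rfl⟩
  · exact ⟨0, by simp [flexQuartic], Or.inl ⟨rfl, hX, rfl⟩⟩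
  · refine ⟨Y / k, ?_, Or.inr ⟨hV, ?_⟩⟩
    · have := (equation_of_short rfl rfl).mp n.1
      simp only [flexCurve] at this
      simp only [flexQuartic]
      field_simp at this ⊢
      apply mul_left_cancel₀ hV
      grind
    · rw [mul_div_cancel₀ _ hk]
      exact ⟨n, rfl⟩

end FlexModel

/-- The cubic cofactors of V and W = U - V in the two quartics add up to 9UVW, so a common zero
forces U, V or W to vanish. This guarantees that G₁ - G₂ : G₁ + G₂ is a point. -/
theorem flexQuartic_not_both_zero {k l U V : ℂ} (hk : k ≠ 0) (hl : l ≠ 0) (hkl : k + l = -4)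
    (h : U ≠ 0 ∨ V ≠ 0) : flexQuartic k V U ≠ 0 ∨ flexQuartic l (U - V) U ≠ 0 := by
  by_contra! h0
  obtain ⟨h1, h2⟩ := h0
  simp only [flexQuartic, mul_eq_zero] at h1 h2
  have e : (V * (V - 3 * U) ^ 2 + k * U ^ 3) + ((U - V) * (U - V - 3 * U) ^ 2 + l * U ^ 3)
      = 9 * (U * V * (U - V)) := by linear_combination U ^ 3 * hkl
  rcases h1 with rfl | h1
  · have hU : U ≠ 0 := by simpa using h
    rcases h2 with h2 | h2
    · exact hU (by linear_combination h2)
    · exact mul_ne_zero hk (pow_ne_zero 3 hU) (by linear_combination U ^ 3 * hkl - h2)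
  · rcases h2 with h2 | h2
    · have hV : V = U := by linear_combination -h2
      subst hV
      have hV : V ≠ 0 := by simpa using h
      exact mul_ne_zero hl (pow_ne_zero 3 hV) (by linear_combination V ^ 3 * hkl - h1)
    · rw [h1, h2] at e
      have e' : U * V * (U - V) = 0 := by linear_combination -e / 9
      have hV : V ^ 3 = 0 := by
        rcases mul_eq_zero.mp e' with e' | e'
        · rcases mul_eq_zero.mp e' with rfl | rfl
          · linear_combination h1
          · norm_num
        · have hU : U = V := by linear_combination e'
          subst hU
          have h3 : U ^ 3 * l = 0 := by linear_combination h2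
          simpa [hl] using h3
      have hV' : V = 0 := by simpa using hV
      subst hV'
      have h3 : k * U ^ 3 = 0 := by linear_combination h1
      have hU : U = 0 := by simpa [hk] using h3
      simp [hU] at h

theorem eq_coords_of_x_eq {n m : ℕ} {F : BinForm n} {G : BinForm m} {P : Cover F} {Q : Cover G}
    (h : P.x = Q.x) : Q.X = P.X ∧ Q.Z = P.Z := by
  rw [Cover.x_eq_x_iff] at h
  rcases P.norm with h1 | ⟨h1, h2⟩ <;> rcases Q.norm with k1 | ⟨k1, k2⟩ <;> simp_all

theorem phi_cross {p q : Param} {t : ℂ} (hs : p.c ≠ q.c) (κ : CoverIso (formC t) (formFib p q))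
    (Q : C t) : (phi₁ hs κ Q).X * (phi₂ hs κ Q).Z = (phi₂ hs κ Q).X * (phi₁ hs κ Q).Z := by
  obtain ⟨h0, hX, hY, hZ⟩ := C.coords Q
  obtain ⟨σ, -, a1, -, a3⟩ := phi₁_spec hs κ h0 hX hY hZ
  obtain ⟨σ', -, b1, -, b3⟩ := phi₂_spec hs κ h0 hX hY hZ
  rw [a1, a3, b1, b3]
  ring

theorem rep_neg_isog {k l δ W G U : ℂ} {B : (flexCurve k).Point}
    (h : Rep B (isogX l W U) (isogY l δ W G U) (isogZ W U)) :
    Rep (-B) (isogX l W U) (isogY l δ W (-G) U) (isogZ W U) := by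
  have := flexCurve_rep_neg h
  rwa [show -isogY l δ W G U = isogY l δ W (-G) U by simp only [isogY]; ring] at this

theorem eq_or_eq_neg_of_injective {A B : Type*} [AddGroup A] [AddGroup B] {f : A →+ B}
    (hf : Function.Injective f) {a b : A} (h : f a = f b ∨ f a = -f b) : a = b ∨ a = -b := by
  rw [← map_neg] at h
  exact h.imp (fun h => hf h) fun h => hf h

/-! ### The common point on the curve of genus two -/

namespace FlexModel

variable {p q : Param} {t : ℂ} {hs : p.c ≠ q.c} {κ : CoverIso (formC t) (formFib p q)}
  (M : FlexModel hs κ) (ht : t ≠ 0) {ζ : ℂ} (hζ : IsPrimitiveRoot ζ 3)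

theorem uv_ne (P : E p) :
    M.u.1 * P.X + M.u.2 * P.Z ≠ 0 ∨ M.v.1 * P.X + M.v.2 * P.Z ≠ 0 := by
  by_contra! h
  obtain ⟨h1, h2⟩ := h
  have hX : (M.u.1 * M.v.2 - M.u.2 * M.v.1) * P.X = 0 := by
    linear_combination M.v.2 * h1 - M.u.2 * h2
  have hZ : (M.u.1 * M.v.2 - M.u.2 * M.v.1) * P.Z = 0 := by
    linear_combination M.u.1 * h2 - M.v.1 * h1
  rcases P.ne_zero with h | h
  · exact mul_ne_zero M.det_ne h hX
  · exact mul_ne_zero M.det_ne h hZ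

/-- Compatible coordinates for two points with the same `x`-coordinate. -/
theorem exists_coords {P₁ : E p} {P₂ : E q} (h : P₁.x = P₂.x) {U V : ℂ}
    (hU : U = M.u.1 * P₁.X + M.u.2 * P₁.Z) (hV : V = M.v.1 * P₁.X + M.v.2 * P₁.Z) :
    ∃ G₁ G₂, G₁ ^ 2 = flexQuartic M.k V U ∧ G₂ ^ 2 = flexQuartic M.l (U - V) U ∧
      Rep (M.ν₁ (lam p P₁)) (M.k * U) (M.k * G₁) V ∧
      Rep (M.ν₂ (lam q P₂)) (M.l * U) (M.l * G₂) (U - V) := by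
  obtain ⟨hX, hZ⟩ := eq_coords_of_x_eq h
  obtain ⟨Y₁, h₁⟩ := M.rep_lam₁ P₁
  obtain ⟨Y₂, h₂⟩ := M.rep_lam₂ P₂
  rw [hX, hZ, ← hU, ← hV] at h₂
  rw [← hU, ← hV] at h₁
  obtain ⟨G₁, e₁, r₁⟩ := h₁.exists_sqrt M.k_ne
  obtain ⟨G₂, e₂, r₂⟩ := h₂.exists_sqrt M.l_ne
  exact ⟨G₁, G₂, e₁, e₂, r₁, r₂⟩

theorem rep₁_of_coords {Q : C t} {ρ X Y T : ℂ} (hρ : ρ ≠ 0) (hX : Q.X = ρ * X)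
    (hY : Q.Y = ρ ^ 3 * Y) (hT : Q.Z = ρ * (T / t ^ 2)) :
    Rep (M.ν₁ (phi₁ hs κ Q)) (M.k * (X * T)) (M.k * (Y * (X + T))) ((X + T) ^ 2) := by
  have h := M.rep₁ hρ hX hY hT
  rwa [mul_div_cancel₀ _ (pow_ne_zero 2 M.t_ne)] at h

theorem rep₂_of_coords {Q : C t} {ρ X Y T : ℂ} (hρ : ρ ≠ 0) (hX : Q.X = ρ * X)
    (hY : Q.Y = ρ ^ 3 * Y) (hT : Q.Z = ρ * (T / t ^ 2)) :
    Rep (M.ν₂ (phi₂ hs κ Q)) (M.l * (-X * T)) (M.l * (Y * (-X + T))) ((-X + T) ^ 2) := by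
  have h := M.rep₂ hρ hX hY hT
  rwa [mul_div_cancel₀ _ (pow_ne_zero 2 M.t_ne)] at h

/-- The points of `E'_{s₁}` and `E'_{s₂}` occurring in the theorem are the images of the points
`Q`, `σ(Q)` and `σ²(Q)` of the curve of genus two. -/
theorem exists_common_point
    (hκ₁ : ∀ Q : C t, phi₁ hs κ ((tau ht).map Q) = phi₁ hs κ Q)
    (hκ₂ : ∀ Q : C t, phi₂ hs κ ((tau ht).map ((iota t).map Q)) = phi₂ hs κ Q)
    (hfib₁ : ∀ Q : C t, phi₁ hs κ ⁻¹' {phi₁ hs κ Q} = {Q, (tau ht).map Q})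
    (hfib₂ : ∀ Q : C t, phi₂ hs κ ⁻¹' {phi₂ hs κ Q} = {Q, (tau ht).map ((iota t).map Q)})
    {P₁ : E p} {P₂ : E q} (h : P₁.x = P₂.x) {U V : ℂ}
    (hU : U = M.u.1 * P₁.X + M.u.2 * P₁.Z) (hV : V = M.v.1 * P₁.X + M.v.2 * P₁.Z) :
    ∃ (G₁ G₂ ρ : ℂ) (Q : C t), ρ ≠ 0 ∧ G₁ ^ 2 = flexQuartic M.k V U ∧
      G₂ ^ 2 = flexQuartic M.l (U - V) U ∧
      Q.X = ρ * (G₁ - G₂) ∧ Q.Z = ρ * ((G₁ + G₂) / t ^ 2) ∧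
      (lam p (2 • P₁) = phi₁ hs κ Q ∨ lam p (2 • P₁) = -phi₁ hs κ Q) ∧
      (lam p (-P₁ + isog₂₁ hs ht κ hζ P₂) = phi₁ hs κ ((sigma t hζ).map Q) ∨
        lam p (-P₁ + isog₂₁ hs ht κ hζ P₂) = -phi₁ hs κ ((sigma t hζ).map Q)) ∧
      (lam q (-P₂ + isog₁₂ hs ht κ hζ P₁) = phi₂ hs κ ((sigma t hζ).map Q) ∨
        lam q (-P₂ + isog₁₂ hs ht κ hζ P₁) = -phi₂ hs κ ((sigma t hζ).map Q)) ∧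
      (lam p (-P₁ - isog₂₁ hs ht κ hζ P₂)
          = phi₁ hs κ ((sigma t hζ).map ((sigma t hζ).map Q)) ∨
        lam p (-P₁ - isog₂₁ hs ht κ hζ P₂)
          = -phi₁ hs κ ((sigma t hζ).map ((sigma t hζ).map Q))) ∧
      (lam q (-P₂ - isog₁₂ hs ht κ hζ P₁)
          = phi₂ hs κ ((sigma t hζ).map ((sigma t hζ).map Q)) ∨
        lam q (-P₂ - isog₁₂ hs ht κ hζ P₁)
          = -phi₂ hs κ ((sigma t hζ).map ((sigma t hζ).map Q))) := by
  obtain ⟨G₁, G₂, e₁, e₂, r₁, r₂⟩ := M.exists_coords h hU hV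
  have ht2 := pow_ne_zero 2 ht
  have hne : G₁ - G₂ ≠ 0 ∨ (G₁ + G₂) / t ^ 2 ≠ 0 := by
    by_contra! h0
    obtain ⟨h1, h2⟩ := h0
    have h3 : G₁ + G₂ = 0 := by simpa [ht] using h2
    have h4 : G₁ = 0 := by linear_combination (h1 + h3) / 2
    have h5 : G₂ = 0 := by linear_combination (h3 - h1) / 2
    rcases flexQuartic_not_both_zero M.k_ne M.l_ne M.add_eq (hU ▸ hV ▸ M.uv_ne P₁) with h | h
    · exact h (by rw [← e₁, h4]; norm_num)
    · exact h (by rw [← e₂, h5]; norm_num)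
  -- Q is the point with X : T = G₁ - G₂ : G₁ + G₂; the sign of its y-coordinate does not matter.
  obtain ⟨Q, ρ, Y, hρ, hX, hY, hZ⟩ := C.exists_point t _ _ hne
  obtain ⟨ρ', hρ', jX, jY, jZ⟩ := sigma_spec hζ hρ hX hY hZ
  obtain ⟨ρ'', hρ'', kX, kY, kZ⟩ := sigma_spec hζ hρ' jX jY jZ
  have hζ' := root_rel hζ
  have h3 := hζ.pow_eq_one
  have hζ0 : ζ ^ 2 ≠ 0 := pow_ne_zero 2 (hζ.ne_zero (by norm_num))
  have b₁ := M.rep_isog₂₁' ht hζ hκ₁ hfib₂ r₂ e₂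
  have b₂ := M.rep_isog₁₂' ht hζ hκ₂ hfib₁ r₁ e₁
  have hV' : V = U - (U - V) := by ring
  have c₀ := M.rep₁_of_coords hρ hX hY hZ
  have c₁ := M.rep₁_of_coords hρ' jX jY jZ
  have c₂ := M.rep₂_of_coords hρ' jX jY jZ
  have d₁ := (M.rep₁_of_coords hρ'' kX kY kZ).smul hζ0
  have d₂ := (M.rep₂_of_coords hρ'' kX kY kZ).smul hζ0
  -- The coordinate -X used by φ₂ amounts to exchanging G₁ and G₂.
  rw [show M.l * (-(ζ * (G₁ - G₂)) * (G₁ + G₂)) = M.l * (ζ * (G₂ - G₁) * (G₂ + G₁)) by ring,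
    show (-(ζ * (G₁ - G₂)) + (G₁ + G₂)) ^ 2 = (ζ * (G₂ - G₁) + (G₂ + G₁)) ^ 2 by ring] at c₂
  -- Up to scaling by ζ², passing from σ to σ² changes the sign of the other square root, which
  -- negates the isogeny term.
  rw [show ζ ^ 2 * (M.k * (ζ * (ζ * (G₁ - G₂)) * (G₁ + G₂)))
      = M.k * (ζ * (G₁ - -G₂) * (G₁ + -G₂)) by
      linear_combination M.k * ζ * (G₁ - G₂) * (G₁ + G₂) * h3,
    show ζ ^ 2 * (ζ * (ζ * (G₁ - G₂)) + (G₁ + G₂)) ^ 2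
      = (ζ * (G₁ - -G₂) + (G₁ + -G₂)) ^ 2 by
      linear_combination ((G₁ - G₂) ^ 2 * (ζ ^ 3 + 1) + 2 * ζ * (G₁ - G₂) * (G₁ + G₂)) * h3] at d₁
  rw [show ζ ^ 2 * (M.l * (-(ζ * (ζ * (G₁ - G₂))) * (G₁ + G₂)))
      = M.l * (ζ * (G₂ - -G₁) * (G₂ + -G₁)) by
      linear_combination -M.l * ζ * (G₁ - G₂) * (G₁ + G₂) * h3,
    show ζ ^ 2 * (-(ζ * (ζ * (G₁ - G₂))) + (G₁ + G₂)) ^ 2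
      = (ζ * (G₂ - -G₁) + (G₂ + -G₁)) ^ 2 by
      linear_combination ((G₁ - G₂) ^ 2 * (ζ ^ 3 + 1) - 2 * ζ * (G₁ - G₂) * (G₁ + G₂)) * h3] at d₂
  have l₁ : lam p (isog₂₁ hs ht κ hζ P₂) = isog₂₁' hs ht κ hζ (lam q P₂) :=
    Equiv.apply_symm_apply _ _
  have l₂ : lam q (isog₁₂ hs ht κ hζ P₁) = isog₁₂' hs ht κ hζ (lam p P₁) :=
    Equiv.apply_symm_apply _ _
  refine ⟨G₁, G₂, ρ, Q, hρ, e₁, e₂, hX, hZ, ?_, ?_, ?_, ?_, ?_⟩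
  · apply eq_or_eq_neg_of_injective M.injective₁
    rw [lam_nsmul, map_nsmul]
    exact two_nsmul_flex M.add_eq rfl e₁ e₂ r₁ c₀
  · apply eq_or_eq_neg_of_injective M.injective₁
    rw [lam_add, lam_neg, map_add, map_neg, l₁]
    exact neg_add_isog M.add_eq rfl e₁ e₂ hζ' r₁ b₁ c₁
  · apply eq_or_eq_neg_of_injective M.injective₂
    rw [lam_add, lam_neg, map_add, map_neg, l₂]
    exact neg_add_isog M.add_eq' hV' e₂ e₁ hζ' r₂ b₂ c₂
  · apply eq_or_eq_neg_of_injective M.injective₁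
    rw [sub_eq_add_neg, lam_add, lam_neg, lam_neg, map_add, map_neg, map_neg, l₁]
    exact neg_add_isog M.add_eq rfl e₁ (by rw [neg_sq, e₂]) hζ' r₁ (rep_neg_isog b₁) d₁
  · apply eq_or_eq_neg_of_injective M.injective₂
    rw [sub_eq_add_neg, lam_add, lam_neg, lam_neg, map_add, map_neg, map_neg, l₂]
    exact neg_add_isog M.add_eq' hV' e₂ (by rw [neg_sq, e₁]) hζ' r₂ (rep_neg_isog b₂) d₂

/-- Additivity is not needed: the explicit formula commutes with doubling up to sign. -/
theorem isOfFinAddOrder_isog₂₁ (M : FlexModel hs κ)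
    (hκ₁ : ∀ Q : C t, phi₁ hs κ ((tau ht).map Q) = phi₁ hs κ Q)
    (hfib₂ : ∀ Q : C t, phi₂ hs κ ⁻¹' {phi₂ hs κ Q} = {Q, (tau ht).map ((iota t).map Q)})
    {P : E q} (hP : IsOfFinAddOrder P) : IsOfFinAddOrder (isog₂₁ hs ht κ hζ P) := by
  have hcoords : ∀ R : E' q, ∃ U G W, G ^ 2 = flexQuartic M.l W U ∧
      Rep (M.ν₂ R) (M.l * U) (M.l * G) W := by
    intro R
    obtain ⟨Q, rfl⟩ := phi₂_surjective hs κ R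
    obtain ⟨h0, hX, hY, hZ⟩ := C.coords Q
    obtain ⟨G, e, r⟩ := (M.rep₂ h0 hX hY hZ).exists_sqrt M.l_ne
    exact ⟨_, G, _, e, r⟩
  have h1 : IsOfFinAddOrder (isog₂₁' hs ht κ hζ (lam q P)) := by
    refine isOfFinAddOrder_of_two_nsmul (fun R => ?_)
      ((lamAdd q).toAddMonoidHom.isOfFinAddOrder hP)
    obtain ⟨U, G, W, e, r⟩ := hcoords R
    obtain ⟨U', G', W', e', r'⟩ := hcoords (2 • R)
    apply eq_or_eq_neg_of_injective M.injective₁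
    rw [map_nsmul]
    refine two_nsmul_isog M.l_ne M.l_add_four_ne M.add_eq (δ := ζ - ζ ^ 2) ?_ e e' r
      (by rwa [← map_nsmul]) (M.rep_isog₂₁' ht hζ hκ₁ hfib₂ r e)
      (M.rep_isog₂₁' ht hζ hκ₁ hfib₂ r' e')
    linear_combination (ζ ^ 2 - 3 * ζ + 3) * root_rel hζ
  exact (lamAdd p).symm.toAddMonoidHom.isOfFinAddOrder h1

theorem isOfFinAddOrder_isog₁₂ (M : FlexModel hs κ)
    (hκ₂ : ∀ Q : C t, phi₂ hs κ ((tau ht).map ((iota t).map Q)) = phi₂ hs κ Q)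
    (hfib₁ : ∀ Q : C t, phi₁ hs κ ⁻¹' {phi₁ hs κ Q} = {Q, (tau ht).map Q})
    {P : E p} (hP : IsOfFinAddOrder P) : IsOfFinAddOrder (isog₁₂ hs ht κ hζ P) := by
  have hcoords : ∀ R : E' p, ∃ U G V, G ^ 2 = flexQuartic M.k V U ∧
      Rep (M.ν₁ R) (M.k * U) (M.k * G) V := by
    intro R
    obtain ⟨Q, rfl⟩ := phi₁_surjective hs κ R
    obtain ⟨h0, hX, hY, hZ⟩ := C.coords Q
    obtain ⟨G, e, r⟩ := (M.rep₁ h0 hX hY hZ).exists_sqrt M.k_ne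
    exact ⟨_, G, _, e, r⟩
  have h1 : IsOfFinAddOrder (isog₁₂' hs ht κ hζ (lam p P)) := by
    refine isOfFinAddOrder_of_two_nsmul (fun R => ?_)
      ((lamAdd p).toAddMonoidHom.isOfFinAddOrder hP)
    obtain ⟨U, G, V, e, r⟩ := hcoords R
    obtain ⟨U', G', V', e', r'⟩ := hcoords (2 • R)
    apply eq_or_eq_neg_of_injective M.injective₂
    rw [map_nsmul]
    refine two_nsmul_isog M.k_ne M.k_add_four_ne M.add_eq' (δ := ζ - ζ ^ 2) ?_ e e' r
      (by rwa [← map_nsmul]) (M.rep_isog₁₂' ht hζ hκ₂ hfib₁ r e)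
      (M.rep_isog₁₂' ht hζ hκ₂ hfib₁ r' e')
    linear_combination (ζ ^ 2 - 3 * ζ + 3) * root_rel hζ
  exact (lamAdd q).symm.toAddMonoidHom.isOfFinAddOrder h1

theorem halves_and_torsion (M : FlexModel hs κ)
    (hκ₁ : ∀ Q : C t, phi₁ hs κ ((tau ht).map Q) = phi₁ hs κ Q)
    (hκ₂ : ∀ Q : C t, phi₂ hs κ ((tau ht).map ((iota t).map Q)) = phi₂ hs κ Q)
    (hfib₁ : ∀ Q : C t, phi₁ hs κ ⁻¹' {phi₁ hs κ Q} = {Q, (tau ht).map Q})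
    (hfib₂ : ∀ Q : C t, phi₂ hs κ ⁻¹' {phi₂ hs κ Q} = {Q, (tau ht).map ((iota t).map Q)})
    {P₁ : E p} {P₂ : E q} (h : P₁.x = P₂.x) :
    halves (-P₁ + isog₂₁ hs ht κ hζ P₂) = halves (-P₂ + isog₁₂ hs ht κ hζ P₁) ∧
    halves (-P₁ - isog₂₁ hs ht κ hζ P₂) = halves (-P₂ - isog₁₂ hs ht κ hζ P₁) ∧
    twoTranslates P₁ = twoTranslates P₂ ∧
    (IsOfFinAddOrder P₁ → IsOfFinAddOrder P₂ →
      twoTranslates P₁ ∪ halves (-P₁ + isog₂₁ hs ht κ hζ P₂) ∪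
        halves (-P₁ - isog₂₁ hs ht κ hζ P₂) ⊆ commonTorsion p q) := by
  have hcong : ∀ {R₁ : E p} {R₂ : E q} {Q : C t},
      (lam p R₁ = phi₁ hs κ Q ∨ lam p R₁ = -phi₁ hs κ Q) →
      (lam q R₂ = phi₂ hs κ Q ∨ lam q R₂ = -phi₂ hs κ Q) → halves R₁ = halves R₂ := by
    intro R₁ R₂ Q h₁ h₂
    exact halves_congr (cross_trans (phi₁ hs κ Q).ne_zero (E'.cross_of_eq_or p h₁)
      (cross_trans (phi₂ hs κ Q).ne_zero (phi_cross hs κ Q) (E'.cross_of_eq_or q h₂).symm))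
  obtain ⟨G₁, G₂, ρ, Q, -, -, -, -, -, -, a₁, a₂, b₁, b₂⟩ :=
    M.exists_common_point ht hζ hκ₁ hκ₂ hfib₁ hfib₂ h rfl rfl
  have e₁ := hcong a₁ a₂
  have e₂ := hcong b₁ b₂
  have e₃ := twoTranslates_congr h
  refine ⟨e₁, e₂, e₃, fun o₁ o₂ => ?_⟩
  have i₁ := M.isOfFinAddOrder_isog₂₁ ht hζ hκ₁ hfib₂ o₂
  have i₂ := M.isOfFinAddOrder_isog₁₂ ht hζ hκ₂ hfib₁ o₁
  refine Set.union_subset (Set.union_subset ?_ ?_) ?_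
  · refine Set.subset_inter ?_ ?_
    · rw [twoTranslates_eq_halves]
      exact halves_subset_torsion o₁.nsmul
    · rw [e₃, twoTranslates_eq_halves]
      exact halves_subset_torsion o₂.nsmul
  · refine Set.subset_inter (halves_subset_torsion (o₁.neg.add i₁)) ?_
    rw [e₁]
    exact halves_subset_torsion (o₂.neg.add i₂)
  · refine Set.subset_inter (halves_subset_torsion ?_) ?_
    · rw [sub_eq_add_neg]
      exact o₁.neg.add i₁.neg
    · rw [e₂, sub_eq_add_neg]
      exact halves_subset_torsion (o₂.neg.add i₂.neg)

end FlexModel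

/-! ### Counting elements and the finite exceptional set -/

theorem ncard_psiFiber {A B : ℂ} (hA : A ≠ 0) (hB : B ≠ 0) (hAB : A ≠ B) :
    (psiFiber A B).ncard = 4 := by
  -- With a² = A/B, the root x = a + √(a² - 1) solves x + 1/x = 2a. The fiber is then {±x, ±1/x},
  -- which degenerates only for x² = ±1, that is for A/B = 1 or 0.
  obtain ⟨a, ha⟩ := IsAlgClosed.exists_pow_nat_eq (A / B) (n := 2) (by norm_num)
  obtain ⟨b, hb⟩ := IsAlgClosed.exists_pow_nat_eq (a ^ 2 - 1) (n := 2) (by norm_num)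
  have ha' : A = a ^ 2 * B := by rw [ha]; field_simp
  obtain ⟨x, hx⟩ : ∃ x, x = a + b := ⟨_, rfl⟩
  have hroot : x ^ 2 - 2 * a * x + 1 = 0 := by rw [hx]; linear_combination hb
  have hx0 : x ≠ 0 := by
    intro h
    rw [h] at hroot
    norm_num at hroot
  have h1 : x ^ 2 ≠ 1 := by
    intro h
    apply hAB
    have : a * x = 1 := by linear_combination (h - hroot) / 2
    rw [ha']
    linear_combination B * (a * x + 1) * this - a ^ 2 * B * h
  have h2 : x ^ 2 ≠ -1 := by
    intro h
    apply hA
    have : a * x = 0 := by linear_combination (h - hroot) / 2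
    rw [ha', (mul_eq_zero.mp this).resolve_right hx0]
    ring
  have hset : psiFiber A B
      = (fun z : ℂ => (z : OnePoint ℂ)) '' {x, x⁻¹, -x, -x⁻¹} := by
    ext ξ
    simp only [psiFiber, Set.mem_ofPred_eq, Set.mem_image, Set.mem_insert_iff,
      Set.mem_singleton_iff]
    constructor
    · rintro ⟨X, Z, ⟨rfl, rfl⟩ | ⟨rfl, rfl, -⟩, h⟩
      · refine ⟨X, ?_, rfl⟩
        have h' : (X - x) * (x * X - 1) * ((X + x) * (x * X + 1)) = 0 := by
          have e : (X ^ 2 + 1) ^ 2 - a ^ 2 * (4 * X ^ 2) = 0 := by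
            apply mul_left_cancel₀ hB
            rw [ha'] at h
            linear_combination -h
          have e' : 2 * (a * x) = x ^ 2 + 1 := by linear_combination -hroot
          linear_combination x ^ 2 * e + X ^ 2 * (2 * (a * x) + x ^ 2 + 1) * e'
        simp only [mul_eq_zero] at h'
        rcases h' with (h' | h') | h' | h'
        · exact Or.inl (by linear_combination h')
        · exact Or.inr (Or.inl (eq_inv_of_mul_eq_one_right (by linear_combination h')))
        · exact Or.inr (Or.inr (Or.inl (by linear_combination h')))
        · refine Or.inr (Or.inr (Or.inr ?_))
          rw [← neg_eq_iff_eq_neg]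
          exact eq_inv_of_mul_eq_one_right (by linear_combination -h')
      · exact absurd (by linear_combination -h) hB
    · have e' : 2 * (a * x) = x ^ 2 + 1 := by linear_combination -hroot
      rintro ⟨X, h, rfl⟩
      refine ⟨X, 1, Or.inl ⟨rfl, rfl⟩, ?_⟩
      rw [ha']
      apply mul_left_cancel₀ (pow_ne_zero 2 hx0)
      have h' : (X - x) * (x * X - 1) * ((X + x) * (x * X + 1)) = 0 := by
        rcases h with rfl | rfl | rfl | rfl
        · ring
        · rw [mul_inv_cancel₀ hx0]; ring
        · ring
        · rw [mul_neg, mul_inv_cancel₀ hx0]; ring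
      linear_combination B * X ^ 2 * (2 * (a * x) + x ^ 2 + 1) * e' - B * h'
  have n1 : x ≠ x⁻¹ := by
    intro h
    exact h1 (by rw [sq]; nth_rewrite 2 [h]; exact mul_inv_cancel₀ hx0)
  have n2 : x ≠ -x := fun h => hx0 (by linear_combination h / 2)
  have n3 : x ≠ -x⁻¹ := by
    intro h
    exact h2 (by rw [sq]; nth_rewrite 2 [h]; rw [mul_neg, mul_inv_cancel₀ hx0])
  have n4 : x⁻¹ ≠ -x := fun h => n3 (by rw [h, neg_neg])
  have n5 : x⁻¹ ≠ -x⁻¹ := fun h => inv_ne_zero hx0 (by linear_combination h / 2)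
  have n6 : -x ≠ -x⁻¹ := fun h => n1 (neg_injective h)
  rw [hset, Set.ncard_image_of_injective _ OnePoint.coe_injective,
    Set.ncard_insert_of_notMem (by simp [n1, n2, n3]),
    Set.ncard_insert_of_notMem (by simp [n4, n5]), Set.ncard_pair n6]

theorem x_eq_of_cross {n : ℕ} {F : BinForm n} {P : Cover F} {A B : ℂ} (h : A ≠ 0 ∨ B ≠ 0)
    (e : P.X * B = A * P.Z) :
    P.x = if B = 0 then OnePoint.infty else ((A / B : ℂ) : OnePoint ℂ) := by
  unfold Cover.x
  rcases P.norm with h1 | ⟨h1, h2⟩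
  · rw [h1, mul_one] at e
    have hB : B ≠ 0 := by
      rintro rfl
      rw [mul_zero] at e
      simp [← e] at h
    rw [if_neg hB, if_neg (by rw [h1]; exact one_ne_zero), ← e, mul_div_cancel_right₀ _ hB]
  · rw [h1, mul_zero, h2, one_mul] at e
    rw [if_pos h1, if_pos e]

theorem disjoint_psiFiber {p : Param} {R R' : E' p} (h : R.X * R'.Z ≠ R'.X * R.Z) :
    Disjoint (psiFiber R.X R.Z) (psiFiber R'.X R'.Z) := by
  rw [Set.disjoint_left]
  intro ξ h1 h2
  obtain ⟨P, rfl⟩ := exists_of_mem_psiFiber h1 p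
  rw [cross_psi_iff] at h1 h2
  exact h (cross_trans (psi p P).ne_zero h1.symm h2)

theorem ncard_psiFiber_of_Y_ne {p : Param} {R : E' p} (h : R.Y ≠ 0) :
    (psiFiber R.X R.Z).ncard = 4 := by
  have h1 : R.X * (R.X - R.Z) * (R.X - p.c * R.Z) * R.Z ≠ 0 := by
    have := R.eqn
    simp only [formE'] at this
    rw [← this]
    exact pow_ne_zero 2 h
  simp only [ne_eq, mul_eq_zero, not_or] at h1
  exact ncard_psiFiber h1.1.1.1 h1.2 fun e => h1.1.1.2 (by rw [e, sub_self])

section Phi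

variable {p q : Param} {t : ℂ} (hs : p.c ≠ q.c) {κ : CoverIso (formC t) (formFib p q)}
  (hb : κ.b = κ.a * t ^ 2) (hd : κ.d = -(κ.c * t ^ 2))

include hb hd

theorem a_c_ne : κ.a ≠ 0 ∧ κ.c ≠ 0 := by
  constructor <;> intro h <;> apply κ.det_ne <;> rw [hb, hd, h] <;> ring

theorem phi₁_Y_ne {Q : C t} {ρ X Y Z : ℂ}
    (hρ : ρ ≠ 0) (hX : Q.X = ρ * X) (hY : Q.Y = ρ ^ 3 * Y) (hZ : Q.Z = ρ * Z)
    (h : X + t ^ 2 * Z ≠ 0) (h' : Y ≠ 0) : (phi₁ hs κ Q).Y ≠ 0 := by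
  obtain ⟨σ, hσ, -, a2, -⟩ := phi₁_spec hs κ hρ hX hY hZ
  rw [a2, hb, show κ.a * X + κ.a * t ^ 2 * Z = κ.a * (X + t ^ 2 * Z) by ring]
  exact mul_ne_zero (pow_ne_zero 2 hσ) (mul_ne_zero (mul_ne_zero (a_c_ne hb hd).1 h)
    (mul_ne_zero κ.e_ne h'))

/-- In terms of X/T the x-coordinate of φ₁ has degree two and is invariant under inversion, so the
difference of two values factors as in `h`. -/
theorem phi₁_cross_ne {Q Q' : C t} {ρ X Y Z ρ' X' Y' Z' : ℂ}
    (hρ : ρ ≠ 0) (hX : Q.X = ρ * X) (hY : Q.Y = ρ ^ 3 * Y) (hZ : Q.Z = ρ * Z)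
    (hρ' : ρ' ≠ 0) (hX' : Q'.X = ρ' * X') (hY' : Q'.Y = ρ' ^ 3 * Y') (hZ' : Q'.Z = ρ' * Z')
    (h : (X * (t ^ 2 * Z') - X' * (t ^ 2 * Z)) * (X * X' - (t ^ 2 * Z) * (t ^ 2 * Z')) ≠ 0) :
    (phi₁ hs κ Q).X * (phi₁ hs κ Q').Z ≠ (phi₁ hs κ Q').X * (phi₁ hs κ Q).Z := by
  obtain ⟨σ, hσ, a1, -, a3⟩ := phi₁_spec hs κ hρ hX hY hZ
  obtain ⟨σ', hσ', b1, -, b3⟩ := phi₁_spec hs κ hρ' hX' hY' hZ'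
  obtain ⟨ha, hc⟩ := a_c_ne hb hd
  have hD : q.c - p.c ≠ 0 := sub_ne_zero.mpr hs.symm
  rw [a1, a3, b1, b3, hb, hd, ← sub_ne_zero]
  have : 4 * σ * σ' * κ.a ^ 2 * κ.c ^ 2 * (q.c - p.c) ≠ 0 := by simp [*]
  convert mul_ne_zero this h using 1
  ring

end Phi

namespace FlexModel

variable {p q : Param} {t : ℂ} {hs : p.c ≠ q.c} {κ : CoverIso (formC t) (formFib p q)}

/-- Only finitely many points of the line satisfy a given linear relation between the two
quartics. -/
theorem finite_pencil (M : FlexModel hs κ) {α β : ℂ} (h : α ≠ 0 ∨ β ≠ 0) :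
    {ξ : OnePoint ℂ | ∃ P : E p, P.x = ξ ∧
      α * flexQuartic M.k (M.v.1 * P.X + M.v.2 * P.Z) (M.u.1 * P.X + M.u.2 * P.Z)
      + β * flexQuartic M.l ((M.u.1 * P.X + M.u.2 * P.Z) - (M.v.1 * P.X + M.v.2 * P.Z))
        (M.u.1 * P.X + M.u.2 * P.Z) = 0}.Finite := by
  -- The form αF₁ + βF₂ divided by U⁴, as a polynomial in V/U. Its outer coefficients α + β and -kβ
  -- vanish together only for α = β = 0.
  obtain ⟨f, hf⟩ : ∃ f : Polynomial ℂ, f = .C (α + β) * .X ^ 4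
    + .C (2 * β - 6 * α) * .X ^ 3 + .C (9 * α - 3 * β) * .X ^ 2 + .C (M.k * (α + β)) * .X
    + .C (-(M.k * β)) := ⟨_, rfl⟩
  have hf0 : f ≠ 0 := by
    intro h0
    have c0 : f.eval 0 = -(M.k * β) := by simp [hf]
    have c4 : f.coeff 4 = α + β := by
      simp only [hf, Polynomial.coeff_add, Polynomial.coeff_C_mul, Polynomial.coeff_X_pow,
        Polynomial.coeff_X, Polynomial.coeff_C]
      norm_num
    rw [h0, Polynomial.eval_zero] at c0
    rw [h0, Polynomial.coeff_zero] at c4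
    have hβ : β = 0 := by
      have : M.k * β = 0 := by linear_combination c0
      simpa [M.k_ne] using this
    subst hβ
    have hα : α = 0 := by linear_combination -c4
    simp [hα] at h
  let g : ℂ × ℂ → OnePoint ℂ := fun w =>
    if w.2 = 0 then OnePoint.infty else ((w.1 / w.2 : ℂ) : OnePoint ℂ)
  refine (((f.roots.toFinset.finite_toSet.image fun v =>
    g (M.v.2 - M.u.2 * v, M.u.1 * v - M.v.1)).union (Set.finite_singleton
      (g (-M.u.2, M.u.1))))).subset ?_
  rintro _ ⟨P, rfl, e⟩
  obtain ⟨U, hU⟩ : ∃ U, U = M.u.1 * P.X + M.u.2 * P.Z := ⟨_, rfl⟩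
  obtain ⟨V, hV⟩ : ∃ V, V = M.v.1 * P.X + M.v.2 * P.Z := ⟨_, rfl⟩
  rw [← hU, ← hV] at e
  have hdet := M.det_ne
  -- U = 0 singles out one point of the line, the second finite set above.
  by_cases hU0 : U = 0
  · right
    refine x_eq_of_cross ?_ (by linear_combination hU0 - hU)
    by_contra! h0
    apply hdet
    have h1 : -M.u.2 = 0 := h0.1
    have h2 : M.u.1 = 0 := h0.2
    linear_combination M.v.1 * h1 + M.v.2 * h2
  · left
    refine ⟨V / U, ?_, ?_⟩
    · rw [Finset.mem_coe, Multiset.mem_toFinset, Polynomial.mem_roots hf0, Polynomial.IsRoot.def]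
      apply mul_left_cancel₀ (pow_ne_zero 4 hU0)
      simp only [hf, Polynomial.eval_add, Polynomial.eval_mul, Polynomial.eval_C,
        Polynomial.eval_pow, Polynomial.eval_X]
      simp only [flexQuartic] at e
      field_simp
      linear_combination e - β * (U - V) * U ^ 3 * M.add_eq
    · symm
      refine x_eq_of_cross ?_ ?_
      · by_contra! h0
        apply hdet
        linear_combination M.u.1 * h0.1 + M.u.2 * h0.2
      · apply mul_left_cancel₀ hU0
        field_simp
        rw [hU, hV]
        ring

theorem finite_exceptional (M : FlexModel hs κ) (ht : t ≠ 0) {ζ : ℂ} (hζ : IsPrimitiveRoot ζ 3)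
    (hb : κ.b = κ.a * t ^ 2) (hd : κ.d = -(κ.c * t ^ 2))
    (hκ₁ : ∀ Q : C t, phi₁ hs κ ((tau ht).map Q) = phi₁ hs κ Q)
    (hκ₂ : ∀ Q : C t, phi₂ hs κ ((tau ht).map ((iota t).map Q)) = phi₂ hs κ Q)
    (hfib₁ : ∀ Q : C t, phi₁ hs κ ⁻¹' {phi₁ hs κ Q} = {Q, (tau ht).map Q})
    (hfib₂ : ∀ Q : C t, phi₂ hs κ ⁻¹' {phi₂ hs κ Q} = {Q, (tau ht).map ((iota t).map Q)}) :
    {ξ : OnePoint ℂ | ∃ (P₁ : E p) (P₂ : E q), P₁.x = ξ ∧ P₂.x = ξ ∧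
      ¬ ((twoTranslates P₁).ncard = 4 ∧
        ((halves (-P₁ + isog₂₁ hs ht κ hζ P₂) ∪ halves (-P₁ - isog₂₁ hs ht κ hζ P₂))
          \ twoTranslates P₁).ncard = 8)}.Finite := by
  -- The bad values of X/T other than ∞: 0, the sixth roots of unity, and the zeros of Y.
  obtain ⟨b, hbp⟩ : ∃ b : Polynomial ℂ,
      b = .X * ((.X ^ 6 - 1) * (.X ^ 6 + .C (M.k + 2) * .X ^ 3 + 1)) :=
    ⟨_, rfl⟩
  have hb0 : b ≠ 0 := by
    rw [hbp]
    refine mul_ne_zero Polynomial.X_ne_zero (mul_ne_zero ?_ ?_)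
    · exact Polynomial.X_pow_sub_C_ne_zero (by norm_num) 1
    · intro h
      have := congrArg (Polynomial.eval 0) h
      simp at this
  refine ((b.roots.toFinset.finite_toSet.biUnion fun x _ => M.finite_pencil (α := (1 - x) ^ 2)
    (β := -(1 + x) ^ 2) ?_).union (M.finite_pencil (α := 1) (β := -1) (by norm_num))).subset ?_
  · by_contra! h
    have h1 : 1 - x = 0 := by simpa using h.1
    have h2 : 1 + x = 0 := by simpa using h.2
    have : (2 : ℂ) = 0 := by linear_combination h1 + h2
    norm_num at this
  rintro _ ⟨P₁, P₂, rfl, h, hbad⟩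
  obtain ⟨G₁, G₂, ρ, Q, hρ, e₁, e₂, hX, hZ, c₀, c₁, -, c₂, -⟩ :=
    M.exists_common_point ht hζ hκ₁ hκ₂ hfib₁ hfib₂ h.symm rfl rfl
  have hT : t ^ 2 * Q.Z = ρ * (G₁ + G₂) := by
    rw [hZ]
    field_simp
  obtain ⟨X, hX'⟩ : ∃ X, X = Q.X := ⟨_, rfl⟩
  obtain ⟨T, hT'⟩ : ∃ T, T = t ^ 2 * Q.Z := ⟨_, rfl⟩
  have hY := M.Y_sq Q
  rw [← hT', ← hX'] at hY
  -- Immediate from X : T = G₁ - G₂ : G₁ + G₂. For a fixed value of X/T it is a linear relation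
  -- between F₁ and F₂.
  have hrel : (T - X) ^ 2 * G₁ ^ 2 = (T + X) ^ 2 * G₂ ^ 2 := by
    rw [hT', hX', hT, hX]
    ring
  rw [e₁, e₂] at hrel
  -- Otherwise φ₁(Q), φ₁(σQ), φ₁(σ²Q) have distinct x-coordinates outside the branch points, so the
  -- three fibers are disjoint with four elements each and the point is not exceptional.
  have hsuff : T ≠ 0 → X * ((X ^ 6 - T ^ 6) * Q.Y ^ 2) = 0 := by
    intro hT0
    by_contra hne
    simp only [mul_eq_zero, not_or] at hne
    obtain ⟨hX0, h6, hY0⟩ := hne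
    replace hY0 : Q.Y ≠ 0 := fun h => hY0 (by rw [h]; norm_num)
    apply hbad
    obtain ⟨h0, iX, iY, iZ⟩ := C.coords Q
    obtain ⟨ρ', hρ', jX, jY, jZ⟩ := sigma_spec hζ h0 iX iY iZ
    obtain ⟨ρ'', hρ'', kX, kY, kZ⟩ := sigma_spec hζ hρ' jX jY jZ
    have h3 := hζ.pow_eq_one
    have h1 := sub_ne_zero.mpr (hζ.ne_one (by norm_num))
    have hz := hζ.ne_zero (by norm_num)
    have hlin : ∀ c : ℂ, c ^ 3 = 1 → c * X + T ≠ 0 ∧ c * X ^ 2 - T ^ 2 ≠ 0 := by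
      intro c hc
      refine ⟨fun e => h6 ?_, fun e => h6 ?_⟩
      · have e' : (c * X) ^ 6 = (-T) ^ 6 := by rw [eq_neg_of_add_eq_zero_left e]
        linear_combination e' - X ^ 6 * (c ^ 3 + 1) * hc
      · have e' : (c * X ^ 2) ^ 3 = (T ^ 2) ^ 3 := by rw [sub_eq_zero.mp e]
        linear_combination e' - X ^ 6 * hc
    have hS : ∀ {R : E p} {Q' : C t}, (lam p R = phi₁ hs κ Q' ∨ lam p R = -phi₁ hs κ Q') →
        halves R = psiFiber (phi₁ hs κ Q').X (phi₁ hs κ Q').Z := by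
      intro R Q' hR
      rw [halves_eq]
      exact psiFiber_congr (lam p R).ne_zero (phi₁ hs κ Q').ne_zero (E'.cross_of_eq_or p hR)
    rw [twoTranslates_eq_halves, hS c₀, hS c₁, hS c₂]
    have hc2 : (ζ ^ 2) ^ 3 = 1 := by linear_combination (ζ ^ 3 + 1) * h3
    have y₀ := phi₁_Y_ne hs hb hd h0 iX iY iZ
      (by simpa [← hX', ← hT'] using (hlin 1 (by norm_num)).1) hY0
    have y₁ := phi₁_Y_ne hs hb hd hρ' jX jY jZ
      (by rw [← hX', ← hT']; exact (hlin ζ h3).1) hY0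
    have y₂ := phi₁_Y_ne hs hb hd hρ'' kX kY kZ
      (by rw [← hX', ← hT', ← mul_assoc, ← sq]; exact (hlin _ hc2).1) hY0
    have d₁ := disjoint_psiFiber (phi₁_cross_ne hs hb hd hρ' jX jY jZ h0 iX iY iZ (by
      rw [← hX', ← hT']
      convert mul_ne_zero (mul_ne_zero h1 (mul_ne_zero hX0 hT0)) (hlin ζ h3).2 using 1
      ring))
    have d₂ := disjoint_psiFiber (phi₁_cross_ne hs hb hd hρ'' kX kY kZ h0 iX iY iZ (by
      rw [← hX', ← hT']
      have h1' : ζ ^ 2 - 1 ≠ 0 := fun e => h1 (by linear_combination h3 - ζ * e)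
      convert mul_ne_zero (mul_ne_zero h1' (mul_ne_zero hX0 hT0)) (hlin _ hc2).2 using 1
      ring))
    have d₃ := disjoint_psiFiber (phi₁_cross_ne hs hb hd hρ' jX jY jZ hρ'' kX kY kZ (by
      rw [← hX', ← hT']
      convert mul_ne_zero (mul_ne_zero (mul_ne_zero (neg_ne_zero.mpr hz) h1)
        (mul_ne_zero hX0 hT0)) (hlin 1 (by norm_num)).2 using 1
      linear_combination ζ * (1 - ζ) * X * T * X ^ 2 * h3))
    refine ⟨ncard_psiFiber_of_Y_ne y₀, ?_⟩
    have n₁ := ncard_psiFiber_of_Y_ne y₁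
    have n₂ := ncard_psiFiber_of_Y_ne y₂
    rw [(Set.disjoint_union_left.mpr ⟨d₁, d₂⟩).sdiff_eq_left, Set.ncard_union_eq d₃
      (Set.finite_of_ncard_ne_zero (by rw [n₁]; norm_num))
      (Set.finite_of_ncard_ne_zero (by rw [n₂]; norm_num)), n₁, n₂]
  -- The value X/T = ∞ corresponds to the member F₁ - F₂ of the pencil.
  by_cases hT0 : T = 0
  · right
    refine ⟨P₁, rfl, ?_⟩
    have hX0 : X ≠ 0 := by
      have := M.coords_ne Q
      rw [← hX', ← hT'] at this
      simpa [hT0] using this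
    apply mul_left_cancel₀ (pow_ne_zero 2 hX0)
    rw [hT0] at hrel
    linear_combination hrel
  · left
    have hx := hsuff hT0
    rw [hY] at hx
    simp only [Set.mem_iUnion]
    refine ⟨X / T, ?_, P₁, rfl, ?_⟩
    · rw [Finset.mem_coe, Multiset.mem_toFinset, Polynomial.mem_roots hb0, Polynomial.IsRoot.def]
      apply mul_left_cancel₀ (pow_ne_zero 13 hT0)
      simp only [hbp, Polynomial.eval_add, Polynomial.eval_sub, Polynomial.eval_mul,
        Polynomial.eval_C, Polynomial.eval_pow, Polynomial.eval_X, Polynomial.eval_one]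
      field_simp
      linear_combination hx
    · generalize flexQuartic M.k _ _ = F₁ at hrel ⊢
      generalize flexQuartic M.l _ _ = F₂ at hrel ⊢
      apply mul_left_cancel₀ (pow_ne_zero 2 hT0)
      field_simp
      linear_combination hrel

end FlexModel

end PoonenPairs

end

open PoonenPairs in
theorem mainTheorem9 (s₁ s₂ : Param) (hs : s₁.c ≠ s₂.c) (S₁ : E s₁) (S₂ : E s₂)
    (hS₁ : addOrderOf S₁ = 3) (hS₂ : addOrderOf S₂ = 3) (hS : S₁.x = S₂.x) :
    (∃ (t : ℂ) (ht : t ≠ 0) (κ : CoverIso (formC t) (formFib s₁ s₂)),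
      t ^ 12 ≠ 1 ∧ IsModel hs S₁ S₂ ht κ) ∧
    ∀ (t : ℂ) (ht : t ≠ 0) (κ : CoverIso (formC t) (formFib s₁ s₂)) (ζ : ℂ)
      (hζ : IsPrimitiveRoot ζ 3), t ^ 12 ≠ 1 → IsModel hs S₁ S₂ ht κ →
      (∀ (P₁ : E s₁) (P₂ : E s₂), P₁.x = P₂.x →
        halves (-P₁ + isog₂₁ hs ht κ hζ P₂) = halves (-P₂ + isog₁₂ hs ht κ hζ P₁) ∧
        halves (-P₁ - isog₂₁ hs ht κ hζ P₂) = halves (-P₂ - isog₁₂ hs ht κ hζ P₁) ∧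
        twoTranslates P₁ = twoTranslates P₂ ∧
        (IsOfFinAddOrder P₁ → IsOfFinAddOrder P₂ →
          twoTranslates P₁ ∪ halves (-P₁ + isog₂₁ hs ht κ hζ P₂) ∪
            halves (-P₁ - isog₂₁ hs ht κ hζ P₂) ⊆ commonTorsion s₁ s₂)) ∧
      {ξ : OnePoint ℂ | ∃ (P₁ : E s₁) (P₂ : E s₂), P₁.x = ξ ∧ P₂.x = ξ ∧
        ¬ ((twoTranslates P₁).ncard = 4 ∧
          ((halves (-P₁ + isog₂₁ hs ht κ hζ P₂) ∪ halves (-P₁ - isog₂₁ hs ht κ hζ P₂))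
            \ twoTranslates P₁).ncard = 8)}.Finite := by
  obtain ⟨r, n, hX₁, hZ₁, hX₂, hZ₂, h, hq⟩ := exists_isFlexParam hs hS₁ hS₂ hS
  refine ⟨exists_isModel hs h hq hX₁ hZ₁ hX₂ hZ₂, fun t ht κ ζ hζ _ hκ => ?_⟩
  obtain ⟨hb, hd, ha⟩ := coeffs_of_isModel hs ht h hq hX₁ hZ₁ hX₂ hZ₂ hκ
  obtain ⟨M⟩ := nonempty_flexModel hs ht h hq hb hd ha
  obtain ⟨hκ₁, hκ₂, -, -⟩ := hκ
  have hfib₁ := preimage_phi₁ hs ht hκ₁ hb hd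
  have hfib₂ := preimage_phi₂ hs ht hκ₂ hb hd
  exact ⟨fun P₁ P₂ h => M.halves_and_torsion ht hζ hκ₁ hκ₂ hfib₁ hfib₂ h,
    M.finite_exceptional ht hζ hb hd hκ₁ hκ₂ hfib₁ hfib₂⟩
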